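/- Let $N\ge 1$. The Davey–Stewartson system is $$\mathrm i\psi_t+\psi_{xx}-\alpha^2\psi_{yy}+2(\Phi+\rho|\psi|^2)\psi=0,\qquad \Phi_{xx}+\alpha^2\Phi_{yy}+2\rho\,(|\psi|^2)_{xx}=0,$$ with $\rho=\pm1$, $x,y,t$ real, $\psi$ complex valued and $\Phi$ real valued; DS1$^\rho$ is the case $\alpha=\mathrm i$ and DS2$^\rho$ the case $\alpha=1$. Put $\xi=\frac12(x-\mathrm i\alpha y)$, $\eta=\frac12(x+\mathrm i\alpha y)$ and $\phi=\Phi+\rho|\psi|^2$; solutions are given below as functions $\psi,\phi$ of $(\xi,\eta,t)$. For a function $\tau$ of independent complex variables $\xi,\eta,t$ put $\phi[\tau]=\frac12(\ln\tau)_{\xi\xi}+\frac12(\ln\tau)_{\eta\eta}+\frac h4$. Throughout $h,\theta\in\mathbb R$. **Determinantal functions.** Let $g\ge1$, $a,b,u_k,v_k,d_k\in\mathbb C$ and $\kappa_1,\kappa_2\in\mathbb C\setminus\{0\}$ with $a\ne b$ and $v_i\neq u_k$ for all $1\le i,k\le g$. For $c\in\{a,b\}$ put $V_{c,k}=\frac1{c-v_k}-\frac1{c-u_k}$,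 $W_{c,k}=-\frac1{(c-v_k)^2}+\frac1{(c-u_k)^2}$, $r_k=\ln\big\{\frac{b-v_k}{b-u_k}\frac{a-u_k}{a-v_k}\big\}$, $Z_k=\mathrm i\kappa_1V_{a,k}\xi-\mathrm i\kappa_2V_{b,k}\eta+\mathrm i(\kappa_1^2W_{a,k}-\kappa_2^2W_{b,k})\frac t2$, $G_1=\frac{\kappa_1}{b-a}$, $G_2=\frac{\kappa_2}{a-b}$, $G_3=-G_1^2-G_2^2+h$, and let $\mathbb T_\beta$ be the $g\times g$ matrix with entries $\delta_{ik}+\frac{v_i-u_i}{v_i-u_k}e^{\frac12(z_i+z_k)}$, $z_k=Z_k-d_k+\beta r_k$. Put $A=|\kappa_1\kappa_2|^{1/2}|a-b|^{-1}$ and $$\psi=A e^{\mathrm i\theta}\,\frac{\det\mathbb T_1}{\det\mathbb T_0}\,e^{-\mathrm i(G_1\xi+G_2\eta-G_3t/2)},\qquad \phi=\phi[\det\mathbb T_0].\tag{1}$$ **Asymptotics.** With phases $Z_k$ linear in $(\xi,\eta,t)$, "$|\psi|\to L$ in all generic directions" means: for every $t$, every point $(x_0,y_0)$ and every direction $(c_1,c_2)$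 along which no $\operatorname{Re}Z_k$ is constant, the denominator of $\psi$ is non-zero at $(x_0+sc_1,y_0+sc_2,t)$ for all large $s$ and $|\psi|\to L$ there as $s\to+\infty$. **(i) Dark $N$-solitons of DS1$^\rho$.** Let $g=N$. If $a,b,\kappa_1,\kappa_2,d_k\in\mathbb R$ and $\overline{v_k}=u_k$, then $\det\mathbb T_0\neq0$ for all real $x,y,t$ and (1) defines a $C^\infty$ solution of DS1$^\rho$ on $\mathbb R^3$ with $\rho=-\operatorname{sign}(\kappa_1\kappa_2)$. If moreover the $v_k$ are pairwise distinct, then $|\psi|\to A>0$ in all generic directions. **(ii) Dark $N$-solitons of DS2$^+$.** Let $g=N$. If $\overline a=b$, $\overline{\kappa_1}=\kappa_2$ and $u_k,v_k,d_k\in\mathbb R$, then (1) defines a $C^\infty$ solution of DS2$^+$ on the open set where $\det\mathbb T_0\ne0$. If moreover $v_1<u_1<v_2<u_2<\dots<v_N<u_N$, then $\det\mathbb T_0\neq0$ for all real $x,y,t$, and the solution is $C^\infty$ on $\mathbb R^3$. If the $u_k$ are pairwise distinct and the $v_k$ are pairwise distinct, then $|\psi|\to A>0$ in all generic directions. **Bright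 functions.** Let $\hat\kappa_1,\hat\kappa_2\in\mathbb C\setminus\{0\}$, $\hat d_i\in\mathbb C$, and $\alpha_{u_i},\alpha_{v_i}\in\mathbb C\setminus\{0\}$ for $1\le i\le 2N$, with $\alpha_{v_i}\ne\alpha_{u_k}$ whenever $i,k$ have different parity. Put $z_i=Z_i-\hat d_i$, where $Z_{2k-1}=\mathrm i\hat\kappa_1\alpha_{u_{2k-1}}\xi+\mathrm i\hat\kappa_2\alpha_{v_{2k-1}}\eta+\mathrm i(\hat\kappa_1^2\alpha_{u_{2k-1}}^2+\hat\kappa_2^2\alpha_{v_{2k-1}}^2)\frac t2$, $Z_{2k}=-\mathrm i\hat\kappa_1\alpha_{v_{2k}}\xi-\mathrm i\hat\kappa_2\alpha_{u_{2k}}\eta-\mathrm i(\hat\kappa_1^2\alpha_{v_{2k}}^2+\hat\kappa_2^2\alpha_{u_{2k}}^2)\frac t2$, and $\hat r_i=(-1)^i\ln\{-\alpha_{v_i}\alpha_{u_i}\}$. Let $\mathbb K,\mathbb M$ be the $2N\times2N$ matrices with $\mathbb M_{ik}=\delta_{ik}$ for $i,k$ of the same parity, $\mathbb M_{ik}=(-1)^{i+1}\frac{\alpha_{v_i}\alpha_{u_k}}{\alpha_{v_i}-\alpha_{u_k}}e^{\frac12(z_i+z_k)}$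 otherwise, and - $i,k$ odd: $\mathbb K_{ik}=\delta_{ik}$; - $i$ odd, $k$ even: $\mathbb K_{ik}=\frac{\alpha_{v_i}\alpha_{u_k}}{\alpha_{v_i}-\alpha_{u_k}}e^{\frac12(z_i+z_k+\hat r_i+\hat r_k)}$; - $i$ even, $k$ odd: $\mathbb K_{ik}=-\frac{\alpha_{u_k}^2}{\alpha_{v_i}-\alpha_{u_k}}\frac{\alpha_{v_2}-\alpha_{v_i}}{\alpha_{v_2}-\alpha_{u_k}}e^{\frac12(z_i+z_k+\hat r_i+\hat r_k)}$; - $i,k$ even: $\mathbb K_{ik}=\delta_{ik}-\delta_{2,i}\delta_{2,k}+\delta_{2,i}e^{\frac12(z_2+z_k+\hat r_2+\hat r_k)}+\delta_{2,k}(\delta_{2,i}-1)e^{\frac12(z_i-z_2+\hat r_i-\hat r_2)}$. Put $$\psi=|\hat\kappa_1\hat\kappa_2|^{1/2}e^{\mathrm i\theta}\,\frac{\det\mathbb K}{\det\mathbb M}\,e^{\mathrm iht/2},\qquad\phi=\phi[\det\mathbb M].\tag{2}$$ **(iii) Degeneration.** For any $a\ne b$ in $\mathbb C$ take in (1) $g=2N$,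 $u_{2k-1}=a+\epsilon\alpha_{u_{2k-1}}^{-1}(a-b)$, $v_{2k-1}=b+\epsilon\alpha_{v_{2k-1}}^{-1}(a-b)$, $u_{2k}=b+\epsilon\alpha_{u_{2k}}^{-1}(a-b)$, $v_{2k}=a+\epsilon\alpha_{v_{2k}}^{-1}(a-b)$, $\kappa_j=\epsilon\hat\kappa_j(a-b)$, $d_i=-\ln\epsilon+\hat d_i$. Then, at each $(\xi,\eta,t)\in\mathbb C^3$ with $\det\mathbb M\ne0$, the functions (1) tend to the functions (2) as $\epsilon\to0^+$. **(iv) Bright $N$-solitons of DS1$^\rho$.** If $\hat\kappa_1,\hat\kappa_2\in\mathbb R$, $\overline{\hat d_{2k-1}}=\hat d_{2k}$, $\overline{\alpha_{u_{2k-1}}}=\alpha_{v_{2k}}$ and $\overline{\alpha_{u_{2k}}}=\alpha_{v_{2k-1}}$ for $1\le k\le N$, then (2) defines a $C^\infty$ solution of DS1$^\rho$, $\rho=-\operatorname{sign}(\hat\kappa_1\hat\kappa_2)$, on the open set where $\det\mathbb M\neq0$. **(v) Bright $N$-solitons of DS2$^-$.** If $\overline{\hat\kappa_1}=\hat\kappa_2$,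 $\overline{\hat d_{2k-1}}=\hat d_{2k}$, $\overline{\alpha_{u_{2k-1}}}=\alpha_{u_{2k}}$ and $\overline{\alpha_{v_{2k-1}}}=\alpha_{v_{2k}}$ for $1\le k\le N$, then (2) defines a $C^\infty$ solution of DS2$^-$ on the open set where $\det\mathbb M\neq0$. In (iv) and (v), if the $\alpha_{u_{2k-1}}$ are pairwise distinct and the $\alpha_{v_{2k-1}}$ are pairwise distinct, then $|\psi|\to0$ in all generic directions. -/

import Mathlib

open scoped ContDiff Topology ComplexConjugate

noncomputable section

/-! ## The Davey-Stewartson system -/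

/-- The first characteristic coordinate `ξ = (x - iαy)/2`. -/
def dsXi (α : ℂ) (x y : ℝ) : ℂ := ((x : ℂ) - Complex.I * α * y) / 2

/-- The second characteristic coordinate `η = (x + iαy)/2`. -/
def dsEta (α : ℂ) (x y : ℝ) : ℂ := ((x : ℂ) + Complex.I * α * y) / 2

/-- `(ψ, Φ)` is a smooth solution, on the open set `U` of points `(x, y, t)`, of the system
`i ψ_t + ψ_xx - α² ψ_yy + 2 (Φ + ρ |ψ|²) ψ = 0`, `Φ_xx + α² Φ_yy + 2 ρ (|ψ|²)_xx = 0`.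
The system DS1 with sign `ρ` is the case `α = i`, and DS2 with sign `ρ` the case `α = 1`. -/
structure IsDSSolutionOn (α : ℂ) (ρ : ℝ) (U : Set (ℝ × ℝ × ℝ))
    (ψ : ℝ → ℝ → ℝ → ℂ) (Φ : ℝ → ℝ → ℝ → ℝ) : Prop where
  isOpen : IsOpen U
  smooth_psi : ContDiffOn ℝ ∞ (fun p : ℝ × ℝ × ℝ => ψ p.1 p.2.1 p.2.2) U
  smooth_Phi : ContDiffOn ℝ ∞ (fun p : ℝ × ℝ × ℝ => Φ p.1 p.2.1 p.2.2) U
  eq_psi : ∀ x y t : ℝ, (x, y, t) ∈ U →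
    Complex.I * deriv (fun s => ψ x y s) t
      + iteratedDeriv 2 (fun s => ψ s y t) x
      - α ^ 2 * iteratedDeriv 2 (fun s => ψ x s t) y
      + 2 * (((Φ x y t + ρ * ‖ψ x y t‖ ^ 2 : ℝ)) : ℂ) * ψ x y t = 0
  eq_Phi : ∀ x y t : ℝ, (x, y, t) ∈ U →
    ((iteratedDeriv 2 (fun s => Φ s y t) x : ℝ) : ℂ)
      + α ^ 2 * ((iteratedDeriv 2 (fun s => Φ x s t) y : ℝ) : ℂ)
      + 2 * (ρ : ℂ) * ((iteratedDeriv 2 (fun s => ‖ψ s y t‖ ^ 2) x : ℝ) : ℂ) = 0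

/-- Functions `ψ` and `φ = Φ + ρ |ψ|²`, given in the variables `(ξ, η, t)`, define a smooth
solution of the Davey-Stewartson system on `U`; in particular `Φ = φ - ρ |ψ|²` is real there. -/
def SolvesDSOn (α : ℂ) (ρ : ℝ) (U : Set (ℝ × ℝ × ℝ)) (ψ φ : ℂ → ℂ → ℂ → ℂ) : Prop :=
  ∃ Φ : ℝ → ℝ → ℝ → ℝ,
    (∀ x y t : ℝ, (x, y, t) ∈ U →
      φ (dsXi α x y) (dsEta α x y) t
        = (Φ x y t : ℂ) + ρ * (‖ψ (dsXi α x y) (dsEta α x y) t‖ : ℂ) ^ 2) ∧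
    IsDSSolutionOn α ρ U (fun x y t => ψ (dsXi α x y) (dsEta α x y) t) Φ

/-- The points `(x, y, t)` where the denominator `τ` does not vanish. -/
def dsRegularSet (α : ℂ) (τ : ℂ → ℂ → ℂ → ℂ) : Set (ℝ × ℝ × ℝ) :=
  {p | τ (dsXi α p.1 p.2.1) (dsEta α p.1 p.2.1) p.2.2 ≠ 0}

/-- At every fixed time, along every ray of the `(x, y)`-plane whose direction `(c₁, c₂)` is not
parallel to one of the solitons (the real parts of the phases `Z_k`, linear in `(ξ, η, t)`, are not
constant along it), the denominator `τ` eventually does not vanish and `|ψ|` tends to `L`. -/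
def HasSolitonBackground {κ : Type*} (α : ℂ) (Z : ℂ → ℂ → ℂ → κ → ℂ)
    (τ ψ : ℂ → ℂ → ℂ → ℂ) (L : ℝ) : Prop :=
  ∀ x₀ y₀ t c₁ c₂ : ℝ, (∀ k, (Z (dsXi α c₁ c₂) (dsEta α c₁ c₂) 0 k).re ≠ 0) →
    (∀ᶠ s : ℝ in Filter.atTop, (x₀ + s * c₁, y₀ + s * c₂, t) ∈ dsRegularSet α τ) ∧
    Filter.Tendsto
      (fun s : ℝ => ‖ψ (dsXi α (x₀ + s * c₁) (y₀ + s * c₂))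
        (dsEta α (x₀ + s * c₁) (y₀ + s * c₂)) t‖) Filter.atTop (𝓝 L)

/-- `½ (ln τ)_ξξ + ½ (ln τ)_ηη + h/4`, for `τ` a function of independent complex variables
`ξ, η, t`; `(ln τ)_ξξ` is the `ξ`-derivative of `τ_ξ / τ`. -/
def dsPhi (τ : ℂ → ℂ → ℂ → ℂ) (h : ℝ) (ξ η t : ℂ) : ℂ :=
  1 / 2 * deriv (logDeriv fun s => τ s η t) ξ
    + 1 / 2 * deriv (logDeriv fun s => τ ξ s t) η + (h : ℂ) / 4

/-! ## The determinantal functions -/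

/-- The parameters of the determinantal functions: `w_a, w_b, κ₁, κ₂, h, θ`, and
`w_{u_k}, w_{v_k}, d_k` for `k` in the index set `ι`. -/
structure DSParams (ι : Type*) where
  a : ℂ
  b : ℂ
  κ₁ : ℂ
  κ₂ : ℂ
  h : ℝ
  θ : ℝ
  u : ι → ℂ
  v : ι → ℂ
  d : ι → ℂ

namespace DSParams

variable {ι : Type*} (p : DSParams ι)

/-- `V_{c,k} = 1/(w_c - w_{v_k}) - 1/(w_c - w_{u_k})`. -/
def V (c : ℂ) (k : ι) : ℂ := 1 / (c - p.v k) - 1 / (c - p.u k)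

/-- `W_{c,k} = -1/(w_c - w_{v_k})² + 1/(w_c - w_{u_k})²`. -/
def W (c : ℂ) (k : ι) : ℂ := -(1 / (c - p.v k) ^ 2) + 1 / (c - p.u k) ^ 2

/-- The scalars `r_k`. -/
def r (k : ι) : ℂ :=
  Complex.log ((p.b - p.v k) / (p.b - p.u k) * ((p.a - p.u k) / (p.a - p.v k)))

/-- The phases `Z_k`. -/
def Z (ξ η t : ℂ) (k : ι) : ℂ :=
  Complex.I * p.κ₁ * p.V p.a k * ξ - Complex.I * p.κ₂ * p.V p.b k * η
    + Complex.I * (p.κ₁ ^ 2 * p.W p.a k - p.κ₂ ^ 2 * p.W p.b k) * (t / 2)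

def G₁ : ℂ := p.κ₁ / (p.b - p.a)

def G₂ : ℂ := p.κ₂ / (p.a - p.b)

def G₃ : ℂ := -p.G₁ ^ 2 - p.G₂ ^ 2 + p.h

/-- The amplitude `A = |κ₁ κ₂|^{1/2} |w_a - w_b|⁻¹`. -/
def A : ℝ := Real.sqrt ‖p.κ₁ * p.κ₂‖ / ‖p.a - p.b‖

variable [Fintype ι] [DecidableEq ι]

/-- The matrix `T_β` (used for `β = 0, 1`), with
`z_k = Z_k - d_k + β r_k`. -/
def T (β : ℂ) (ξ η t : ℂ) : Matrix ι ι ℂ :=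
  Matrix.of fun i k =>
    (if i = k then 1 else 0) + (p.v i - p.u i) / (p.v i - p.u k) *
      Complex.exp (1 / 2 * ((p.Z ξ η t i - p.d i + β * p.r i) + (p.Z ξ η t k - p.d k + β * p.r k)))

/-- The denominator `det T_0`. -/
def tau (ξ η t : ℂ) : ℂ := (p.T 0 ξ η t).det

/-- `ψ = A e^{iθ} (det T_1 / det T_0) exp(-i (G₁ ξ + G₂ η - G₃ t/2))`. -/
def psi (ξ η t : ℂ) : ℂ :=
  p.A * Complex.exp (Complex.I * p.θ) * ((p.T 1 ξ η t).det / (p.T 0 ξ η t).det) *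
    Complex.exp (-Complex.I * (p.G₁ * ξ + p.G₂ * η - p.G₃ * (t / 2)))

/-- `φ = ½ (ln det T_0)_ξξ + ½ (ln det T_0)_ηη + h/4`. -/
def phi (ξ η t : ℂ) : ℂ := dsPhi p.tau p.h ξ η t

end DSParams

namespace DSParams

/-- The points are such that all the expressions above make sense: `w_a ≠ w_b`,
`w_{v_i} ≠ w_{u_k}` for all `i, k`, and `κ₁, κ₂ ≠ 0`. -/
structure Admissible {ι : Type*} (p : DSParams ι) : Prop where
  a_ne_b : p.a ≠ p.b
  κ₁_ne : p.κ₁ ≠ 0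
  κ₂_ne : p.κ₂ ≠ 0
  v_ne_u : ∀ i k, p.v i ≠ p.u k

/-- The reality condition for dark solitons of DS1: `w_a, w_b, κ₁, κ₂, d_k` are real and
`conj w_{v_k} = w_{u_k}`. -/
structure DarkRealityDS1 {ι : Type*} (p : DSParams ι) : Prop where
  a_real : conj p.a = p.a
  b_real : conj p.b = p.b
  κ₁_real : conj p.κ₁ = p.κ₁
  κ₂_real : conj p.κ₂ = p.κ₂
  d_real : ∀ k, conj (p.d k) = p.d k
  conj_v : ∀ k, conj (p.v k) = p.u k

/-- The reality condition for dark solitons of DS2: `conj w_a = w_b`, `conj κ₁ = κ₂`, and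
`w_{u_k}, w_{v_k}, d_k` are real. -/
structure DarkRealityDS2 {ι : Type*} (p : DSParams ι) : Prop where
  conj_a : conj p.a = p.b
  conj_κ₁ : conj p.κ₁ = p.κ₂
  d_real : ∀ k, conj (p.d k) = p.d k
  u_real : ∀ k, conj (p.u k) = p.u k
  v_real : ∀ k, conj (p.v k) = p.v k

/-- `w_{v_1} < w_{u_1} < w_{v_2} < w_{u_2} < ... < w_{v_N} < w_{u_N}` (for real points). -/
def Ordered {N : ℕ} (p : DSParams (Fin N)) : Prop :=
  (∀ k, (p.v k).re < (p.u k).re) ∧ ∀ i k, i < k → (p.u i).re < (p.v k).re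

end DSParams

/-! ## The bright solitons

The indices `1, ..., 2N` are the elements of `Fin N ⊕ Fin N`: with `k : Fin N` counted from `0`,
`Sum.inl k` is the odd index `2k + 1` and `Sum.inr k` is the even index `2k + 2`. So the index `2`
is `Sum.inr 0`. -/

/-- The parameters `κ̂₁, κ̂₂, h, θ` and `α_{u_i}, α_{v_i}, d̂_i` for `i = 1, ..., 2N`. -/
structure BrightParams (N : ℕ) where
  κ₁ : ℂ
  κ₂ : ℂ
  h : ℝ
  θ : ℝ
  αu : Fin N ⊕ Fin N → ℂ
  αv : Fin N ⊕ Fin N → ℂ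
  d : Fin N ⊕ Fin N → ℂ

namespace BrightParams

variable {N : ℕ} (q : BrightParams N)

/-- The linear part `z_i + d̂_i` of the phase `z_i`. -/
def Z (ξ η t : ℂ) : Fin N ⊕ Fin N → ℂ
  | .inl k =>
      Complex.I * q.κ₁ * q.αu (.inl k) * ξ + Complex.I * q.κ₂ * q.αv (.inl k) * η
        + Complex.I * (q.κ₁ ^ 2 * q.αu (.inl k) ^ 2 + q.κ₂ ^ 2 * q.αv (.inl k) ^ 2) * (t / 2)
  | .inr k =>
      -(Complex.I * q.κ₁ * q.αv (.inr k) * ξ) - Complex.I * q.κ₂ * q.αu (.inr k) * η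
        - Complex.I * (q.κ₁ ^ 2 * q.αv (.inr k) ^ 2 + q.κ₂ ^ 2 * q.αu (.inr k) ^ 2) * (t / 2)

/-- The phases `z_i`. -/
def z (ξ η t : ℂ) (i : Fin N ⊕ Fin N) : ℂ := q.Z ξ η t i - q.d i

/-- `r̂_i = (-1)^i ln(-α_{v_i} α_{u_i})`. -/
def r : Fin N ⊕ Fin N → ℂ
  | .inl k => -Complex.log (-(q.αv (.inl k) * q.αu (.inl k)))
  | .inr k => Complex.log (-(q.αv (.inr k) * q.αu (.inr k)))

/-- The matrix `M`. -/
def M (ξ η t : ℂ) : Matrix (Fin N ⊕ Fin N) (Fin N ⊕ Fin N) ℂ :=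
  Matrix.of fun i k => match i, k with
    | .inl i, .inl k => if i = k then 1 else 0
    | .inr i, .inr k => if i = k then 1 else 0
    | .inl i, .inr k =>
        q.αv (.inl i) * q.αu (.inr k) / (q.αv (.inl i) - q.αu (.inr k)) *
          Complex.exp (1 / 2 * (q.z ξ η t (.inl i) + q.z ξ η t (.inr k)))
    | .inr i, .inl k =>
        -(q.αv (.inr i) * q.αu (.inl k) / (q.αv (.inr i) - q.αu (.inl k))) *
          Complex.exp (1 / 2 * (q.z ξ η t (.inr i) + q.z ξ η t (.inl k)))

/-- The matrix `K`. -/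
def K [NeZero N] (ξ η t : ℂ) : Matrix (Fin N ⊕ Fin N) (Fin N ⊕ Fin N) ℂ :=
  Matrix.of fun i k => match i, k with
    | .inl i, .inl k => if i = k then 1 else 0
    | .inl i, .inr k =>
        q.αv (.inl i) * q.αu (.inr k) / (q.αv (.inl i) - q.αu (.inr k)) *
          Complex.exp (1 / 2 *
            (q.z ξ η t (.inl i) + q.z ξ η t (.inr k) + q.r (.inl i) + q.r (.inr k)))
    | .inr i, .inl k =>
        -(q.αu (.inl k) ^ 2 / (q.αv (.inr i) - q.αu (.inl k))) *
          ((q.αv (.inr 0) - q.αv (.inr i)) / (q.αv (.inr 0) - q.αu (.inl k))) *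
          Complex.exp (1 / 2 *
            (q.z ξ η t (.inr i) + q.z ξ η t (.inl k) + q.r (.inr i) + q.r (.inl k)))
    | .inr i, .inr k =>
        (if i = k then 1 else 0) - (if i = 0 ∧ k = 0 then 1 else 0)
          + (if i = 0 then Complex.exp (1 / 2 *
              (q.z ξ η t (.inr 0) + q.z ξ η t (.inr k) + q.r (.inr 0) + q.r (.inr k))) else 0)
          - (if k = 0 ∧ i ≠ 0 then Complex.exp (1 / 2 *
              (q.z ξ η t (.inr i) - q.z ξ η t (.inr 0) + q.r (.inr i) - q.r (.inr 0))) else 0)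

/-- The denominator `det M`. -/
def tau (ξ η t : ℂ) : ℂ := (q.M ξ η t).det

/-- `ψ = |κ̂₁ κ̂₂|^{1/2} e^{iθ} (det K / det M) e^{iht/2}`. -/
def psi [NeZero N] (ξ η t : ℂ) : ℂ :=
  (Real.sqrt ‖q.κ₁ * q.κ₂‖ : ℂ) * Complex.exp (Complex.I * q.θ) *
    ((q.K ξ η t).det / (q.M ξ η t).det) * Complex.exp (Complex.I * q.h * (t / 2))

/-- `φ = ½ (ln det M)_ξξ + ½ (ln det M)_ηη + h/4`. -/
def phi (ξ η t : ℂ) : ℂ := dsPhi q.tau q.h ξ η t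

/-- All the expressions above make sense: `κ̂₁, κ̂₂ ≠ 0`, the `α`'s do not vanish, and
`α_{v_i} ≠ α_{u_k}` whenever `i` and `k` have different parity. -/
structure Admissible : Prop where
  κ₁_ne : q.κ₁ ≠ 0
  κ₂_ne : q.κ₂ ≠ 0
  αu_ne : ∀ i, q.αu i ≠ 0
  αv_ne : ∀ i, q.αv i ≠ 0
  odd_even : ∀ i k, q.αv (.inl i) ≠ q.αu (.inr k)
  even_odd : ∀ i k, q.αv (.inr i) ≠ q.αu (.inl k)

/-- The reality condition for bright solitons of DS1. -/
structure RealityDS1 : Prop where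
  κ₁_real : conj q.κ₁ = q.κ₁
  κ₂_real : conj q.κ₂ = q.κ₂
  conj_d : ∀ k, conj (q.d (.inl k)) = q.d (.inr k)
  conj_αu_odd : ∀ k, conj (q.αu (.inl k)) = q.αv (.inr k)
  conj_αu_even : ∀ k, conj (q.αu (.inr k)) = q.αv (.inl k)

/-- The reality condition for bright solitons of DS2. -/
structure RealityDS2 : Prop where
  conj_κ₁ : conj q.κ₁ = q.κ₂
  conj_d : ∀ k, conj (q.d (.inl k)) = q.d (.inr k)
  conj_αu : ∀ k, conj (q.αu (.inl k)) = q.αu (.inr k)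
  conj_αv : ∀ k, conj (q.αv (.inl k)) = q.αv (.inr k)

/-- The parameters `w_{u_{2k-1}} = w_a + ε α_{u_{2k-1}}⁻¹ (w_a - w_b)`,
`w_{u_{2k}} = w_b + ε α_{u_{2k}}⁻¹ (w_a - w_b)`, `w_{v_{2k-1}} = w_b + ε α_{v_{2k-1}}⁻¹ (w_a - w_b)`,
`w_{v_{2k}} = w_a + ε α_{v_{2k}}⁻¹ (w_a - w_b)`, `κ_j = ε κ̂_j (w_a - w_b)`, `d_k = -ln ε + d̂_k` of
the determinantal functions which degenerate to the bright solitons as `ε → 0`. -/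
def degenerating (a b : ℂ) (ε : ℝ) : DSParams (Fin N ⊕ Fin N) where
  a := a
  b := b
  κ₁ := ε * q.κ₁ * (a - b)
  κ₂ := ε * q.κ₂ * (a - b)
  h := q.h
  θ := q.θ
  u
    | .inl k => a + ε * (q.αu (.inl k))⁻¹ * (a - b)
    | .inr k => b + ε * (q.αu (.inr k))⁻¹ * (a - b)
  v
    | .inl k => b + ε * (q.αv (.inl k))⁻¹ * (a - b)
    | .inr k => a + ε * (q.αv (.inr k))⁻¹ * (a - b)
  d i := -(Real.log ε : ℂ) + q.d i

end BrightParams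

end

noncomputable section

/-! ## Directional derivatives of functions of `(ξ, η, t)` -/

/-! Dark and bright functions are two instances of one construction. The matrix `mat` is a diagonal
of exponentials `c_k e^{-z_k}` plus a constant matrix `C` of displacement rank one: `diag(av) C - C
diag(au)` and `diag(bv) C - C diag(bu)` are the outer products of `av, au` and of `bv, bu`. The
phases are differences of the same diagonals (of their squares for `t`), so a derivative of a form
`om x y = xᵀ mat⁻¹ y` is a polynomial in such forms: see `dirD_om_of_displacement` and
`vecMulVec_form`. The relation `av bv = l (bv - av)`, and likewise for `u`, removes the mixed
products.

In this calculus the logarithmic derivatives of `tau` are forms. With `G = l - om bu av` and `Gs = l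
+ om au bv`, the evolution equation becomes a polynomial identity in the forms (`schrodinger_G`),
and the mixed second logarithmic derivative of `tau` is `κ₁ κ₂ (G Gs - l²)`. Under the reality
conditions `conj G = Gs`, so `G Gs` is `|G|²` on the real slice and the mixed derivative yields the
equation for `Φ`. The transfer from holomorphic functions of `(ξ, η, t)` to real `(x, y, t)` is
`solvesDSOn_of_holomorphic`.

The given functions are identified with this form by determinant algebra. Passing from `T_0` to
`T_1` is a rank-one perturbation up to diagonal factors (`det_T_one`), with `l = ε` a free scale.
The matrix `K` is a rescaled bordered matrix after one pivot step (`det_K`), with `l = 0`. Taking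
the scale of the dark data to be the degeneration parameter makes the data converge entrywise to the
bright data, and `psi`, `phi` depend continuously on the data where the limiting determinant is
non-zero.

For non-vanishing, `tau = det (1 + E A)` with `E` positive diagonal and `A` of Cauchy type; all
principal minors of `A` are nonnegative, so expansion over subsets of rows gives a value at least
`1`.

Along a generic ray every exponential tends to zero or infinity. Normalizing the large rows leaves
rows of `C` on the set of increasing phases and identity rows elsewhere, an invertible limit by
Cauchy's determinant. In the dark case `T_0` and `T_1` share this limit and their prefactors have
equal modulus; in the bright case the block structure of `C` makes the limiting form zero. -/

/-- The derivative of `F` in the constant direction `e`. -/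
def dirD (e : ℂ × ℂ × ℂ) (F : ℂ × ℂ × ℂ → ℂ) : ℂ × ℂ × ℂ → ℂ := fun p => fderiv ℂ F p e

section dirD

variable {e e' p : ℂ × ℂ × ℂ} {F G : ℂ × ℂ × ℂ → ℂ}

theorem dirD_congr (h : F =ᶠ[𝓝 p] G) : dirD e F p = dirD e G p := by
  simp only [dirD, h.fderiv_eq]

theorem dirD_const (c : ℂ) : dirD e (fun _ => c) p = 0 := by simp [dirD]

theorem dirD_add (hF : DifferentiableAt ℂ F p) (hG : DifferentiableAt ℂ G p) :
    dirD e (fun q => F q + G q) p = dirD e F p + dirD e G p := by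
  simp [dirD, fderiv_fun_add hF hG]

theorem dirD_sub (hF : DifferentiableAt ℂ F p) (hG : DifferentiableAt ℂ G p) :
    dirD e (fun q => F q - G q) p = dirD e F p - dirD e G p := by
  simp [dirD, fderiv_fun_sub hF hG]

theorem dirD_mul (hF : DifferentiableAt ℂ F p) (hG : DifferentiableAt ℂ G p) :
    dirD e (fun q => F q * G q) p = dirD e F p * G p + F p * dirD e G p := by
  simp only [dirD, fderiv_fun_mul hF hG]
  simp; ring

theorem dirD_const_mul (c : ℂ) (hF : DifferentiableAt ℂ F p) :
    dirD e (fun q => c * F q) p = c * dirD e F p := by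
  simp [dirD, fderiv_const_mul hF]

theorem dirD_sum {κ : Type*} (s : Finset κ) {H : κ → ℂ × ℂ × ℂ → ℂ}
    (hH : ∀ k ∈ s, DifferentiableAt ℂ (H k) p) :
    dirD e (fun q => ∑ k ∈ s, H k q) p = ∑ k ∈ s, dirD e (H k) p := by
  simp [dirD, fderiv_fun_sum hH]

theorem dirD_prod {κ : Type*} [DecidableEq κ] (s : Finset κ) {H : κ → ℂ × ℂ × ℂ → ℂ}
    (hH : ∀ k ∈ s, DifferentiableAt ℂ (H k) p) :
    dirD e (fun q => ∏ k ∈ s, H k q) p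
      = ∑ k ∈ s, (∏ j ∈ s.erase k, H j p) * dirD e (H k) p := by
  simp [dirD, fderiv_finsetProd hH]

theorem dirD_exp (hF : DifferentiableAt ℂ F p) :
    dirD e (fun q => Complex.exp (F q)) p = Complex.exp (F p) * dirD e F p := by
  simp [dirD, hF.hasFDerivAt.cexp.fderiv]

theorem dirD_add_dir : dirD (e + e') F p = dirD e F p + dirD e' F p := by simp [dirD]

theorem dirD_smul_dir (c : ℂ) : dirD (c • e) F p = c * dirD e F p := by simp [dirD]

theorem ContDiffAt.dirD (hF : ContDiffAt ℂ ∞ F p) (e : ℂ × ℂ × ℂ) :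
    ContDiffAt ℂ ∞ (dirD e F) p := by
  have h : ContDiffAt ℂ ∞ (fderiv ℂ F) p := hF.fderiv_right (by norm_cast)
  exact h.clm_apply contDiffAt_const

theorem dirD_comm (hF : ContDiffAt ℂ ∞ F p) : dirD e (dirD e' F) p = dirD e' (dirD e F) p := by
  have h : ContDiffAt ℂ ∞ (fderiv ℂ F) p := hF.fderiv_right (by norm_cast)
  have hd : DifferentiableAt ℂ (fderiv ℂ F) p := h.differentiableAt (by simp)
  have hs : IsSymmSndFDerivAt ℂ F p := hF.isSymmSndFDerivAt (by simp; exact WithTop.coe_le_coe.2 le_top)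
  have key : ∀ a b : ℂ × ℂ × ℂ, _root_.dirD a (_root_.dirD b F) p = fderiv ℂ (fderiv ℂ F) p a b := by
    intro a b
    change fderiv ℂ (fun q => fderiv ℂ F q b) p a = _
    rw [fderiv_clm_apply hd (differentiableAt_const b)]
    simp
  rw [key, key]
  exact hs e e'

theorem deriv_line_eq_dirD (hF : DifferentiableAt ℂ F p) :
    HasDerivAt (fun s : ℂ => F (p + s • e)) (dirD e F p) 0 := by
  have h1 : HasFDerivAt F (fderiv ℂ F p) (p + (0 : ℂ) • e) := by simpa using hF.hasFDerivAt
  have h2 : HasDerivAt (fun s : ℂ => p + s • e) e 0 := by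
    simpa using ((hasDerivAt_id (0 : ℂ)).smul_const e).const_add p
  exact h1.comp_hasDerivAt (0 : ℂ) h2

end dirD

/-! ## Derivatives of determinants and inverses -/

section Matrix

variable {ι : Type*} [Fintype ι] [DecidableEq ι] {M : ℂ × ℂ × ℂ → Matrix ι ι ℂ}
  {e p : ℂ × ℂ × ℂ}

open Matrix

theorem contDiffAt_det (hM : ∀ i k, ContDiffAt ℂ ∞ (fun q => M q i k) p) :
    ContDiffAt ℂ ∞ (fun q => (M q).det) p := by
  simp only [det_apply']
  exact ContDiffAt.sum fun σ _ => contDiffAt_const.mul (contDiffAt_prod fun i _ => hM _ _)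

theorem contDiffAt_adjugate (hM : ∀ i k, ContDiffAt ℂ ∞ (fun q => M q i k) p) (i k : ι) :
    ContDiffAt ℂ ∞ (fun q => (M q).adjugate i k) p := by
  simp only [adjugate_apply]
  refine contDiffAt_det fun a b => ?_
  by_cases h : a = k
  · subst h; simpa using contDiffAt_const
  · simpa [updateRow_ne h] using hM a b

theorem contDiffAt_matrix_inv (hM : ∀ i k, ContDiffAt ℂ ∞ (fun q => M q i k) p) (hd : (M p).det ≠ 0)
    (i k : ι) : ContDiffAt ℂ ∞ (fun q => (M q)⁻¹ i k) p := by
  simp only [inv_def, Ring.inverse_eq_inv', Matrix.smul_apply, smul_eq_mul]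
  exact ((contDiffAt_det hM).inv hd).mul (contDiffAt_adjugate hM i k)

/-- Jacobi's formula. Expanding the trace by Cramer's rule gives a sum of determinants with one
column replaced by its derivative, which is the product rule applied to the Leibniz expansion. -/
theorem dirD_det (hM : ∀ i k, ContDiffAt ℂ ∞ (fun q => M q i k) p) :
    dirD e (fun q => (M q).det) p
      = ((M p).adjugate * Matrix.of fun i k => dirD e (fun q => M q i k) p).trace := by
  have hd : ∀ i k, DifferentiableAt ℂ (fun q => M q i k) p := fun i k =>
    (hM i k).differentiableAt (by simp)
  set M' : Matrix ι ι ℂ := Matrix.of fun i k => dirD e (fun q => M q i k) p with hM'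
  have h1 : ((M p).adjugate * M').trace = ∑ k, ((M p).updateCol k (fun i => M' i k)).det := by
    simp only [trace, diag_apply, mul_apply]
    refine Finset.sum_congr rfl fun k _ => ?_
    rw [← cramer_apply, cramer_eq_adjugate_mulVec]
    rfl
  rw [h1]
  have hpr : ∀ σ : Equiv.Perm ι, DifferentiableAt ℂ (fun q => ∏ i, M q (σ i) i) p := fun σ =>
    (contDiffAt_prod fun i _ => hM (σ i) i).differentiableAt (by simp)
  simp only [det_apply']
  rw [dirD_sum]
  swap
  · intro σ _
    exact (differentiableAt_const _).fun_mul (hpr σ)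
  rw [Finset.sum_comm]
  refine Finset.sum_congr rfl fun σ _ => ?_
  rw [dirD_const_mul _ (hpr σ),
    dirD_prod _ (fun i _ => hd _ _), Finset.mul_sum]
  refine Finset.sum_congr rfl fun k _ => ?_
  congr 1
  rw [← Finset.mul_prod_erase Finset.univ _ (Finset.mem_univ k), mul_comm]
  congr 1
  · simp [hM']
  · refine Finset.prod_congr rfl fun j hj => ?_
    rw [updateCol_ne (Finset.ne_of_mem_erase hj)]

/-- Comes from differentiating `M⁻¹ M = 1`, an identity valid near `p` because the determinant stays
non-zero there. -/
theorem dirD_inv (hM : ∀ i k, ContDiffAt ℂ ∞ (fun q => M q i k) p) (hp : (M p).det ≠ 0) :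
    (Matrix.of fun i k => dirD e (fun q => (M q)⁻¹ i k) p)
      = -((M p)⁻¹ * (Matrix.of fun i k => dirD e (fun q => M q i k) p) * (M p)⁻¹) := by
  have hd : ∀ i k, DifferentiableAt ℂ (fun q => M q i k) p := fun i k =>
    (hM i k).differentiableAt (by simp)
  have hi : ∀ i k, DifferentiableAt ℂ (fun q => (M q)⁻¹ i k) p := fun i k =>
    (contDiffAt_matrix_inv hM hp i k).differentiableAt (by simp)
  have hev : ∀ᶠ q in 𝓝 p, (M q).det ≠ 0 :=
    (contDiffAt_det hM).continuousAt.eventually_ne hp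
  have key : (Matrix.of fun i k => dirD e (fun q => (M q)⁻¹ i k) p) * M p
      + (M p)⁻¹ * (Matrix.of fun i k => dirD e (fun q => M q i k) p) = 0 := by
    ext i k
    have h0 : dirD e (fun q => ∑ j, (M q)⁻¹ i j * M q j k) p = 0 := by
      rw [dirD_congr (G := fun _ => (1 : Matrix ι ι ℂ) i k), dirD_const]
      filter_upwards [hev] with q hq
      rw [← nonsing_inv_mul (M q) (isUnit_iff_ne_zero.2 hq), mul_apply]
    rw [dirD_sum _ fun j _ => (hi i j).fun_mul (hd j k)] at h0
    simp only [dirD_mul (hi _ _) (hd _ _), Finset.sum_add_distrib] at h0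
    simpa [mul_apply] using h0
  have h2 := congrArg (· * (M p)⁻¹) key
  simp only [add_mul, zero_mul, mul_assoc, mul_nonsing_inv (M p) (isUnit_iff_ne_zero.2 hp),
    mul_one] at h2
  rw [eq_neg_iff_add_eq_zero, ← h2, mul_assoc]

theorem dirD_inv_bilin (hM : ∀ i k, ContDiffAt ℂ ∞ (fun q => M q i k) p) (hp : (M p).det ≠ 0)
    (x y : ι → ℂ) :
    dirD e (fun q => x ⬝ᵥ ((M q)⁻¹ *ᵥ y)) p
      = -(x ⬝ᵥ (((M p)⁻¹ * (Matrix.of fun i k => dirD e (fun q => M q i k) p) * (M p)⁻¹) *ᵥ y)) := by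
  have hi : ∀ i k, DifferentiableAt ℂ (fun q => (M q)⁻¹ i k) p := fun i k =>
    (contDiffAt_matrix_inv hM hp i k).differentiableAt (by simp)
  rw [← dotProduct_neg, ← neg_mulVec, ← dirD_inv hM hp]
  simp only [dotProduct, mulVec]
  have h1 : ∀ i, DifferentiableAt ℂ (fun q => ∑ k, (M q)⁻¹ i k * y k) p := fun i =>
    DifferentiableAt.fun_sum fun k _ => (hi i k).fun_mul (differentiableAt_const _)
  rw [dirD_sum _ fun i _ => (differentiableAt_const _).fun_mul (h1 i)]
  refine Finset.sum_congr rfl fun i _ => ?_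
  rw [dirD_const_mul _ (h1 i), dirD_sum _ fun k _ => (hi i k).fun_mul (differentiableAt_const _)]
  congr 1
  refine Finset.sum_congr rfl fun k _ => ?_
  rw [dirD_mul (hi i k) (differentiableAt_const _), dirD_const]
  simp

end Matrix

/-! ## Determinants of Cauchy type -/

/-- Data of a matrix `diag (c_k e^{-z_k}) + C` with `C` of displacement rank one with respect to
two pairs of commuting diagonal matrices. -/
structure CauchyData (ι : Type*) where
  κ₁ : ℂ
  κ₂ : ℂ
  l : ℂ
  av : ι → ℂ
  au : ι → ℂ
  bv : ι → ℂ
  bu : ι → ℂ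
  c : ι → ℂ
  C : Matrix ι ι ℂ

namespace CauchyData

variable {ι : Type*} (D : CauchyData ι)

/-- The relations `relA` and `relB` express displacement rank one. The relations `rel_v` and `rel_u`
are the partial fraction identity for `1/((a - w)(b - w))`; for `l = 0` they say that the two
families have disjoint supports. -/
structure Valid : Prop where
  relA : ∀ i k, (D.av i - D.au k) * D.C i k = D.av i * D.au k
  relB : ∀ i k, (D.bv i - D.bu k) * D.C i k = D.bv i * D.bu k
  rel_v : ∀ i, D.av i * D.bv i = D.l * (D.bv i - D.av i)
  rel_u : ∀ i, D.au i * D.bu i = D.l * (D.bu i - D.au i)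
  c_ne : ∀ i, D.c i ≠ 0

/-- The linear phases. -/
def phase (p : ℂ × ℂ × ℂ) (k : ι) : ℂ :=
  Complex.I * D.κ₁ * (D.av k - D.au k) * p.1 - Complex.I * D.κ₂ * (D.bv k - D.bu k) * p.2.1
    + Complex.I * (D.κ₁ ^ 2 * (D.au k ^ 2 - D.av k ^ 2) - D.κ₂ ^ 2 * (D.bu k ^ 2 - D.bv k ^ 2))
      * (p.2.2 / 2)

variable [Fintype ι] [DecidableEq ι]

open Matrix

/-- The matrix `diag (c_k e^{-z_k}) + C`. -/
def mat (p : ℂ × ℂ × ℂ) : Matrix ι ι ℂ :=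
  diagonal (fun k => D.c k * Complex.exp (-D.phase p k)) + D.C

/-- The determinant of `1 + diag (e^{z_k} / c_k) C`. -/
def tau (p : ℂ × ℂ × ℂ) : ℂ := (∏ k, Complex.exp (D.phase p k) / D.c k) * (D.mat p).det

/-- The bilinear form of the inverse matrix. -/
def om (x y : ι → ℂ) (p : ℂ × ℂ × ℂ) : ℂ := x ⬝ᵥ ((D.mat p)⁻¹ *ᵥ y)

theorem om_add_left (x x' y : ι → ℂ) (p) : D.om (x + x') y p = D.om x y p + D.om x' y p := by
  simp [om, add_dotProduct]

theorem om_sub_left (x x' y : ι → ℂ) (p) : D.om (x - x') y p = D.om x y p - D.om x' y p := by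
  simp [om, sub_dotProduct]

theorem om_smul_left (r : ℂ) (x y : ι → ℂ) (p) : D.om (r • x) y p = r * D.om x y p := by
  simp [om, smul_dotProduct]

theorem om_add_right (x y y' : ι → ℂ) (p) : D.om x (y + y') p = D.om x y p + D.om x y' p := by
  simp [om, mulVec_add, dotProduct_add]

theorem om_sub_right (x y y' : ι → ℂ) (p) : D.om x (y - y') p = D.om x y p - D.om x y' p := by
  simp [om, mulVec_sub, dotProduct_sub]

theorem om_smul_right (r : ℂ) (x y : ι → ℂ) (p) : D.om x (r • y) p = r * D.om x y p := by
  simp [om, mulVec_smul, dotProduct_smul]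

theorem contDiff_phase (k : ι) : ContDiff ℂ ∞ fun p => D.phase p k := by
  unfold phase; fun_prop

theorem contDiffAt_mat (p) (i k : ι) : ContDiffAt ℂ ∞ (fun q => D.mat q i k) p := by
  simp only [mat, Matrix.add_apply, diagonal_apply]
  have := D.contDiff_phase i
  split_ifs
  · exact ((contDiff_const.mul (this.neg.cexp)).add contDiff_const).contDiffAt
  · exact contDiffAt_const

theorem contDiff_tau : ContDiff ℂ ∞ D.tau := by
  rw [contDiff_iff_contDiffAt]
  intro p
  refine ContDiffAt.mul ?_ (contDiffAt_det (D.contDiffAt_mat p))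
  refine contDiffAt_prod fun k _ => ?_
  exact ((D.contDiff_phase k).cexp.div_const _).contDiffAt

variable {D}

theorem tau_ne_zero_iff (hD : D.Valid) {p} : D.tau p ≠ 0 ↔ (D.mat p).det ≠ 0 := by
  have : (∏ k, Complex.exp (D.phase p k) / D.c k) ≠ 0 :=
    Finset.prod_ne_zero_iff.2 fun k _ => div_ne_zero (Complex.exp_ne_zero _) (hD.c_ne k)
  rw [tau, mul_ne_zero_iff]
  exact and_iff_right this

theorem contDiffAt_om {p} (hp : (D.mat p).det ≠ 0) (x y : ι → ℂ) :
    ContDiffAt ℂ ∞ (D.om x y) p := by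
  unfold om
  simp only [dotProduct, mulVec]
  exact ContDiffAt.sum fun i _ => contDiffAt_const.mul <| ContDiffAt.sum fun k _ =>
    (contDiffAt_matrix_inv (D.contDiffAt_mat p) hp i k).mul contDiffAt_const

theorem differentiableAt_om {p} (hp : (D.mat p).det ≠ 0) (x y : ι → ℂ) :
    DifferentiableAt ℂ (D.om x y) p :=
  (contDiffAt_om hp x y).differentiableAt (by simp)

theorem eventually_det_ne {p} (hp : (D.mat p).det ≠ 0) : ∀ᶠ q in 𝓝 p, (D.mat q).det ≠ 0 :=
  (contDiffAt_det (D.contDiffAt_mat p)).continuousAt.eventually_ne hp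

variable (D)

/-- The derivative of the phase in the direction `e` is its value at `e`. -/
theorem dirD_phase (e p) (k : ι) : dirD e (fun q => D.phase q k) p = D.phase e k := by
  have h : HasDerivAt (fun s : ℂ => D.phase (p + s • e) k) (D.phase e k) 0 := by
    have : (fun s : ℂ => D.phase (p + s • e) k) = fun s => D.phase p k + s * D.phase e k := by
      funext s; simp [phase]; ring
    rw [this]
    simpa using ((hasDerivAt_id (0 : ℂ)).mul_const (D.phase e k)).const_add (D.phase p k)
  exact (deriv_line_eq_dirD ((D.contDiff_phase k).contDiffAt.differentiableAt (by simp))).unique h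

theorem dirD_mat (e p) :
    (Matrix.of fun i k => dirD e (fun q => D.mat q i k) p)
      = -(diagonal (D.phase e) * (D.mat p - D.C)) := by
  have hd : ∀ k, DifferentiableAt ℂ (fun q => D.phase q k) p := fun k =>
    (D.contDiff_phase k).contDiffAt.differentiableAt (by simp)
  ext i k
  simp only [mat, add_sub_cancel_right, diagonal_mul_diagonal, Matrix.of_apply, Matrix.neg_apply,
    Matrix.add_apply, diagonal_apply]
  split_ifs with h
  · have hn : DifferentiableAt ℂ (fun q => -D.phase q i) p := (hd i).neg
    rw [dirD_add (hn.cexp.const_mul _) (differentiableAt_const _), dirD_const,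
      dirD_const_mul _ hn.cexp, dirD_exp hn]
    have : dirD e (fun q => -D.phase q i) p = - D.phase e i := by
      rw [← D.dirD_phase e p i]
      simp [dirD, fderiv_fun_neg]
    rw [this]; ring
  · simp [dirD_const]

/-- The direction of the coordinate `ξ`. -/
def eξ : ℂ × ℂ × ℂ := (1, 0, 0)

/-- The direction of the coordinate `η`. -/
def eη : ℂ × ℂ × ℂ := (0, 1, 0)

/-- The direction of the coordinate `t`. -/
def et : ℂ × ℂ × ℂ := (0, 0, 1)

variable {D}

/-- If `[diag e, C]`-type displacement of the matrix in the direction `e` splits as below, then the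
derivative of the bilinear form follows. -/
theorem dirD_om_of_displacement {e p} (hp : (D.mat p).det ≠ 0) {r s : ι → ℂ} {m : Matrix ι ι ℂ}
    (he : ∀ k, D.phase e k = r k - s k)
    (hm : diagonal r * D.C - D.C * diagonal s = m) (x y : ι → ℂ) :
    dirD e (D.om x y) p = D.om x (r * y) p - D.om (s * x) y p
      - x ⬝ᵥ (((D.mat p)⁻¹ * m * (D.mat p)⁻¹) *ᵥ y) := by
  have hu := isUnit_iff_ne_zero.2 hp
  -- Only the diagonal part of `mat` varies, and it commutes with `r` and `s`. Putting `r` on the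
  -- left and `s` on the right completes it to full factors `mat`, which cancel against the
  -- inverses; the correction for `C` is the displacement `m`.
  have h1 : (Matrix.of fun i k => dirD e (fun q => D.mat q i k) p)
      = -(diagonal r * D.mat p) + D.mat p * diagonal s + m := by
    rw [dirD_mat, ← hm]
    ext i k
    by_cases h : i = k
    · subst h
      simp [mat, diagonal_mul, mul_diagonal, he]; ring
    · simp [mat, diagonal_mul, mul_diagonal, h, he]
  unfold om
  rw [dirD_inv_bilin (D.contDiffAt_mat p) hp, h1, mul_add, mul_add, add_mul, add_mul, mul_neg,
    neg_mul, ← mul_assoc, mul_assoc _ _ (D.mat p)⁻¹, mul_nonsing_inv _ hu, mul_one, ← mul_assoc,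
    nonsing_inv_mul _ hu, one_mul]
  have hr : r * y = diagonal r *ᵥ y := by ext i; simp [mulVec_diagonal]
  have hs : s * x = x ᵥ* diagonal s := by ext i; simp [vecMul_diagonal, mul_comm]
  rw [hr, hs, add_mulVec, add_mulVec, neg_mulVec, ← mulVec_mulVec, ← mulVec_mulVec,
    ← dotProduct_mulVec, dotProduct_add, dotProduct_add, dotProduct_neg]
  ring

/-- Rank one of the displacement makes the last term of the derivative split into a product of two
forms, so the calculus of forms closes. -/
theorem vecMulVec_form (p) (x y a b : ι → ℂ) :
    x ⬝ᵥ (((D.mat p)⁻¹ * vecMulVec a b * (D.mat p)⁻¹) *ᵥ y) = D.om x a p * D.om b y p := by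
  unfold om
  rw [← mulVec_mulVec, ← mulVec_mulVec, vecMulVec_mulVec]
  simp [mulVec_smul, dotProduct_smul, mul_comm]

theorem displacementA (hD : D.Valid) :
    diagonal D.av * D.C - D.C * diagonal D.au = vecMulVec D.av D.au := by
  ext i k
  simp [diagonal_mul, mul_diagonal, vecMulVec_apply, ← hD.relA]; ring

theorem displacementB (hD : D.Valid) :
    diagonal D.bv * D.C - D.C * diagonal D.bu = vecMulVec D.bv D.bu := by
  ext i k
  simp [diagonal_mul, mul_diagonal, vecMulVec_apply, ← hD.relB]; ring

/-- The `ξ`-coefficients of the phases are `iκ₁ (av - au)`, so the relevant displacement is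
`displacementA`. -/
theorem dirD_om_ξ (hD : D.Valid) {p} (hp : (D.mat p).det ≠ 0) (x y : ι → ℂ) :
    dirD eξ (D.om x y) p = Complex.I * D.κ₁ *
      (D.om x (D.av * y) p - D.om (D.au * x) y p - D.om x D.av p * D.om D.au y p) := by
  rw [dirD_om_of_displacement hp (r := (Complex.I * D.κ₁) • D.av) (s := (Complex.I * D.κ₁) • D.au)
    (m := (Complex.I * D.κ₁) • vecMulVec D.av D.au)]
  · simp only [smul_mul_assoc, om_smul_left, om_smul_right, Matrix.mul_smul, Matrix.smul_mul, smul_mulVec,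
      dotProduct_smul, vecMulVec_form, smul_eq_mul]
    ring
  · intro k; simp [phase, eξ]; ring
  · rw [← displacementA hD, diagonal_smul, diagonal_smul, Matrix.smul_mul, Matrix.mul_smul, smul_sub]

theorem dirD_om_η (hD : D.Valid) {p} (hp : (D.mat p).det ≠ 0) (x y : ι → ℂ) :
    dirD eη (D.om x y) p = -(Complex.I * D.κ₂) *
      (D.om x (D.bv * y) p - D.om (D.bu * x) y p - D.om x D.bv p * D.om D.bu y p) := by
  rw [dirD_om_of_displacement hp (r := (-(Complex.I * D.κ₂)) • D.bv)
    (s := (-(Complex.I * D.κ₂)) • D.bu) (m := (-(Complex.I * D.κ₂)) • vecMulVec D.bv D.bu)]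
  · simp only [smul_mul_assoc, om_smul_left, om_smul_right, Matrix.mul_smul, Matrix.smul_mul, smul_mulVec,
      dotProduct_smul, vecMulVec_form, smul_eq_mul]
    ring
  · intro k; simp [phase, eη]; ring
  · rw [← displacementB hD, diagonal_smul, diagonal_smul, Matrix.smul_mul, Matrix.mul_smul, smul_sub]

theorem dirD_om_t (hD : D.Valid) {p} (hp : (D.mat p).det ≠ 0) (x y : ι → ℂ) :
    dirD et (D.om x y) p = -(Complex.I * D.κ₁ ^ 2 / 2) *
      (D.om x (D.av ^ 2 * y) p - D.om (D.au ^ 2 * x) y p - D.om x (D.av ^ 2) p * D.om D.au y p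
        - D.om x D.av p * D.om (D.au ^ 2) y p)
      + Complex.I * D.κ₂ ^ 2 / 2 *
      (D.om x (D.bv ^ 2 * y) p - D.om (D.bu ^ 2 * x) y p - D.om x (D.bv ^ 2) p * D.om D.bu y p
        - D.om x D.bv p * D.om (D.bu ^ 2) y p) := by
  set α : ℂ := -(Complex.I * D.κ₁ ^ 2 / 2) with hα
  set β : ℂ := Complex.I * D.κ₂ ^ 2 / 2 with hβ
  rw [dirD_om_of_displacement hp (r := α • D.av ^ 2 + β • D.bv ^ 2)
    (s := α • D.au ^ 2 + β • D.bu ^ 2)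
    (m := α • (vecMulVec (D.av ^ 2) D.au + vecMulVec D.av (D.au ^ 2))
      + β • (vecMulVec (D.bv ^ 2) D.bu + vecMulVec D.bv (D.bu ^ 2)))]
  · simp only [add_mul, smul_mul_assoc, om_smul_left, om_smul_right, om_add_left, om_add_right,
      Matrix.mul_add, Matrix.add_mul, Matrix.mul_smul, Matrix.smul_mul, smul_mulVec, add_mulVec, dotProduct_add,
      dotProduct_smul, vecMulVec_form, smul_eq_mul]
    ring
  · intro k; simp [phase, et, hα, hβ]; ring
  · ext i k
    simp only [Matrix.sub_apply, diagonal_mul, mul_diagonal, Matrix.add_apply, Matrix.smul_apply,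
      vecMulVec_apply, Pi.add_apply, Pi.smul_apply, Pi.pow_apply, smul_eq_mul]
    -- The squares have displacement of rank two per family, since `av² - au² = (av + au)(av - au)`
    -- entrywise.
    linear_combination α * (D.av i + D.au k) * hD.relA i k + β * (D.bv i + D.bu k) * hD.relB i k

end CauchyData

/-! ### Logarithmic derivatives of `tau` and the Schrödinger equation for `G` -/

namespace CauchyData

variable {ι : Type*} (D : CauchyData ι) [Fintype ι] [DecidableEq ι]

open Matrix

/-- The quotient of tau functions entering the solution of the Schrödinger equation. -/
def G (p : ℂ × ℂ × ℂ) : ℂ := D.l - D.om D.bu D.av p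

/-- The quotient of tau functions dual to `G`. -/
def Gs (p : ℂ × ℂ × ℂ) : ℂ := D.l + D.om D.au D.bv p

/-- The second logarithmic derivatives of `tau`, expressed by the inverse matrix. -/
def potA (p : ℂ × ℂ × ℂ) : ℂ :=
  -D.κ₁ ^ 2 * (D.om D.au (D.av ^ 2) p - D.om (D.au ^ 2) D.av p - D.om D.au D.av p ^ 2)

def potB (p : ℂ × ℂ × ℂ) : ℂ :=
  -D.κ₂ ^ 2 * (D.om D.bu (D.bv ^ 2) p - D.om (D.bu ^ 2) D.bv p - D.om D.bu D.bv p ^ 2)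

/-- The potential `½ (ln tau)_ξξ + ½ (ln tau)_ηη + h/4`. -/
def pot (h : ℝ) (p : ℂ × ℂ × ℂ) : ℂ := 1 / 2 * D.potA p + 1 / 2 * D.potB p + h / 4

variable {D}

/-- By Jacobi's formula the determinant contributes minus the sum of the phases at `e`, which the
exponential prefactor of `tau` cancels; only the trace against the displacement remains. -/
theorem dirD_tau_of_displacement {e p} (hp : (D.mat p).det ≠ 0) {r s : ι → ℂ}
    {m : Matrix ι ι ℂ} (he : ∀ k, D.phase e k = r k - s k)
    (hm : diagonal r * D.C - D.C * diagonal s = m) :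
    dirD e D.tau p = ((D.mat p)⁻¹ * m).trace * D.tau p := by
  have hu := isUnit_iff_ne_zero.2 hp
  have h1 : (Matrix.of fun i k => dirD e (fun q => D.mat q i k) p)
      = -(diagonal r * D.mat p) + D.mat p * diagonal s + m := by
    rw [dirD_mat, ← hm]
    ext i k
    by_cases h : i = k
    · subst h
      simp [mat, diagonal_mul, mul_diagonal, he]; ring
    · simp [mat, diagonal_mul, mul_diagonal, h, he]
  have hdet : dirD e (fun q => (D.mat q).det) p
      = (D.mat p).det * (((D.mat p)⁻¹ * m).trace - ∑ k, D.phase e k) := by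
    have hadj : (D.mat p).adjugate = (D.mat p).det • (D.mat p)⁻¹ := by
      rw [inv_def, smul_smul, Ring.mul_inverse_cancel _ hu, one_smul]
    rw [dirD_det (D.contDiffAt_mat p), h1, hadj, Matrix.smul_mul, trace_smul, Matrix.mul_add,
      Matrix.mul_add, trace_add, trace_add, Matrix.mul_neg, trace_neg, ← mul_assoc,
      trace_mul_comm ((D.mat p)⁻¹ * diagonal r), ← mul_assoc, mul_nonsing_inv _ hu, one_mul,
      ← mul_assoc, nonsing_inv_mul _ hu, one_mul, smul_eq_mul]
    simp only [he, Finset.sum_sub_distrib, trace_diagonal]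
    ring
  have hph : ∀ k, DifferentiableAt ℂ (fun q => Complex.exp (D.phase q k) / D.c k) p := fun k =>
    (((D.contDiff_phase k).cexp.div_const _).contDiffAt).differentiableAt (by simp)
  have hpr : dirD e (fun q => ∏ k, Complex.exp (D.phase q k) / D.c k) p
      = (∏ k, Complex.exp (D.phase p k) / D.c k) * ∑ k, D.phase e k := by
    rw [dirD_prod _ fun k _ => hph k, Finset.mul_sum]
    refine Finset.sum_congr rfl fun k hk => ?_
    have hd : DifferentiableAt ℂ (fun q => D.phase q k) p :=
      (D.contDiff_phase k).contDiffAt.differentiableAt (by simp)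
    have : dirD e (fun q => Complex.exp (D.phase q k) / D.c k) p
        = Complex.exp (D.phase p k) / D.c k * D.phase e k := by
      simp only [div_eq_mul_inv]
      rw [dirD_mul hd.cexp (differentiableAt_const _), dirD_const, dirD_exp hd, dirD_phase]
      ring
    rw [this, ← Finset.mul_prod_erase Finset.univ _ hk]
    ring
  have hdiff : DifferentiableAt ℂ (fun q => (D.mat q).det) p :=
    (contDiffAt_det (D.contDiffAt_mat p)).differentiableAt (by simp)
  change dirD e (fun q => (∏ k, Complex.exp (D.phase q k) / D.c k) * (D.mat q).det) p = _
  rw [dirD_mul ((contDiffAt_prod fun k _ =>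
    ((D.contDiff_phase k).cexp.div_const _).contDiffAt).differentiableAt (by simp)) hdiff,
    hpr, hdet, tau]
  ring

theorem trace_inv_vecMulVec (p) (a b : ι → ℂ) :
    ((D.mat p)⁻¹ * vecMulVec a b).trace = D.om b a p := by
  rw [mul_vecMulVec, trace_vecMulVec, om, dotProduct_comm]

theorem dirD_tau_ξ (hD : D.Valid) {p} (hp : (D.mat p).det ≠ 0) :
    dirD eξ D.tau p = Complex.I * D.κ₁ * D.om D.au D.av p * D.tau p := by
  rw [dirD_tau_of_displacement hp (r := (Complex.I * D.κ₁) • D.av)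
    (s := (Complex.I * D.κ₁) • D.au) (m := (Complex.I * D.κ₁) • vecMulVec D.av D.au)]
  · rw [Matrix.mul_smul, trace_smul, trace_inv_vecMulVec, smul_eq_mul]
  · intro k; simp [phase, eξ]; ring
  · rw [← displacementA hD, diagonal_smul, diagonal_smul, Matrix.smul_mul, Matrix.mul_smul, smul_sub]

theorem dirD_tau_η (hD : D.Valid) {p} (hp : (D.mat p).det ≠ 0) :
    dirD eη D.tau p = -(Complex.I * D.κ₂) * D.om D.bu D.bv p * D.tau p := by
  rw [dirD_tau_of_displacement hp (r := (-(Complex.I * D.κ₂)) • D.bv)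
    (s := (-(Complex.I * D.κ₂)) • D.bu) (m := (-(Complex.I * D.κ₂)) • vecMulVec D.bv D.bu)]
  · rw [Matrix.mul_smul, trace_smul, trace_inv_vecMulVec, smul_eq_mul]
  · intro k; simp [phase, eη]; ring
  · rw [← displacementB hD, diagonal_smul, diagonal_smul, Matrix.smul_mul, Matrix.mul_smul, smul_sub]

theorem hasDerivAt_ξ {F : ℂ × ℂ × ℂ → ℂ} {ξ η t : ℂ} (hF : DifferentiableAt ℂ F (ξ, η, t)) :
    HasDerivAt (fun s => F (s, η, t)) (dirD eξ F (ξ, η, t)) ξ := by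
  have h2 : HasDerivAt (fun s : ℂ => (s, η, t)) eξ ξ :=
    (hasDerivAt_id ξ).prodMk ((hasDerivAt_const ξ η).prodMk (hasDerivAt_const ξ t))
  exact HasFDerivAt.comp_hasDerivAt ξ hF.hasFDerivAt h2

theorem hasDerivAt_η {F : ℂ × ℂ × ℂ → ℂ} {ξ η t : ℂ} (hF : DifferentiableAt ℂ F (ξ, η, t)) :
    HasDerivAt (fun s => F (ξ, s, t)) (dirD eη F (ξ, η, t)) η := by
  have h2 : HasDerivAt (fun s : ℂ => (ξ, s, t)) eη η :=
    (hasDerivAt_const η ξ).prodMk ((hasDerivAt_id η).prodMk (hasDerivAt_const η t))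
  exact HasFDerivAt.comp_hasDerivAt η hF.hasFDerivAt h2

theorem dirD_om_aa (hD : D.Valid) {p} (hp : (D.mat p).det ≠ 0) :
    Complex.I * D.κ₁ * dirD eξ (D.om D.au D.av) p = D.potA p := by
  rw [dirD_om_ξ hD hp, potA, ← sq, ← sq]
  linear_combination (D.κ₁ ^ 2 * (D.om D.au (D.av ^ 2) p - D.om (D.au ^ 2) D.av p
    - D.om D.au D.av p ^ 2)) * Complex.I_sq

theorem dirD_om_bb (hD : D.Valid) {p} (hp : (D.mat p).det ≠ 0) :
    -(Complex.I * D.κ₂) * dirD eη (D.om D.bu D.bv) p = D.potB p := by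
  rw [dirD_om_η hD hp, potB, ← sq, ← sq]
  linear_combination (D.κ₂ ^ 2 * (D.om D.bu (D.bv ^ 2) p - D.om (D.bu ^ 2) D.bv p
    - D.om D.bu D.bv p ^ 2)) * Complex.I_sq

theorem dsPhi_tau (hD : D.Valid) {h : ℝ} {ξ η t : ℂ} (hp : D.tau (ξ, η, t) ≠ 0) :
    dsPhi (fun ξ η t => D.tau (ξ, η, t)) h ξ η t = D.pot h (ξ, η, t) := by
  have hdet := (tau_ne_zero_iff hD).1 hp
  have htd : ∀ q, DifferentiableAt ℂ D.tau q := fun q =>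
    D.contDiff_tau.contDiffAt.differentiableAt (by simp)
  -- `dsPhi` differentiates the logarithmic derivative once more, so its formula is needed on a
  -- neighbourhood.
  have hA : (logDeriv fun s => D.tau (s, η, t)) =ᶠ[𝓝 ξ]
      fun s => Complex.I * D.κ₁ * D.om D.au D.av (s, η, t) := by
    have hc : Filter.Tendsto (fun s : ℂ => (s, η, t)) (𝓝 ξ) (𝓝 (ξ, η, t)) := by
      apply Continuous.tendsto'; · fun_prop
      · rfl
    filter_upwards [hc.eventually (eventually_det_ne hdet)] with s hs
    have hs' := (tau_ne_zero_iff hD).2 hs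
    rw [logDeriv_apply, (hasDerivAt_ξ (htd _)).deriv, dirD_tau_ξ hD hs]
    field_simp
  have hB : (logDeriv fun s => D.tau (ξ, s, t)) =ᶠ[𝓝 η]
      fun s => -(Complex.I * D.κ₂) * D.om D.bu D.bv (ξ, s, t) := by
    have hc : Filter.Tendsto (fun s : ℂ => (ξ, s, t)) (𝓝 η) (𝓝 (ξ, η, t)) := by
      apply Continuous.tendsto'; · fun_prop
      · rfl
    filter_upwards [hc.eventually (eventually_det_ne hdet)] with s hs
    have hs' := (tau_ne_zero_iff hD).2 hs
    rw [logDeriv_apply, (hasDerivAt_η (htd _)).deriv, dirD_tau_η hD hs]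
    field_simp
  rw [dsPhi, hA.deriv_eq, hB.deriv_eq,
    ((hasDerivAt_ξ (differentiableAt_om hdet D.au D.av)).const_mul _).deriv,
    ((hasDerivAt_η (differentiableAt_om hdet D.bu D.bv)).const_mul _).deriv,
    dirD_om_aa hD hdet, dirD_om_bb hD hdet, pot]

theorem au_mul_bu (hD : D.Valid) : D.au * D.bu = D.l • (D.bu - D.au) := by
  ext i; simpa using hD.rel_u i

theorem bu_mul_au (hD : D.Valid) : D.bu * D.au = D.l • (D.bu - D.au) := by
  rw [mul_comm, au_mul_bu hD]

theorem av_mul_bv (hD : D.Valid) : D.av * D.bv = D.l • (D.bv - D.av) := by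
  ext i; simpa using hD.rel_v i

theorem bv_mul_av (hD : D.Valid) : D.bv * D.av = D.l • (D.bv - D.av) := by
  rw [mul_comm, av_mul_bv hD]

/-- The mixed second logarithmic derivative of `tau`. -/
theorem dirD_η_om_aa (hD : D.Valid) {p} (hp : (D.mat p).det ≠ 0) :
    Complex.I * D.κ₁ * dirD eη (D.om D.au D.av) p = D.κ₁ * D.κ₂ * (D.G p * D.Gs p - D.l ^ 2) := by
  rw [dirD_om_η hD hp, bv_mul_av hD, bu_mul_au hD, G, Gs]
  simp only [om_smul_left, om_smul_right, om_sub_left, om_sub_right]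
  linear_combination (-D.κ₁ * D.κ₂ * (D.l * (D.om D.au D.bv p - D.om D.au D.av p)
    - D.l * (D.om D.bu D.av p - D.om D.au D.av p) - D.om D.au D.bv p * D.om D.bu D.av p))
    * Complex.I_sq

/-- The same mixed derivative of `ln tau` taken in the other order. Both versions are needed,
because the potential is assembled from a `ξ`- and an `η`-logarithmic derivative. -/
theorem dirD_ξ_om_bb (hD : D.Valid) {p} (hp : (D.mat p).det ≠ 0) :
    -(Complex.I * D.κ₂) * dirD eξ (D.om D.bu D.bv) p
      = D.κ₁ * D.κ₂ * (D.G p * D.Gs p - D.l ^ 2) := by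
  rw [dirD_om_ξ hD hp, av_mul_bv hD, au_mul_bu hD, G, Gs]
  simp only [om_smul_left, om_smul_right, om_sub_left, om_sub_right]
  linear_combination (-D.κ₁ * D.κ₂ * (D.l * (D.om D.bu D.bv p - D.om D.bu D.av p)
    - D.l * (D.om D.bu D.bv p - D.om D.au D.bv p) - D.om D.bu D.av p * D.om D.au D.bv p))
    * Complex.I_sq

theorem dirD_ξ_G (hD : D.Valid) {p} (hp : (D.mat p).det ≠ 0) :
    dirD eξ D.G p = -(Complex.I * D.κ₁) * (D.om D.bu (D.av ^ 2) p
      - D.l * (D.om D.bu D.av p - D.om D.au D.av p) - D.om D.bu D.av p * D.om D.au D.av p) := by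
  change dirD eξ (fun p => D.l - D.om D.bu D.av p) p = _
  rw [dirD_sub (differentiableAt_const _) (differentiableAt_om hp _ _), dirD_const,
    dirD_om_ξ hD hp, au_mul_bu hD, ← sq, om_smul_left, om_sub_left]
  ring

theorem dirD_η_G (hD : D.Valid) {p} (hp : (D.mat p).det ≠ 0) :
    dirD eη D.G p = Complex.I * D.κ₂ * (D.l * (D.om D.bu D.bv p - D.om D.bu D.av p)
      - D.om (D.bu ^ 2) D.av p - D.om D.bu D.bv p * D.om D.bu D.av p) := by
  change dirD eη (fun p => D.l - D.om D.bu D.av p) p = _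
  rw [dirD_sub (differentiableAt_const _) (differentiableAt_om hp _ _), dirD_const,
    dirD_om_η hD hp, bv_mul_av hD, ← sq, om_smul_right, om_sub_right]
  ring

theorem dirD_ξξ_G (hD : D.Valid) {p} (hp : (D.mat p).det ≠ 0) :
    dirD eξ (dirD eξ D.G) p = D.κ₁ ^ 2 * (
      (D.om D.bu (D.av ^ 3) p - D.l * (D.om D.bu (D.av ^ 2) p - D.om D.au (D.av ^ 2) p)
        - D.om D.bu D.av p * D.om D.au (D.av ^ 2) p)
      - (D.l + D.om D.au D.av p) * (D.om D.bu (D.av ^ 2) p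
        - D.l * (D.om D.bu D.av p - D.om D.au D.av p) - D.om D.bu D.av p * D.om D.au D.av p)
      + (D.l - D.om D.bu D.av p) * (D.om D.au (D.av ^ 2) p - D.om (D.au ^ 2) D.av p
        - D.om D.au D.av p ^ 2)) := by
  have h : dirD eξ D.G =ᶠ[𝓝 p] fun p => -(Complex.I * D.κ₁) * (D.om D.bu (D.av ^ 2) p
      - D.l * (D.om D.bu D.av p - D.om D.au D.av p) - D.om D.bu D.av p * D.om D.au D.av p) :=
    (eventually_det_ne hp).mono fun q hq => dirD_ξ_G hD hq
  have d := fun x y => differentiableAt_om hp x y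
  rw [dirD_congr h, dirD_const_mul _ (((d _ _).fun_sub (((d _ _).fun_sub (d _ _)).const_mul _)).fun_sub
      ((d _ _).fun_mul (d _ _))),
    dirD_sub ((d _ _).fun_sub (((d _ _).fun_sub (d _ _)).const_mul _)) ((d _ _).fun_mul (d _ _)),
    dirD_sub (d _ _) (((d _ _).fun_sub (d _ _)).const_mul _),
    dirD_const_mul _ ((d _ _).fun_sub (d _ _)), dirD_sub (d _ _) (d _ _), dirD_mul (d _ _) (d _ _)]
  simp only [dirD_om_ξ hD hp, au_mul_bu hD]
  rw [show D.av * D.av ^ 2 = D.av ^ 3 by ring, show D.av * D.av = D.av ^ 2 by ring,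
    show D.au * D.au = D.au ^ 2 by ring]
  simp only [om_smul_left, om_sub_left]
  -- With the product relations used up, the forms can be treated as independent variables; only `I²
  -- = -1` lies outside the ring normal form.
  generalize D.om D.bu (D.av ^ 3) p = x1
  generalize D.om D.bu (D.av ^ 2) p = x2
  generalize D.om D.bu D.av p = x3
  generalize D.om D.au D.av p = x4
  generalize D.om D.au (D.av ^ 2) p = x5
  generalize D.om (D.au ^ 2) D.av p = x6
  ring_nf
  simp only [Complex.I_sq]
  ring

theorem dirD_ηη_G (hD : D.Valid) {p} (hp : (D.mat p).det ≠ 0) :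
    dirD eη (dirD eη D.G) p = D.κ₂ ^ 2 * (
      (D.l - D.om D.bu D.av p) * (D.om D.bu (D.bv ^ 2) p - D.om (D.bu ^ 2) D.bv p
        - D.om D.bu D.bv p ^ 2)
      - (D.l + D.om D.bu D.bv p) * (D.l * (D.om D.bu D.bv p - D.om D.bu D.av p)
        - D.om (D.bu ^ 2) D.av p - D.om D.bu D.bv p * D.om D.bu D.av p)
      - (D.l * (D.om (D.bu ^ 2) D.bv p - D.om (D.bu ^ 2) D.av p) - D.om (D.bu ^ 3) D.av p
        - D.om (D.bu ^ 2) D.bv p * D.om D.bu D.av p)) := by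
  have h : dirD eη D.G =ᶠ[𝓝 p] fun p => Complex.I * D.κ₂ * (D.l * (D.om D.bu D.bv p - D.om D.bu D.av p)
      - D.om (D.bu ^ 2) D.av p - D.om D.bu D.bv p * D.om D.bu D.av p) :=
    (eventually_det_ne hp).mono fun q hq => dirD_η_G hD hq
  have d := fun x y => differentiableAt_om hp x y
  rw [dirD_congr h, dirD_const_mul _ ((((((d _ _).fun_sub (d _ _)).const_mul _)).fun_sub (d _ _)).fun_sub
      ((d _ _).fun_mul (d _ _))),
    dirD_sub (((((d _ _).fun_sub (d _ _)).const_mul _)).fun_sub (d _ _)) ((d _ _).fun_mul (d _ _)),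
    dirD_sub (((d _ _).fun_sub (d _ _)).const_mul _) (d _ _),
    dirD_const_mul _ ((d _ _).fun_sub (d _ _)), dirD_sub (d _ _) (d _ _), dirD_mul (d _ _) (d _ _)]
  simp only [dirD_om_η hD hp, bv_mul_av hD]
  rw [show D.bu * D.bu ^ 2 = D.bu ^ 3 by ring, show D.bv * D.bv = D.bv ^ 2 by ring,
    show D.bu * D.bu = D.bu ^ 2 by ring]
  simp only [om_smul_right, om_sub_right]
  generalize D.om (D.bu ^ 3) D.av p = x1
  generalize D.om (D.bu ^ 2) D.av p = x2
  generalize D.om D.bu D.av p = x3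
  generalize D.om D.bu D.bv p = x4
  generalize D.om D.bu (D.bv ^ 2) p = x5
  generalize D.om (D.bu ^ 2) D.bv p = x6
  ring_nf
  simp only [Complex.I_sq]
  ring

theorem dirD_t_G (hD : D.Valid) {p} (hp : (D.mat p).det ≠ 0) :
    dirD et D.G p = Complex.I * D.κ₁ ^ 2 / 2 * (D.om D.bu (D.av ^ 3) p
        - D.l * (D.l * (D.om D.bu D.av p - D.om D.au D.av p) - D.om (D.au ^ 2) D.av p)
        - D.om D.bu (D.av ^ 2) p * D.om D.au D.av p - D.om D.bu D.av p * D.om (D.au ^ 2) D.av p)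
      - Complex.I * D.κ₂ ^ 2 / 2 * (D.l * (D.om D.bu (D.bv ^ 2) p
          - D.l * (D.om D.bu D.bv p - D.om D.bu D.av p)) - D.om (D.bu ^ 3) D.av p
        - D.om D.bu (D.bv ^ 2) p * D.om D.bu D.av p - D.om D.bu D.bv p * D.om (D.bu ^ 2) D.av p) := by
  have h1 : D.au ^ 2 * D.bu = D.l • (D.l • (D.bu - D.au) - D.au ^ 2) := by
    rw [← au_mul_bu hD]
    have := au_mul_bu hD
    ext i
    have := congrFun this i
    simp at this ⊢
    linear_combination (D.au i) * this
  have h2 : D.bv ^ 2 * D.av = D.l • (D.bv ^ 2 - D.l • (D.bv - D.av)) := by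
    have := bv_mul_av hD
    ext i
    have := congrFun this i
    simp at this ⊢
    linear_combination (D.bv i - D.l) * this
  change dirD et (fun p => D.l - D.om D.bu D.av p) p = _
  rw [dirD_sub (differentiableAt_const _) (differentiableAt_om hp _ _), dirD_const,
    dirD_om_t hD hp, h1, h2, show D.av ^ 2 * D.av = D.av ^ 3 by ring,
    show D.bu ^ 2 * D.bu = D.bu ^ 3 by ring]
  simp only [om_smul_left, om_smul_right, om_sub_left, om_sub_right]
  ring

/-- The bilinear equation of Schrödinger type for the quotient of tau functions. -/
theorem schrodinger_G (hD : D.Valid) {p} (hp : (D.mat p).det ≠ 0) :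
    Complex.I * dirD et D.G p + 1 / 2 * (dirD eξ (dirD eξ D.G) p + dirD eη (dirD eη D.G) p)
      + (D.potA p + D.potB p) * D.G p
      + Complex.I * (D.κ₁ * D.l * dirD eξ D.G p - D.κ₂ * D.l * dirD eη D.G p) = 0 := by
  rw [dirD_t_G hD hp, dirD_ξξ_G hD hp, dirD_ηη_G hD hp, dirD_ξ_G hD hp, dirD_η_G hD hp,
    potA, potB, G]
  -- After the derivatives are inserted no relation between the forms is needed: what remains is a
  -- polynomial identity modulo `I² = -1`. The first-order terms in the statement are those that the
  -- plane wave factor will supply.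
  generalize D.om D.bu (D.av ^ 3) p = x1
  generalize D.om D.bu (D.av ^ 2) p = x2
  generalize D.om D.bu D.av p = x3
  generalize D.om D.au D.av p = x4
  generalize D.om D.au (D.av ^ 2) p = x5
  generalize D.om (D.au ^ 2) D.av p = x6
  generalize D.om (D.bu ^ 3) D.av p = y1
  generalize D.om (D.bu ^ 2) D.av p = y2
  generalize D.om D.bu D.bv p = y4
  generalize D.om D.bu (D.bv ^ 2) p = y5
  generalize D.om (D.bu ^ 2) D.bv p = y6
  ring_nf
  simp only [Complex.I_sq]
  ring

end CauchyData

/-! ## Restriction to the real variables -/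

section slice

variable {e p q : ℂ × ℂ × ℂ} {F : ℂ × ℂ × ℂ → ℂ}

theorem ContDiffAt.eventually_differentiableAt (hF : ContDiffAt ℂ ∞ F p) :
    ∀ᶠ q in 𝓝 p, DifferentiableAt ℂ F q := by
  have h1 : ContDiffAt ℂ 1 F p := hF.of_le (by exact_mod_cast le_top)
  exact (h1.eventually (by simp)).mono fun q hq => hq.differentiableAt (by simp)

theorem tendsto_line (e q : ℂ × ℂ × ℂ) (x : ℝ) :
    Filter.Tendsto (fun s : ℝ => q + (s : ℂ) • e) (𝓝 x) (𝓝 (q + (x : ℂ) • e)) := by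
  apply Continuous.tendsto
  fun_prop

theorem hasDerivAt_line {x : ℝ} (hF : DifferentiableAt ℂ F (q + (x : ℂ) • e)) :
    HasDerivAt (fun s : ℝ => F (q + (s : ℂ) • e)) (dirD e F (q + (x : ℂ) • e)) x := by
  have h2 : HasDerivAt (fun s : ℂ => q + s • e) e (x : ℂ) := by
    simpa using ((hasDerivAt_id (x : ℂ)).smul_const e).const_add q
  exact (HasFDerivAt.comp_hasDerivAt (x : ℂ) hF.hasFDerivAt h2).comp_ofReal

theorem iteratedDeriv_two_line {x : ℝ} (hF : ContDiffAt ℂ ∞ F (q + (x : ℂ) • e)) :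
    iteratedDeriv 2 (fun s : ℝ => F (q + (s : ℂ) • e)) x
      = dirD e (dirD e F) (q + (x : ℂ) • e) := by
  have h1 : deriv (fun s : ℝ => F (q + (s : ℂ) • e)) =ᶠ[𝓝 x]
      fun s : ℝ => dirD e F (q + (s : ℂ) • e) :=
    ((tendsto_line e q x).eventually hF.eventually_differentiableAt).mono
      fun s hs => (hasDerivAt_line hs).deriv
  rw [iteratedDeriv_succ, iteratedDeriv_one, h1.deriv_eq]
  exact (hasDerivAt_line ((hF.dirD e).differentiableAt (by simp))).deriv

theorem ofReal_deriv_line {x : ℝ} {f : ℝ → ℝ} (hF : DifferentiableAt ℂ F (q + (x : ℂ) • e))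
    (hf : ∀ᶠ s in 𝓝 x, (f s : ℂ) = F (q + (s : ℂ) • e)) :
    ((deriv f x : ℝ) : ℂ) = dirD e F (q + (x : ℂ) • e) := by
  have h0 := hasDerivAt_line hF
  have h1 : f =ᶠ[𝓝 x] fun s => (F (q + (s : ℂ) • e)).re := by
    filter_upwards [hf] with s hs
    rw [← hs, Complex.ofReal_re]
  have h2 : HasDerivAt (fun s : ℝ => (F (q + (s : ℂ) • e)).re)
      (dirD e F (q + (x : ℂ) • e)).re x :=
    (Complex.reCLM.hasFDerivAt.comp_hasDerivAt x h0)
  have h3 : HasDerivAt f (deriv f x) x := (h2.congr_of_eventuallyEq h1).differentiableAt.hasDerivAt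
  have h4 : HasDerivAt (fun s : ℝ => F (q + (s : ℂ) • e)) ((deriv f x : ℝ) : ℂ) x :=
    h3.ofReal_comp.congr_of_eventuallyEq (hf.mono fun s hs => hs.symm)
  exact h4.unique h0

theorem ofReal_iteratedDeriv_two_line {x : ℝ} {f : ℝ → ℝ}
    (hF : ContDiffAt ℂ ∞ F (q + (x : ℂ) • e))
    (hf : ∀ᶠ s in 𝓝 x, (f s : ℂ) = F (q + (s : ℂ) • e)) :
    ((iteratedDeriv 2 f x : ℝ) : ℂ) = dirD e (dirD e F) (q + (x : ℂ) • e) := by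
  rw [iteratedDeriv_succ, iteratedDeriv_one]
  refine ofReal_deriv_line ((hF.dirD e).differentiableAt (by simp)) ?_
  filter_upwards [(tendsto_line e q x).eventually hF.eventually_differentiableAt,
    hf.eventually_nhds] with s hs hs'
  exact ofReal_deriv_line hs hs'

/-- The second derivative in a direction of the `(ξ, η)`-plane. -/
theorem dirD_dirD_combination (hF : ContDiffAt ℂ ∞ F p) (a b : ℂ) (e₁ e₂ : ℂ × ℂ × ℂ) :
    dirD (a • e₁ + b • e₂) (dirD (a • e₁ + b • e₂) F) p
      = a ^ 2 * dirD e₁ (dirD e₁ F) p + 2 * a * b * dirD e₁ (dirD e₂ F) p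
        + b ^ 2 * dirD e₂ (dirD e₂ F) p := by
  have h : dirD (a • e₁ + b • e₂) F = fun q => a * dirD e₁ F q + b * dirD e₂ F q := by
    funext q; rw [dirD_add_dir, dirD_smul_dir, dirD_smul_dir]
  have d1 : DifferentiableAt ℂ (dirD e₁ F) p := (hF.dirD e₁).differentiableAt (by simp)
  have d2 : DifferentiableAt ℂ (dirD e₂ F) p := (hF.dirD e₂).differentiableAt (by simp)
  rw [h, dirD_add (d1.const_mul a) (d2.const_mul b), dirD_const_mul a d1, dirD_const_mul b d2]
  simp only [dirD_add_dir, dirD_smul_dir]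
  rw [dirD_comm (e := e₂) (e' := e₁) hF]
  ring

end slice

open CauchyData in
/-- A holomorphic solution of the system in characteristic coordinates, real on the slice of real
`(x, y, t)`, solves the Davey-Stewartson system. -/
theorem solvesDSOn_of_holomorphic {α : ℂ} {ρ : ℝ} {U : Set (ℝ × ℝ × ℝ)}
    {ψ φ : ℂ → ℂ → ℂ → ℂ} (hα : (α ^ 2) ^ 2 = 1) (hU : IsOpen U)
    {Ω : Set (ℂ × ℂ × ℂ)} (hΩ : IsOpen Ω)
    (hUΩ : ∀ x y t : ℝ, (x, y, t) ∈ U → (dsXi α x y, dsEta α x y, (t : ℂ)) ∈ Ω)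
    {Ψ φ' P Q H : ℂ × ℂ × ℂ → ℂ} {c c₀ : ℂ}
    (sΨ : ∀ p ∈ Ω, ContDiffAt ℂ ∞ Ψ p) (sP : ∀ p ∈ Ω, ContDiffAt ℂ ∞ P p)
    (sQ : ∀ p ∈ Ω, ContDiffAt ℂ ∞ Q p) (sH : ∀ p ∈ Ω, ContDiffAt ℂ ∞ H p)
    (hψ : ∀ ξ η t, ψ ξ η t = Ψ (ξ, η, t))
    (hφ : ∀ ξ η t, (ξ, η, t) ∈ Ω → φ ξ η t = φ' (ξ, η, t))
    (hφ' : ∀ p ∈ Ω, φ' p = 1 / 2 * dirD eξ P p + 1 / 2 * dirD eη Q p + c₀)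
    (hS : ∀ p ∈ Ω, Complex.I * dirD et Ψ p
      + 1 / 2 * (dirD eξ (dirD eξ Ψ) p + dirD eη (dirD eη Ψ) p) + 2 * φ' p * Ψ p = 0)
    (hP : ∀ p ∈ Ω, dirD eη P p = c - ρ * H p) (hQ : ∀ p ∈ Ω, dirD eξ Q p = c - ρ * H p)
    (hre : ∀ x y t : ℝ, (x, y, t) ∈ U →
      conj (φ' (dsXi α x y, dsEta α x y, (t : ℂ))) = φ' (dsXi α x y, dsEta α x y, (t : ℂ)))
    (hH : ∀ x y t : ℝ, (x, y, t) ∈ U →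
      (‖Ψ (dsXi α x y, dsEta α x y, (t : ℂ))‖ : ℂ) ^ 2 = H (dsXi α x y, dsEta α x y, (t : ℂ))) :
    SolvesDSOn α ρ U ψ φ := by
  set γ : ℝ → ℝ → ℝ → ℂ × ℂ × ℂ := fun x y t => (dsXi α x y, dsEta α x y, (t : ℂ)) with hγ
  have sφ : ∀ p ∈ Ω, ContDiffAt ℂ ∞ φ' p := by
    intro p hp
    have : ContDiffAt ℂ ∞ (fun p => 1 / 2 * dirD eξ P p + 1 / 2 * dirD eη Q p + c₀) p :=
      ((contDiffAt_const.mul ((sP p hp).dirD _)).add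
        (contDiffAt_const.mul ((sQ p hp).dirD _))).add contDiffAt_const
    exact this.congr_of_eventuallyEq ((hΩ.eventually_mem hp).mono fun q hq => hφ' q hq)
  -- The squared modulus of `ψ` is not holomorphic. Replacing it by `H`, which agrees with it on the
  -- real slice, gives a holomorphic extension `F` of `Φ`.
  set F : ℂ × ℂ × ℂ → ℂ := fun p => φ' p - ρ * H p with hF
  have sF : ∀ p ∈ Ω, ContDiffAt ℂ ∞ F p := fun p hp =>
    (sφ p hp).sub (contDiffAt_const.mul (sH p hp))
  set Φ : ℝ → ℝ → ℝ → ℝ := fun x y t => (φ' (γ x y t)).re - ρ * ‖Ψ (γ x y t)‖ ^ 2 with hΦdef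
  have hΦ : ∀ x y t : ℝ, (x, y, t) ∈ U → (Φ x y t : ℂ) = F (γ x y t) := by
    intro x y t hp
    have h1 := hre x y t hp
    rw [Complex.conj_eq_iff_re] at h1
    simp only [hΦdef, hF, Complex.ofReal_sub, Complex.ofReal_mul, Complex.ofReal_pow]
    rw [hH x y t hp, h1]
  have sγ : ContDiff ℝ ∞ (fun p : ℝ × ℝ × ℝ => γ p.1 p.2.1 p.2.2) := by
    have hc : ∀ {f : ℝ × ℝ × ℝ → ℝ}, ContDiff ℝ ∞ f → ContDiff ℝ ∞ (fun p => (f p : ℂ)) :=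
      fun h => Complex.ofRealCLM.contDiff.comp h
    simp only [hγ, dsXi, dsEta]
    have h1 := hc contDiff_fst
    have h2 := hc (contDiff_fst.comp contDiff_snd)
    have h3 := hc (contDiff_snd.comp contDiff_snd)
    exact ((h1.sub (contDiff_const.mul h2)).div_const _).prodMk
      (((h1.add (contDiff_const.mul h2)).div_const _).prodMk h3)
  have smooth : ∀ {f : ℂ × ℂ × ℂ → ℂ}, (∀ p ∈ Ω, ContDiffAt ℂ ∞ f p) →
      ContDiffOn ℝ ∞ (fun p : ℝ × ℝ × ℝ => f (γ p.1 p.2.1 p.2.2)) U := by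
    intro f hf p hp
    exact (((hf _ (hUΩ p.1 p.2.1 p.2.2 hp)).restrict_scalars ℝ).comp p
      sγ.contDiffAt).contDiffWithinAt
  -- the lines in the coordinate directions
  set ex : ℂ × ℂ × ℂ := (1 / 2 : ℂ) • eξ + (1 / 2 : ℂ) • eη with hex
  set ey : ℂ × ℂ × ℂ := (-(Complex.I * α / 2)) • eξ + (Complex.I * α / 2) • eη with hey
  have lx : ∀ x y t, γ x y t = γ 0 y t + (x : ℂ) • ex := by
    intro x y t
    simp only [hγ, hex, eξ, eη, dsXi, dsEta, Prod.smul_mk, Prod.mk_add_mk, Prod.mk.injEq,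
      smul_eq_mul, Complex.ofReal_zero]
    refine ⟨?_, ?_, ?_⟩ <;> ring
  have ly : ∀ x y t, γ x y t = γ x 0 t + (y : ℂ) • ey := by
    intro x y t
    simp only [hγ, hey, eξ, eη, dsXi, dsEta, Prod.smul_mk, Prod.mk_add_mk, Prod.mk.injEq,
      smul_eq_mul, Complex.ofReal_zero]
    refine ⟨?_, ?_, ?_⟩ <;> ring
  have lt : ∀ x y t, γ x y t = γ x y 0 + (t : ℂ) • et := by
    intro x y t
    simp [hγ, et]
  have evx : ∀ {x y t : ℝ}, (x, y, t) ∈ U → ∀ᶠ s in 𝓝 x, (s, y, t) ∈ U := fun {x y t} hp =>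
    (Continuous.tendsto' (f := fun s : ℝ => (s, y, t)) (by fun_prop) x (x, y, t) rfl).eventually
      (hU.mem_nhds hp)
  have evy : ∀ {x y t : ℝ}, (x, y, t) ∈ U → ∀ᶠ s in 𝓝 y, (x, s, t) ∈ U := fun {x y t} hp =>
    (Continuous.tendsto' (f := fun s : ℝ => (x, s, t)) (by fun_prop) y (x, y, t) rfl).eventually
      (hU.mem_nhds hp)
  refine ⟨Φ, ?_, hU, ?_, ?_, ?_, ?_⟩
  · intro x y t hp
    rw [hφ _ _ _ (hUΩ x y t hp), hΦ x y t hp, hψ, hH x y t hp]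
    simp [hF, hγ]
  · simpa only [hψ] using smooth sΨ
  · refine ContDiffOn.congr (f := fun p : ℝ × ℝ × ℝ => (F (γ p.1 p.2.1 p.2.2)).re) ?_ ?_
    · exact Complex.reCLM.contDiff.comp_contDiffOn (smooth sF)
    · intro p hp
      rw [← hΦ p.1 p.2.1 p.2.2 hp, Complex.ofReal_re]
  · intro x y t hp
    have hpΩ : γ x y t ∈ Ω := hUΩ x y t hp
    have hx : iteratedDeriv 2 (fun s => ψ (dsXi α s y) (dsEta α s y) t) x
        = dirD ex (dirD ex Ψ) (γ x y t) := by
      have : (fun s : ℝ => ψ (dsXi α s y) (dsEta α s y) t)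
          = fun s : ℝ => Ψ (γ 0 y t + (s : ℂ) • ex) := by
        funext s; rw [hψ, ← lx]
      rw [this, iteratedDeriv_two_line (by rw [← lx]; exact sΨ _ hpΩ), ← lx]
    have hy : iteratedDeriv 2 (fun s => ψ (dsXi α x s) (dsEta α x s) t) y
        = dirD ey (dirD ey Ψ) (γ x y t) := by
      have : (fun s : ℝ => ψ (dsXi α x s) (dsEta α x s) t)
          = fun s : ℝ => Ψ (γ x 0 t + (s : ℂ) • ey) := by
        funext s; rw [hψ, ← ly]
      rw [this, iteratedDeriv_two_line (by rw [← ly]; exact sΨ _ hpΩ), ← ly]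
    have ht : deriv (fun s : ℝ => ψ (dsXi α x y) (dsEta α x y) s) t = dirD et Ψ (γ x y t) := by
      have : (fun s : ℝ => ψ (dsXi α x y) (dsEta α x y) s)
          = fun s : ℝ => Ψ (γ x y 0 + (s : ℂ) • et) := by
        funext s; rw [hψ, ← lt]
      rw [this, (hasDerivAt_line (by rw [← lt]; exact (sΨ _ hpΩ).differentiableAt (by simp))).deriv,
        ← lt]
    have hpot : ((Φ x y t + ρ * ‖ψ (dsXi α x y) (dsEta α x y) t‖ ^ 2 : ℝ) : ℂ)
        = φ' (γ x y t) := by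
      push_cast
      rw [hΦ x y t hp, hψ, hH x y t hp]
      simp [hF, hγ]
    rw [hx, hy, ht, hpot, hψ, hex, hey, dirD_dirD_combination (sΨ _ hpΩ),
      dirD_dirD_combination (sΨ _ hpΩ)]
    have := hS _ hpΩ
    change _ + 2 * φ' (γ x y t) * Ψ (γ x y t) = 0
    -- As `α⁴ = 1`, the mixed derivatives cancel and `ψ_xx - α² ψ_yy = ½ (ψ_ξξ + ψ_ηη)`.
    ring_nf at this hα ⊢
    simp only [Complex.I_sq, hα] at this ⊢
    linear_combination this
  · intro x y t hp
    have hpΩ : γ x y t ∈ Ω := hUΩ x y t hp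
    have hx : ((iteratedDeriv 2 (fun s => Φ s y t) x : ℝ) : ℂ) = dirD ex (dirD ex F) (γ x y t) := by
      rw [ofReal_iteratedDeriv_two_line (F := F) (q := γ 0 y t) (e := ex)
        (by rw [← lx]; exact sF _ hpΩ), ← lx]
      filter_upwards [evx hp] with s hs
      rw [← lx, hΦ s y t hs]
    have hy : ((iteratedDeriv 2 (fun s => Φ x s t) y : ℝ) : ℂ) = dirD ey (dirD ey F) (γ x y t) := by
      rw [ofReal_iteratedDeriv_two_line (F := F) (q := γ x 0 t) (e := ey)
        (by rw [← ly]; exact sF _ hpΩ), ← ly]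
      filter_upwards [evy hp] with s hs
      rw [← ly, hΦ x s t hs]
    have hn : ((iteratedDeriv 2 (fun s => ‖ψ (dsXi α s y) (dsEta α s y) t‖ ^ 2) x : ℝ) : ℂ)
        = dirD ex (dirD ex H) (γ x y t) := by
      rw [ofReal_iteratedDeriv_two_line (F := H) (q := γ 0 y t) (e := ex)
        (by rw [← lx]; exact sH _ hpΩ), ← lx]
      filter_upwards [evx hp] with s hs
      rw [← lx, hψ, ← hH s y t hs]
      push_cast; rfl
    rw [hx, hy, hn, hex, hey, dirD_dirD_combination (sF _ hpΩ), dirD_dirD_combination (sF _ hpΩ),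
      dirD_dirD_combination (sH _ hpΩ)]
    set p := γ x y t with hpdef
    -- the mixed derivative of the potential
    have m1 : dirD eξ (dirD eη φ') p = -(ρ / 2) * (dirD eξ (dirD eξ H) p + dirD eη (dirD eη H) p) := by
      have e1 : dirD eη φ' =ᶠ[𝓝 p] fun q => 1 / 2 * dirD eξ (dirD eη P) q
          + 1 / 2 * dirD eη (dirD eη Q) q := by
        filter_upwards [hΩ.eventually_mem hpΩ] with q hq
        have d1 : DifferentiableAt ℂ (dirD eξ P) q := ((sP q hq).dirD _).differentiableAt (by simp)
        have d2 : DifferentiableAt ℂ (dirD eη Q) q := ((sQ q hq).dirD _).differentiableAt (by simp)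
        rw [dirD_congr ((hΩ.eventually_mem hq).mono fun r hr => hφ' r hr),
          dirD_add ((d1.const_mul _).fun_add (d2.const_mul _)) (differentiableAt_const _),
          dirD_add (d1.const_mul _) (d2.const_mul _), dirD_const_mul _ d1, dirD_const_mul _ d2,
          dirD_const, dirD_comm (sP q hq), add_zero]
      have d1 : DifferentiableAt ℂ (dirD eξ (dirD eη P)) p :=
        (((sP p hpΩ).dirD _).dirD _).differentiableAt (by simp)
      have d2 : DifferentiableAt ℂ (dirD eη (dirD eη Q)) p :=
        (((sQ p hpΩ).dirD _).dirD _).differentiableAt (by simp)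
      have e2 : dirD eξ (dirD eη Q) =ᶠ[𝓝 p] dirD eη (dirD eξ Q) :=
        (hΩ.eventually_mem hpΩ).mono fun q hq => dirD_comm (sQ q hq)
      -- Here `φ_ξη = ½ (P_η)_ξξ + ½ (Q_ξ)_ηη`, and `P_η` and `Q_ξ` are both `c - ρ H`; the constant
      -- disappears on differentiation.
      have hlin : ∀ (e : ℂ × ℂ × ℂ) (R : ℂ × ℂ × ℂ → ℂ), (∀ q ∈ Ω, R q = c - ρ * H q) →
          dirD e (dirD e R) p = -ρ * dirD e (dirD e H) p := by
        intro e R hR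
        have e3 : dirD e R =ᶠ[𝓝 p] fun q => -ρ * dirD e H q := by
          filter_upwards [hΩ.eventually_mem hpΩ] with q hq
          have dH : DifferentiableAt ℂ H q := (sH q hq).differentiableAt (by simp)
          rw [dirD_congr ((hΩ.eventually_mem hq).mono fun r hr => hR r hr),
            dirD_sub (differentiableAt_const _) (dH.const_mul _), dirD_const, dirD_const_mul _ dH]
          ring
        rw [dirD_congr e3, dirD_const_mul _ (((sH p hpΩ).dirD _).differentiableAt (by simp))]
      rw [dirD_congr e1, dirD_add (d1.const_mul _) (d2.const_mul _), dirD_const_mul _ d1,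
        dirD_const_mul _ d2, dirD_comm ((sQ p hpΩ).dirD eη), dirD_congr e2,
        hlin eξ _ hP, hlin eη _ hQ]
      ring
    have m2 : dirD eξ (dirD eη F) p = dirD eξ (dirD eη φ') p - ρ * dirD eξ (dirD eη H) p := by
      have e1 : dirD eη F =ᶠ[𝓝 p] fun q => dirD eη φ' q - ρ * dirD eη H q := by
        filter_upwards [hΩ.eventually_mem hpΩ] with q hq
        have dφ : DifferentiableAt ℂ φ' q := (sφ q hq).differentiableAt (by simp)
        have dH : DifferentiableAt ℂ H q := (sH q hq).differentiableAt (by simp)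
        rw [hF, dirD_sub dφ (dH.const_mul _), dirD_const_mul _ dH]
      have dφ : DifferentiableAt ℂ (dirD eη φ') p := ((sφ p hpΩ).dirD _).differentiableAt (by simp)
      have dH : DifferentiableAt ℂ (dirD eη H) p := ((sH p hpΩ).dirD _).differentiableAt (by simp)
      rw [dirD_congr e1, dirD_sub dφ (dH.const_mul _), dirD_const_mul _ dH]
    rw [m2, m1]
    -- Now `α⁴ = 1` turns `F_xx + α² F_yy` into `F_ξη`, while `2ρ H_xx = ρ/2 (H_ξξ + 2 H_ξη +
    -- H_ηη)`, which cancels it.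
    ring_nf at hα ⊢
    simp only [Complex.I_sq, hα]
    ring

/-! ### The plane wave factor and solutions from Cauchy data -/

namespace CauchyData

variable {ι : Type*} (D : CauchyData ι) [Fintype ι] [DecidableEq ι]

open Matrix

/-- The phase of the plane wave background. -/
def wave (h : ℝ) (p : ℂ × ℂ × ℂ) : ℂ :=
  -Complex.I * (-(D.κ₁ * D.l) * p.1 + D.κ₂ * D.l * p.2.1
    - (-(D.κ₁ * D.l) ^ 2 - (D.κ₂ * D.l) ^ 2 + h) * (p.2.2 / 2))

/-- The wave function. -/
def Psi (A : ℂ) (h : ℝ) (p : ℂ × ℂ × ℂ) : ℂ := A * D.G p * Complex.exp (D.wave h p)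

theorem contDiff_wave (h : ℝ) : ContDiff ℂ ∞ (D.wave h) := by
  unfold wave; fun_prop

theorem dirD_wave (h : ℝ) (e p) : dirD e (D.wave h) p = D.wave h e := by
  have h : HasDerivAt (fun s : ℂ => D.wave h (p + s • e)) (D.wave h e) 0 := by
    have : (fun s : ℂ => D.wave h (p + s • e)) = fun s => D.wave h p + s * D.wave h e := by
      funext s; simp [wave]; ring
    rw [this]
    simpa using ((hasDerivAt_id (0 : ℂ)).mul_const (D.wave h e)).const_add (D.wave h p)
  exact (deriv_line_eq_dirD ((D.contDiff_wave _).contDiffAt.differentiableAt (by simp))).unique h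

variable {D}

theorem isOpen_det_ne : IsOpen {p | (D.mat p).det ≠ 0} :=
  isOpen_iff_mem_nhds.2 fun _ hp => eventually_det_ne hp

theorem contDiffAt_G {p} (hp : (D.mat p).det ≠ 0) : ContDiffAt ℂ ∞ D.G p :=
  contDiffAt_const.sub (contDiffAt_om hp _ _)

theorem contDiffAt_Gs {p} (hp : (D.mat p).det ≠ 0) : ContDiffAt ℂ ∞ D.Gs p :=
  contDiffAt_const.add (contDiffAt_om hp _ _)

theorem contDiffAt_Psi (A : ℂ) (h : ℝ) {p} (hp : (D.mat p).det ≠ 0) :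
    ContDiffAt ℂ ∞ (D.Psi A h) p :=
  (contDiffAt_const.mul (contDiffAt_G hp)).mul (D.contDiff_wave h).contDiffAt.cexp

theorem dirD_Psi (A : ℂ) (h : ℝ) (e) {p} (hp : (D.mat p).det ≠ 0) :
    dirD e (D.Psi A h) p
      = A * (dirD e D.G p + D.wave h e * D.G p) * Complex.exp (D.wave h p) := by
  have dG := (contDiffAt_G hp).differentiableAt (n := ∞) (by simp)
  have dw := (D.contDiff_wave h).contDiffAt.differentiableAt (x := p) (by simp)
  change dirD e (fun p => A * D.G p * Complex.exp (D.wave h p)) p = _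
  rw [dirD_mul (dG.const_mul _) dw.cexp, dirD_const_mul _ dG, dirD_exp dw, dirD_wave]
  ring

theorem dirD_dirD_Psi (A : ℂ) (h : ℝ) (e) {p} (hp : (D.mat p).det ≠ 0) :
    dirD e (dirD e (D.Psi A h)) p
      = A * (dirD e (dirD e D.G) p + 2 * D.wave h e * dirD e D.G p + D.wave h e ^ 2 * D.G p)
        * Complex.exp (D.wave h p) := by
  have dG := (contDiffAt_G hp).differentiableAt (n := ∞) (by simp)
  have dG' := ((contDiffAt_G hp).dirD e).differentiableAt (n := ∞) (by simp)
  have dw := (D.contDiff_wave h).contDiffAt.differentiableAt (x := p) (by simp)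
  have h1 : dirD e (D.Psi A h) =ᶠ[𝓝 p] fun p =>
      A * (dirD e D.G p + D.wave h e * D.G p) * Complex.exp (D.wave h p) :=
    (eventually_det_ne hp).mono fun q hq => dirD_Psi A h e hq
  rw [dirD_congr h1, dirD_mul ((dG'.fun_add (dG.const_mul _)).const_mul _) dw.cexp,
    dirD_const_mul _ (dG'.fun_add (dG.const_mul _)), dirD_add dG' (dG.const_mul _),
    dirD_const_mul _ dG, dirD_exp dw, dirD_wave]
  ring

/-- A gauge transformation of `schrodinger_G`. The gradient of the plane wave produces its
first-order terms; the squares of the wave numbers cancel against the time frequency, and the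
remaining `-h/2` cancels the constant `h/4` in `pot`, which enters doubled. -/
theorem schrodinger_Psi (hD : D.Valid) (A : ℂ) (h : ℝ) {p} (hp : (D.mat p).det ≠ 0) :
    Complex.I * dirD et (D.Psi A h) p
      + 1 / 2 * (dirD eξ (dirD eξ (D.Psi A h)) p + dirD eη (dirD eη (D.Psi A h)) p)
      + 2 * D.pot h p * D.Psi A h p = 0 := by
  have h0 := schrodinger_G hD hp
  have w1 : D.wave h eξ = Complex.I * D.κ₁ * D.l := by simp [wave, eξ]; ring
  have w2 : D.wave h eη = -Complex.I * D.κ₂ * D.l := by simp [wave, eη]; ring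
  have w3 : D.wave h et = Complex.I * (-(D.κ₁ * D.l) ^ 2 - (D.κ₂ * D.l) ^ 2 + h) / 2 := by
    simp [wave, et]; ring
  rw [dirD_Psi A h et hp, dirD_dirD_Psi A h eξ hp, dirD_dirD_Psi A h eη hp, w1, w2, w3, pot, Psi]
  generalize Complex.exp (D.wave h p) = E at *
  generalize dirD et D.G p = g1 at *
  generalize dirD eξ (dirD eξ D.G) p = g2 at *
  generalize dirD eη (dirD eη D.G) p = g3 at *
  generalize dirD eξ D.G p = g4 at *
  generalize dirD eη D.G p = g5 at *
  linear_combination A * E * h0 + (A * E * D.G p * (h / 2)) * Complex.I_sq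

/-- Under the reality conditions on the slice of real `(x, y, t)`, the functions built from the data
solve the Davey-Stewartson system. -/
theorem solvesDSOn (hD : D.Valid) {α A : ℂ} {ρ h : ℝ} {U : Set (ℝ × ℝ × ℝ)}
    {ψ φ : ℂ → ℂ → ℂ → ℂ} (hα : (α ^ 2) ^ 2 = 1) (hU : IsOpen U)
    (hdet : ∀ x y t : ℝ, (x, y, t) ∈ U → D.tau (dsXi α x y, dsEta α x y, (t : ℂ)) ≠ 0)
    (hψ : ∀ ξ η t, D.tau (ξ, η, t) ≠ 0 → ψ ξ η t = D.Psi A h (ξ, η, t))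
    (hφ : ∀ ξ η t, φ ξ η t = dsPhi (fun ξ η t => D.tau (ξ, η, t)) h ξ η t)
    (hρ : (ρ : ℂ) * (‖A‖ : ℂ) ^ 2 = -(D.κ₁ * D.κ₂))
    (hpot : ∀ x y t : ℝ, (x, y, t) ∈ U → conj (D.pot h (dsXi α x y, dsEta α x y, (t : ℂ)))
      = D.pot h (dsXi α x y, dsEta α x y, (t : ℂ)))
    (hG : ∀ x y t : ℝ, (x, y, t) ∈ U → conj (D.G (dsXi α x y, dsEta α x y, (t : ℂ)))
      = D.Gs (dsXi α x y, dsEta α x y, (t : ℂ)))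
    (hwave : ∀ x y t : ℝ, (D.wave h (dsXi α x y, dsEta α x y, (t : ℂ))).re = 0) :
    SolvesDSOn α ρ U ψ φ := by
  have hdet' : ∀ x y t : ℝ, (x, y, t) ∈ U →
      (dsXi α x y, dsEta α x y, (t : ℂ)) ∈ {p | (D.mat p).det ≠ 0} := fun x y t hp =>
    (tau_ne_zero_iff hD).1 (hdet x y t hp)
  have hΨ : ∀ p ∈ {p | (D.mat p).det ≠ 0},
      (fun p : ℂ × ℂ × ℂ => ψ p.1 p.2.1 p.2.2) =ᶠ[𝓝 p] D.Psi A h := by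
    intro p hp
    filter_upwards [isOpen_det_ne.eventually_mem hp] with q hq
    exact hψ q.1 q.2.1 q.2.2 ((tau_ne_zero_iff hD).2 hq)
  -- The function `ψ` itself serves as `Ψ`, since it is known to equal `D.Psi` only where `tau` does
  -- not vanish. By `hρ`, `c - ρ H` equals `κ₁ κ₂ (G Gs - l²)`, which dictates `c` and `H`.
  refine solvesDSOn_of_holomorphic hα hU (isOpen_det_ne (D := D)) hdet'
    (Ψ := fun p => ψ p.1 p.2.1 p.2.2) (φ' := D.pot h)
    (P := fun p => Complex.I * D.κ₁ * D.om D.au D.av p)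
    (Q := fun p => -(Complex.I * D.κ₂) * D.om D.bu D.bv p)
    (H := fun p => (‖A‖ : ℂ) ^ 2 * (D.G p * D.Gs p)) (c := -(D.κ₁ * D.κ₂ * D.l ^ 2)) (c₀ := h / 4)
    ?_ ?_ ?_ ?_ (fun _ _ _ => rfl) ?_ ?_ ?_ ?_ ?_ hpot ?_
  · exact fun p hp => (contDiffAt_Psi A h hp).congr_of_eventuallyEq (hΨ p hp)
  · exact fun p hp => contDiffAt_const.mul (contDiffAt_om hp _ _)
  · exact fun p hp => contDiffAt_const.mul (contDiffAt_om hp _ _)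
  · exact fun p hp => contDiffAt_const.mul ((contDiffAt_G hp).mul (contDiffAt_Gs hp))
  · intro ξ η t hp
    rw [hφ, dsPhi_tau hD ((tau_ne_zero_iff hD).2 hp)]
  · intro p hp
    rw [dirD_const_mul _ (differentiableAt_om hp _ _), dirD_const_mul _ (differentiableAt_om hp _ _),
      dirD_om_aa hD hp, dirD_om_bb hD hp, pot]
  · intro p hp
    have e := hΨ p hp
    have e1 : ∀ v, dirD v (dirD v fun p : ℂ × ℂ × ℂ => ψ p.1 p.2.1 p.2.2) p
        = dirD v (dirD v (D.Psi A h)) p := fun v =>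
      dirD_congr (e.eventuallyEq_nhds.mono fun _ hq => dirD_congr hq)
    rw [dirD_congr e, e1, e1, e.eq_of_nhds]
    exact schrodinger_Psi hD A h hp
  · intro p hp
    rw [dirD_const_mul _ (differentiableAt_om hp _ _), dirD_η_om_aa hD hp]
    linear_combination D.G p * D.Gs p * hρ
  · intro p hp
    rw [dirD_const_mul _ (differentiableAt_om hp _ _), dirD_ξ_om_bb hD hp]
    linear_combination D.G p * D.Gs p * hρ
  · intro x y t hp
    have e := (hΨ _ (hdet' x y t hp)).eq_of_nhds
    simp only at e ⊢
    rw [e, Psi, ← hG x y t hp, Complex.mul_conj', norm_mul, norm_mul, Complex.norm_exp,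
      hwave x y t]
    simp [mul_pow]

end CauchyData

/-! ## Reality conditions -/

section Conjugation

open Matrix

variable {ι : Type*} [Fintype ι] [DecidableEq ι]

/-- The hypothesis says that the adjoint of `M` is minus its reindexing by `σ`; adjoint, reindexing
and sign all commute with inversion. -/
theorem conj_inv_apply_of_skew {M : Matrix ι ι ℂ} (σ : Equiv.Perm ι)
    (h : ∀ i k, conj (M i k) = -M (σ k) (σ i)) (i k : ι) :
    conj (M⁻¹ i k) = -M⁻¹ (σ k) (σ i) := by
  have h1 : Mᴴ = -M.submatrix σ σ := by
    ext a b; simpa [conjTranspose_apply] using h b a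
  have h2 : (M⁻¹)ᴴ = -(M⁻¹).submatrix σ σ := by
    rw [conjTranspose_nonsing_inv, h1, ← inv_submatrix_equiv]
    -- In the singular case both inverses are zero by convention.
    by_cases hd : IsUnit (M.submatrix σ σ).det
    · exact inv_eq_right_inv (by rw [neg_mul_neg, mul_nonsing_inv _ hd])
    · rw [nonsing_inv_apply_not_isUnit _ hd, nonsing_inv_apply_not_isUnit, neg_zero]
      simpa [det_neg, IsUnit.mul_iff] using hd
  simpa [conjTranspose_apply] using congrFun (congrFun h2 k) i

/-- Inversion reverses products, so the left and right signs change places. -/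
theorem conj_inv_apply_of_sign {M : Matrix ι ι ℂ} (σ : Equiv.Perm ι) {l r : ι → ℂ}
    (hl : ∀ i, l i * l i = 1) (hr : ∀ i, r i * r i = 1)
    (h : ∀ i k, conj (M i k) = l i * r k * M (σ i) (σ k)) (i k : ι) :
    conj (M⁻¹ i k) = r i * l k * M⁻¹ (σ i) (σ k) := by
  have h1 : Mᴴᵀ = diagonal l * M.submatrix σ σ * diagonal r := by
    ext a b
    simp only [transpose_apply, conjTranspose_apply, diagonal_mul, mul_diagonal, submatrix_apply]
    rw [Complex.star_def, h]; ring
  have hl' : (diagonal l)⁻¹ = diagonal l := inv_eq_right_inv (by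
    rw [diagonal_mul_diagonal, ← diagonal_one]; congr 1; ext a; exact hl a)
  have hr' : (diagonal r)⁻¹ = diagonal r := inv_eq_right_inv (by
    rw [diagonal_mul_diagonal, ← diagonal_one]; congr 1; ext a; exact hr a)
  have h2 : (M⁻¹)ᴴᵀ = diagonal r * (M⁻¹).submatrix σ σ * diagonal l := by
    rw [conjTranspose_nonsing_inv, transpose_nonsing_inv, h1, Matrix.mul_inv_rev, Matrix.mul_inv_rev, hl', hr',
      ← inv_submatrix_equiv, mul_assoc]
  have := congrFun (congrFun h2 i) k
  simp only [transpose_apply, conjTranspose_apply, diagonal_mul, mul_diagonal, submatrix_apply,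
    Complex.star_def] at this
  rw [this]; ring

theorem conj_form_of_skew {M : Matrix ι ι ℂ} (σ : Equiv.Perm ι)
    (h : ∀ i k, conj (M i k) = -M (σ k) (σ i)) {x x' y y' : ι → ℂ}
    (hx : ∀ i, conj (x i) = x' (σ i)) (hy : ∀ i, conj (y i) = y' (σ i)) :
    conj (x ⬝ᵥ (M⁻¹ *ᵥ y)) = -(y' ⬝ᵥ (M⁻¹ *ᵥ x')) := by
  simp only [dotProduct, mulVec, map_sum, map_mul, conj_inv_apply_of_skew σ h, hx, hy]
  rw [← Equiv.sum_comp σ (fun i => y' i * ∑ k, M⁻¹ i k * x' k)]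
  simp only [← Equiv.sum_comp σ (fun k => M⁻¹ (σ _) k * x' k), Finset.mul_sum]
  rw [Finset.sum_comm, ← Finset.sum_neg_distrib]
  refine Finset.sum_congr rfl fun i _ => ?_
  rw [← Finset.sum_neg_distrib]
  refine Finset.sum_congr rfl fun k _ => ?_
  ring

theorem conj_form_of_sign {M : Matrix ι ι ℂ} (σ : Equiv.Perm ι) {l r : ι → ℂ}
    (hl : ∀ i, l i * l i = 1) (hr : ∀ i, r i * r i = 1)
    (h : ∀ i k, conj (M i k) = l i * r k * M (σ i) (σ k)) {x x' y y' : ι → ℂ}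
    (hx : ∀ i, r i * conj (x i) = x' (σ i)) (hy : ∀ i, l i * conj (y i) = y' (σ i)) :
    conj (x ⬝ᵥ (M⁻¹ *ᵥ y)) = x' ⬝ᵥ (M⁻¹ *ᵥ y') := by
  simp only [dotProduct, mulVec, map_sum, map_mul, conj_inv_apply_of_sign σ hl hr h]
  rw [← Equiv.sum_comp σ (fun i => x' i * ∑ k, M⁻¹ i k * y' k)]
  simp only [← Equiv.sum_comp σ (fun k => M⁻¹ (σ _) k * y' k), Finset.mul_sum, ← hx, ← hy]
  refine Finset.sum_congr rfl fun i _ => Finset.sum_congr rfl fun k _ => ?_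
  ring

end Conjugation

namespace CauchyData

variable {ι : Type*} (D : CauchyData ι)

/-- The reality conditions leading to DS1. -/
structure RealDS1 (σ : Equiv.Perm ι) : Prop where
  κ₁_real : conj D.κ₁ = D.κ₁
  κ₂_real : conj D.κ₂ = D.κ₂
  l_real : conj D.l = D.l
  conj_av : ∀ i, conj (D.av i) = D.au (σ i)
  conj_au : ∀ i, conj (D.au i) = D.av (σ i)
  conj_bv : ∀ i, conj (D.bv i) = D.bu (σ i)
  conj_bu : ∀ i, conj (D.bu i) = D.bv (σ i)
  conj_c : ∀ i, conj (D.c i) = -D.c (σ i)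
  conj_C : ∀ i k, conj (D.C i k) = -D.C (σ k) (σ i)

/-- The reality conditions leading to DS2. -/
structure RealDS2 (σ : Equiv.Perm ι) (sl sr : ι → ℂ) (μ e₁ e₂ e₃ e₄ : ℂ) : Prop where
  sl_sq : ∀ i, sl i * sl i = 1
  sr_sq : ∀ i, sr i * sr i = 1
  μ_sq : μ * μ = 1
  e₁₃ : e₁ * e₃ = μ
  e₂₄ : e₂ * e₄ = μ
  e₂₃ : e₂ * e₃ = -1
  conj_κ₁ : conj D.κ₁ = μ * D.κ₂
  conj_κ₂ : conj D.κ₂ = μ * D.κ₁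
  l_real : conj D.l = D.l
  μ_l : μ * D.l = -D.l
  conj_av : ∀ i, conj (D.av i) = μ * D.bv (σ i)
  conj_au : ∀ i, conj (D.au i) = μ * D.bu (σ i)
  conj_bv : ∀ i, conj (D.bv i) = μ * D.av (σ i)
  conj_bu : ∀ i, conj (D.bu i) = μ * D.au (σ i)
  sr_au : ∀ i, sr i * conj (D.au i) = e₁ * D.bu (σ i)
  sr_bu : ∀ i, sr i * conj (D.bu i) = e₂ * D.au (σ i)
  sl_av : ∀ i, sl i * conj (D.av i) = e₃ * D.bv (σ i)
  sl_bv : ∀ i, sl i * conj (D.bv i) = e₄ * D.av (σ i)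
  conj_c : ∀ i, conj (D.c i) = sl i * sr i * D.c (σ i)
  conj_C : ∀ i k, conj (D.C i k) = sl i * sr k * D.C (σ i) (σ k)

variable {D} {σ : Equiv.Perm ι}

theorem conj_dsXi_I (x y : ℝ) : conj (dsXi Complex.I x y) = dsXi Complex.I x y := by
  simp [dsXi, map_ofNat]

theorem conj_dsEta_I (x y : ℝ) : conj (dsEta Complex.I x y) = dsEta Complex.I x y := by
  simp [dsEta, map_ofNat]

theorem conj_dsXi_one (x y : ℝ) : conj (dsXi 1 x y) = dsEta 1 x y := by
  simp [dsXi, dsEta, map_ofNat]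

theorem conj_dsEta_one (x y : ℝ) : conj (dsEta 1 x y) = dsXi 1 x y := by
  simp [dsXi, dsEta, map_ofNat]; ring

namespace RealDS1

variable (h : D.RealDS1 σ) {p : ℂ × ℂ × ℂ} (h1 : conj p.1 = p.1) (h2 : conj p.2.1 = p.2.1)
  (h3 : conj p.2.2 = p.2.2)

include h h1 h2 h3

theorem conj_phase (k : ι) : conj (D.phase p k) = D.phase p (σ k) := by
  simp only [phase, map_add, map_sub, map_mul, map_div₀, map_pow, Complex.conj_I, h.κ₁_real,
    h.κ₂_real, h.conj_av, h.conj_au, h.conj_bv, h.conj_bu, h1, h2, h3, map_ofNat]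
  ring

theorem re_wave (b : ℝ) : (D.wave b p).re = 0 := by
  have : conj (D.wave b p) = -D.wave b p := by
    simp only [wave, map_add, map_sub, map_mul, map_div₀, map_pow, map_neg, Complex.conj_I,
      h.κ₁_real, h.κ₂_real, h.l_real, h1, h2, h3, map_ofNat, Complex.conj_ofReal]
    ring
  have := congrArg Complex.re this
  simp only [Complex.conj_re, Complex.neg_re] at this
  linarith

variable [Fintype ι] [DecidableEq ι]

theorem conj_mat (i k : ι) : conj (D.mat p i k) = -D.mat p (σ k) (σ i) := by
  simp only [mat, Matrix.add_apply, map_add, h.conj_C, Matrix.diagonal_apply, σ.injective.eq_iff]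
  by_cases hik : i = k
  · subst hik
    simp only [if_true, map_mul, h.conj_c, ← Complex.exp_conj, map_neg, h.conj_phase h1 h2 h3]
    ring
  · simp [hik, Ne.symm hik]

theorem conj_om {x x' y y' : ι → ℂ}
    (hx : ∀ i, conj (x i) = x' (σ i)) (hy : ∀ i, conj (y i) = y' (σ i)) :
    conj (D.om x y p) = -D.om y' x' p :=
  conj_form_of_skew σ (h.conj_mat h1 h2 h3) hx hy

theorem conj_G : conj (D.G p) = D.Gs p := by
  rw [G, Gs, map_sub, h.l_real, h.conj_om h1 h2 h3 h.conj_bu h.conj_av, sub_neg_eq_add]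

theorem conj_pot (b : ℝ) : conj (D.pot b p) = D.pot b p := by
  have sq : ∀ {x x' : ι → ℂ}, (∀ i, conj (x i) = x' (σ i)) →
      ∀ i, conj ((x ^ 2) i) = (x' ^ 2) (σ i) := by
    intro x x' hx i; simp [hx]
  simp only [pot, potA, potB, map_add, map_sub, map_mul, map_pow, map_neg, map_div₀, map_one,
    map_ofNat, Complex.conj_ofReal, h.κ₁_real, h.κ₂_real]
  rw [h.conj_om h1 h2 h3 h.conj_au (sq h.conj_av), h.conj_om h1 h2 h3 (sq h.conj_au) h.conj_av,
    h.conj_om h1 h2 h3 h.conj_au h.conj_av, h.conj_om h1 h2 h3 h.conj_bu (sq h.conj_bv),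
    h.conj_om h1 h2 h3 (sq h.conj_bu) h.conj_bv, h.conj_om h1 h2 h3 h.conj_bu h.conj_bv]
  ring

end RealDS1

namespace RealDS2

variable {sl sr : ι → ℂ} {μ e₁ e₂ e₃ e₄ : ℂ} (h : D.RealDS2 σ sl sr μ e₁ e₂ e₃ e₄)
  {p : ℂ × ℂ × ℂ} (h1 : conj p.1 = p.2.1) (h2 : conj p.2.1 = p.1) (h3 : conj p.2.2 = p.2.2)

include h h1 h2 h3

/-- Conjugation exchanges `ξ` with `η` and the `a`-data with the `b`-data. The sign `μ` occurs in
even powers only. -/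
theorem conj_phase (k : ι) : conj (D.phase p k) = D.phase p (σ k) := by
  simp only [phase, map_add, map_sub, map_mul, map_div₀, map_pow, Complex.conj_I, h.conj_κ₁,
    h.conj_κ₂, h.conj_av, h.conj_au, h.conj_bv, h.conj_bu, h1, h2, h3, map_ofNat]
  have := h.μ_sq
  linear_combination (-Complex.I * D.κ₂ * (D.bv (σ k) - D.bu (σ k)) * p.2.1
    + Complex.I * D.κ₁ * (D.av (σ k) - D.au (σ k)) * p.1
    - Complex.I * (D.κ₂ ^ 2 * (D.bu (σ k) ^ 2 - D.bv (σ k) ^ 2)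
      - D.κ₁ ^ 2 * (D.au (σ k) ^ 2 - D.av (σ k) ^ 2)) * (p.2.2 / 2) * (μ * μ + 1)) * this

theorem re_wave (b : ℝ) : (D.wave b p).re = 0 := by
  have hl := h.μ_l
  have : conj (D.wave b p) = -D.wave b p := by
    have k1 : conj (D.κ₁ * D.l) = -(D.κ₂ * D.l) := by
      rw [map_mul, h.conj_κ₁, h.l_real]; linear_combination D.κ₂ * hl
    have k2 : conj (D.κ₂ * D.l) = -(D.κ₁ * D.l) := by
      rw [map_mul, h.conj_κ₂, h.l_real]; linear_combination D.κ₁ * hl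
    rw [wave]
    generalize D.κ₁ * D.l = X at *
    generalize D.κ₂ * D.l = Y at *
    simp only [map_add, map_sub, map_mul, map_div₀, map_pow, map_neg, Complex.conj_I,
      k1, k2, h1, h2, h3, map_ofNat, Complex.conj_ofReal]
    ring
  have := congrArg Complex.re this
  simp only [Complex.conj_re, Complex.neg_re] at this
  linarith

variable [Fintype ι] [DecidableEq ι]

theorem conj_mat (i k : ι) : conj (D.mat p i k) = sl i * sr k * D.mat p (σ i) (σ k) := by
  simp only [mat, Matrix.add_apply, map_add, h.conj_C, Matrix.diagonal_apply, σ.injective.eq_iff]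
  by_cases hik : i = k
  · subst hik
    simp only [if_true, map_mul, h.conj_c, ← Complex.exp_conj, map_neg, h.conj_phase h1 h2 h3]
    ring
  · simp [hik]

theorem conj_om {x x' y y' : ι → ℂ} {e e' : ℂ}
    (hx : ∀ i, sr i * conj (x i) = e * x' (σ i)) (hy : ∀ i, sl i * conj (y i) = e' * y' (σ i)) :
    conj (D.om x y p) = e * e' * D.om x' y' p := by
  have := conj_form_of_sign σ h.sl_sq h.sr_sq (h.conj_mat h1 h2 h3) (x' := e • x') (y' := e' • y')
    hx hy
  rw [om, this, mul_assoc, ← om_smul_right, ← om_smul_left]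
  rfl

/-- The condition `e₂ e₃ = -1` is what turns the minus sign of `G` into the plus sign of `Gs`. -/
theorem conj_G : conj (D.G p) = D.Gs p := by
  rw [G, Gs, map_sub, h.l_real, h.conj_om h1 h2 h3 h.sr_bu h.sl_av, h.e₂₃]
  ring

theorem conj_pot (b : ℝ) : conj (D.pot b p) = D.pot b p := by
  have sq : ∀ {s x x' : ι → ℂ} {e : ℂ}, (∀ i, conj (x i) = μ * x' (σ i)) →
      (∀ i, s i * conj (x i) = e * x' (σ i)) →
      ∀ i, s i * conj ((x ^ 2) i) = (e * μ) * (x' ^ 2) (σ i) := by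
    intro s x x' e hx hs i
    simp only [Pi.pow_apply, map_pow]
    linear_combination (conj (x i)) * hs i + e * x' (σ i) * hx i
  simp only [pot, potA, potB, map_add, map_sub, map_mul, map_pow, map_neg, map_div₀, map_one,
    map_ofNat, Complex.conj_ofReal, h.conj_κ₁, h.conj_κ₂]
  rw [h.conj_om h1 h2 h3 h.sr_au (sq h.conj_av h.sl_av),
    h.conj_om h1 h2 h3 (sq h.conj_au h.sr_au) h.sl_av,
    h.conj_om h1 h2 h3 h.sr_au h.sl_av, h.conj_om h1 h2 h3 h.sr_bu (sq h.conj_bv h.sl_bv),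
    h.conj_om h1 h2 h3 (sq h.conj_bu h.sr_bu) h.sl_bv, h.conj_om h1 h2 h3 h.sr_bu h.sl_bv]
  have h13 := h.e₁₃
  have h24 := h.e₂₄
  have hμ := h.μ_sq
  rw [show e₁ * (e₃ * μ) = 1 by rw [← mul_assoc, h13, hμ],
    show e₁ * μ * e₃ = 1 by rw [mul_right_comm, h13, hμ],
    show e₂ * (e₄ * μ) = 1 by rw [← mul_assoc, h24, hμ],
    show e₂ * μ * e₄ = 1 by rw [mul_right_comm, h24, hμ], h13, h24]
  simp only [mul_pow, show μ ^ 2 = 1 by rw [_root_.sq, hμ]]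
  ring

end RealDS2

end CauchyData

/-! ## The determinantal functions in terms of Cauchy data -/

namespace DSParams

variable {ι : Type*} (p : DSParams ι)

/-- The points are distinct as far as needed for the phases. -/
structure Regular : Prop where
  a_ne_b : p.a ≠ p.b
  v_ne_u : ∀ i k, p.v i ≠ p.u k
  a_ne_v : ∀ i, p.a ≠ p.v i
  a_ne_u : ∀ i, p.a ≠ p.u i
  b_ne_v : ∀ i, p.b ≠ p.v i
  b_ne_u : ∀ i, p.b ≠ p.u i

/-- The Cauchy data of the determinantal functions, scaled by `ε (a - b)`. -/
def data (ε : ℂ) : CauchyData ι where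
  κ₁ := p.κ₁ / (ε * (p.a - p.b))
  κ₂ := p.κ₂ / (ε * (p.a - p.b))
  l := ε
  av i := ε * (p.a - p.b) / (p.a - p.v i)
  au i := ε * (p.a - p.b) / (p.a - p.u i)
  bv i := ε * (p.a - p.b) / (p.b - p.v i)
  bu i := ε * (p.a - p.b) / (p.b - p.u i)
  c i := ε * (p.a - p.b) * Complex.exp (p.d i) / (p.v i - p.u i)
  C := Matrix.of fun i k => ε * (p.a - p.b) / (p.v i - p.u k)

variable {p}

theorem data_valid (hp : p.Regular) {ε : ℂ} (hε : ε ≠ 0) : (p.data ε).Valid where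
  relA i k := by
    have h1 := sub_ne_zero.2 (hp.a_ne_v i)
    have h2 := sub_ne_zero.2 (hp.a_ne_u k)
    have h3 := sub_ne_zero.2 (hp.v_ne_u i k)
    simp only [data, Matrix.of_apply]
    field_simp
    ring
  relB i k := by
    have h1 := sub_ne_zero.2 (hp.b_ne_v i)
    have h2 := sub_ne_zero.2 (hp.b_ne_u k)
    have h3 := sub_ne_zero.2 (hp.v_ne_u i k)
    simp only [data, Matrix.of_apply]
    field_simp
    ring
  rel_v i := by
    have h1 := sub_ne_zero.2 (hp.a_ne_v i)
    have h2 := sub_ne_zero.2 (hp.b_ne_v i)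
    simp only [data]
    field_simp
    ring
  rel_u i := by
    have h1 := sub_ne_zero.2 (hp.a_ne_u i)
    have h2 := sub_ne_zero.2 (hp.b_ne_u i)
    simp only [data]
    field_simp
    ring
  c_ne i := by
    have h1 := sub_ne_zero.2 (hp.v_ne_u i i)
    have h2 := sub_ne_zero.2 hp.a_ne_b
    simp [data, h1, h2, hε]

theorem data_phase (hp : p.Regular) {ε : ℂ} (hε : ε ≠ 0) (ξ η t : ℂ) (k : ι) :
    (p.data ε).phase (ξ, η, t) k = p.Z ξ η t k := by
  have h1 := sub_ne_zero.2 (hp.a_ne_v k)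
  have h2 := sub_ne_zero.2 (hp.b_ne_v k)
  have h3 := sub_ne_zero.2 (hp.a_ne_u k)
  have h4 := sub_ne_zero.2 (hp.b_ne_u k)
  have h5 := sub_ne_zero.2 hp.a_ne_b
  simp only [CauchyData.phase, data, Z, V, W]
  field_simp
  ring

variable [Fintype ι] [DecidableEq ι]

open Matrix

/-- Splitting `e^{½(z_i + z_k)}` into a row factor and a column factor exhibits `T` as a diagonal
rescaling of a Cauchy-type matrix; the shift `β r_k` affects only its diagonal part. -/
theorem det_T (hp : p.Regular) {ε : ℂ} (hε : ε ≠ 0) (β ξ η t : ℂ) :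
    (p.T β ξ η t).det = (∏ k, Complex.exp (p.Z ξ η t k + β * p.r k) / (p.data ε).c k) *
      (diagonal (fun k => (p.data ε).c k * Complex.exp (-(p.Z ξ η t k + β * p.r k)))
        + (p.data ε).C).det := by
  set y : ι → ℂ := fun k => p.Z ξ η t k - p.d k + β * p.r k with hy
  have hab := sub_ne_zero.2 hp.a_ne_b
  have h1 : p.T β ξ η t = diagonal (fun k => Complex.exp (1 / 2 * y k) * (p.v k - p.u k)
        / (ε * (p.a - p.b))) *
      (diagonal (fun k => (p.data ε).c k * Complex.exp (-(p.Z ξ η t k + β * p.r k)))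
        + (p.data ε).C) * diagonal (fun k => Complex.exp (1 / 2 * y k)) := by
    ext i k
    have h3 := sub_ne_zero.2 (hp.v_ne_u i k)
    have h4 := sub_ne_zero.2 (hp.v_ne_u i i)
    simp only [T, mul_diagonal, diagonal_mul, Matrix.add_apply, diagonal_apply, Matrix.of_apply]
    have e1 : Complex.exp (1 / 2 * (y i + y k))
        = Complex.exp (1 / 2 * y i) * Complex.exp (1 / 2 * y k) := by
      rw [← Complex.exp_add]; ring_nf
    change _ + _ * Complex.exp (1 / 2 * (y i + y k)) = _
    rw [e1]
    by_cases h : i = k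
    · subst h
      have e2 : Complex.exp (p.d i) * Complex.exp (-(p.Z ξ η t i + β * p.r i))
          * (Complex.exp (1 / 2 * y i) * Complex.exp (1 / 2 * y i)) = 1 := by
        rw [← Complex.exp_add, ← Complex.exp_add, ← Complex.exp_add, Complex.exp_eq_one_iff]
        exact ⟨0, by simp only [hy]; push_cast; ring⟩
      have e3 : Complex.exp (1 / 2 * y i) * (p.v i - p.u i) / (ε * (p.a - p.b)) *
          (ε * (p.a - p.b) * Complex.exp (p.d i) / (p.v i - p.u i)
            * Complex.exp (-(p.Z ξ η t i + β * p.r i))) * Complex.exp (1 / 2 * y i) = 1 := by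
        refine Eq.trans ?_ e2
        field_simp
      clear_value y
      simp only [if_true, data, Matrix.of_apply]
      rw [mul_add, add_mul, e3]
      field_simp
    · simp only [if_neg h, data, Matrix.of_apply]
      field_simp
      ring
  rw [h1, det_mul, det_mul, det_diagonal, det_diagonal, mul_right_comm, ← Finset.prod_mul_distrib]
  congr 1
  refine Finset.prod_congr rfl fun k _ => ?_
  have h4 := sub_ne_zero.2 (hp.v_ne_u k k)
  have e1 : Complex.exp (p.Z ξ η t k + β * p.r k)
      = Complex.exp (1 / 2 * y k) * Complex.exp (1 / 2 * y k) * Complex.exp (p.d k) := by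
    rw [← Complex.exp_add, ← Complex.exp_add]; congr 1; simp only [hy]; ring
  simp only [data]
  rw [e1]
  field_simp

theorem data_tau (hp : p.Regular) {ε : ℂ} (hε : ε ≠ 0) (ξ η t : ℂ) :
    (p.data ε).tau (ξ, η, t) = p.tau ξ η t := by
  rw [tau, det_T hp hε, CauchyData.tau, CauchyData.mat]
  simp [data_phase hp hε]

theorem det_add_vecMulVec' {A : Matrix ι ι ℂ} (hA : A.det ≠ 0) (x y : ι → ℂ) :
    (A - vecMulVec x y).det = A.det * (1 - y ⬝ᵥ (A⁻¹ *ᵥ x)) := by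
  have h : A - vecMulVec x y = A * (1 - vecMulVec (A⁻¹ *ᵥ x) y) := by
    rw [mul_sub, mul_one, mul_vecMulVec, mulVec_mulVec, mul_nonsing_inv _ (isUnit_iff_ne_zero.2 hA),
      one_mulVec]
  have h2 := det_one_add_replicateCol_mul_replicateRow (ι := Unit) (-(A⁻¹ *ᵥ x)) y
  rw [h, det_mul, sub_eq_add_neg, ← neg_vecMulVec, vecMulVec_eq Unit, h2, dotProduct_neg,
    sub_eq_add_neg]

theorem exp_r (hp : p.Regular) (k : ι) : Complex.exp (p.r k)
    = (p.b - p.v k) / (p.b - p.u k) * ((p.a - p.u k) / (p.a - p.v k)) := by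
  have h1 := sub_ne_zero.2 (hp.a_ne_v k)
  have h2 := sub_ne_zero.2 (hp.b_ne_v k)
  have h3 := sub_ne_zero.2 (hp.a_ne_u k)
  have h4 := sub_ne_zero.2 (hp.b_ne_u k)
  rw [r, Complex.exp_log (by positivity)]

/-- Since `e^{r_k} = (ε - av_k)/(ε - au_k)`, shifting the phases by `r_k` amounts, up to diagonal
factors, to subtracting a rank-one matrix from `mat`. The matrix determinant lemma then produces a
single form. -/
theorem det_T_one (hp : p.Regular) {ε : ℂ} (hε : ε ≠ 0) {ξ η t : ℂ} (hτ : p.tau ξ η t ≠ 0) :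
    ε * ((p.T 1 ξ η t).det / (p.T 0 ξ η t).det) = (p.data ε).G (ξ, η, t) := by
  have hD := data_valid hp hε
  set D := p.data ε with hDdef
  have hdet : (D.mat (ξ, η, t)).det ≠ 0 :=
    (CauchyData.tau_ne_zero_iff hD).1 (by rwa [data_tau hp hε])
  have hs : ε * (p.a - p.b) ≠ 0 := mul_ne_zero hε (sub_ne_zero.2 hp.a_ne_b)
  have nv : ∀ k, ε - D.av k ≠ 0 := by
    intro k
    have h1 := sub_ne_zero.2 (hp.a_ne_v k)
    have h2 := sub_ne_zero.2 (hp.b_ne_v k)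
    have : ε - D.av k = ε * (p.b - p.v k) / (p.a - p.v k) := by
      simp only [hDdef, data]; field_simp; ring
    rw [this]; positivity
  have nu : ∀ k, ε - D.au k ≠ 0 := by
    intro k
    have h1 := sub_ne_zero.2 (hp.a_ne_u k)
    have h2 := sub_ne_zero.2 (hp.b_ne_u k)
    have : ε - D.au k = ε * (p.b - p.u k) / (p.a - p.u k) := by
      simp only [hDdef, data]; field_simp; ring
    rw [this]; positivity
  have er : ∀ k, Complex.exp (p.r k) = (ε - D.av k) / (ε - D.au k) := by
    intro k
    have h1 := sub_ne_zero.2 (hp.a_ne_v k)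
    have h2 := sub_ne_zero.2 (hp.b_ne_v k)
    have h3 := sub_ne_zero.2 (hp.a_ne_u k)
    have h4 := sub_ne_zero.2 (hp.b_ne_u k)
    have e1 : ε - D.av k = ε * (p.b - p.v k) / (p.a - p.v k) := by
      simp only [hDdef, data]; field_simp; ring
    have e2 : ε - D.au k = ε * (p.b - p.u k) / (p.a - p.u k) := by
      simp only [hDdef, data]; field_simp; ring
    rw [exp_r hp, e1, e2]
    field_simp
  set M₁ := diagonal (fun k => D.c k * Complex.exp (-(p.Z ξ η t k + 1 * p.r k))) + D.C with hM₁
  -- On the diagonal the factors absorb the shift `e^{-r_k}`; for the entries of `C` this is the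
  -- displacement relation `relA`.
  have key : diagonal (fun k => ε - D.av k) * M₁
      = (D.mat (ξ, η, t) - vecMulVec D.av (fun k => D.au k / (ε - D.au k)))
        * diagonal (fun k => ε - D.au k) := by
    ext i k
    have hn := nu k
    simp only [hM₁, CauchyData.mat, diagonal_mul, mul_diagonal, Matrix.add_apply, Matrix.sub_apply,
      vecMulVec_apply, diagonal_apply]
    have hrel : (D.av i - D.au k) * D.C i k = D.av i * D.au k := hD.relA i k
    by_cases h : i = k
    · subst h
      have hv := nv i
      simp only [if_true, hDdef, data_phase hp hε]
      simp only [← hDdef]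
      rw [one_mul, neg_add, Complex.exp_add, Complex.exp_neg (p.r i), er]
      field_simp
      linear_combination -hrel
    · simp only [if_neg h]
      field_simp
      linear_combination -hrel
  -- `rel_u` rewrites `au/(ε - au)` as `bu/ε`, which brings in the second family.
  have hbu : (fun k => D.au k / (ε - D.au k)) = (ε)⁻¹ • D.bu := by
    funext k
    have hn := nu k
    have := hD.rel_u k
    change D.au k * D.bu k = ε * (D.bu k - D.au k) at this
    simp only [Pi.smul_apply, smul_eq_mul]
    field_simp
    linear_combination this
  have hdetkey := congrArg det key
  rw [det_mul, det_mul, det_diagonal, det_diagonal, det_add_vecMulVec' hdet, hbu] at hdetkey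
  have hform : (ε⁻¹ • D.bu) ⬝ᵥ ((D.mat (ξ, η, t))⁻¹ *ᵥ D.av) = ε⁻¹ * D.om D.bu D.av (ξ, η, t) := by
    rw [← CauchyData.om_smul_left]; rfl
  rw [hform] at hdetkey
  have h0 : (p.T 0 ξ η t).det = (∏ k, Complex.exp (p.Z ξ η t k) / D.c k) * (D.mat (ξ, η, t)).det := by
    have := data_tau hp hε ξ η t
    rw [tau] at this
    rw [← this, CauchyData.tau]
    simp only [hDdef, data_phase hp hε]
  have h1 : (p.T 1 ξ η t).det = (∏ k, Complex.exp (p.Z ξ η t k) / D.c k)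
      * ((∏ k, (ε - D.av k)) / ∏ k, (ε - D.au k)) * M₁.det := by
    rw [det_T hp hε, ← Finset.prod_div_distrib, ← Finset.prod_mul_distrib]
    congr 1
    refine Finset.prod_congr rfl fun k _ => ?_
    rw [one_mul, Complex.exp_add, er]
    ring
  have nU : ∏ k, (ε - D.au k) ≠ 0 := Finset.prod_ne_zero_iff.2 fun k _ => nu k
  have nE : ∏ k, Complex.exp (p.Z ξ η t k) / D.c k ≠ 0 :=
    Finset.prod_ne_zero_iff.2 fun k _ => div_ne_zero (Complex.exp_ne_zero _) (hD.c_ne k)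
  rw [h0, h1, CauchyData.G]
  change _ = ε - _
  set X := D.om D.bu D.av (ξ, η, t)
  have : (∏ k, (ε - D.av k)) / (∏ k, (ε - D.au k)) * M₁.det
      = (D.mat (ξ, η, t)).det * (1 - ε⁻¹ * X) := by
    rw [div_mul_eq_mul_div, hdetkey]; field_simp
  rw [mul_assoc, this]
  field_simp

theorem data_Psi (hp : p.Regular) {ε : ℝ} (hε : 0 < ε) {ξ η t : ℂ} (hτ : p.tau ξ η t ≠ 0) :
    p.psi ξ η t = (p.data ε).Psi
      ((Real.sqrt ‖(p.data ε).κ₁ * (p.data ε).κ₂‖ : ℂ) * Complex.exp (Complex.I * p.θ)) p.h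
      (ξ, η, t) := by
  have hε' : (ε : ℂ) ≠ 0 := by exact_mod_cast hε.ne'
  have hab := sub_ne_zero.2 hp.a_ne_b
  have hba := sub_ne_zero.2 hp.a_ne_b.symm
  have hA : (p.A : ℂ) = (Real.sqrt ‖(p.data ε).κ₁ * (p.data ε).κ₂‖ : ℂ) * ε := by
    rw [← Complex.ofReal_mul]
    congr 1
    have h1 : ‖(p.data ε).κ₁ * (p.data ε).κ₂‖ = ‖p.κ₁ * p.κ₂‖ / (ε * ‖p.a - p.b‖) ^ 2 := by
      simp only [data, norm_mul, norm_div, Complex.norm_real, Real.norm_of_nonneg hε.le]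
      field_simp
    have h2 : 0 < ‖p.a - p.b‖ := norm_pos_iff.2 hab
    rw [h1, Real.sqrt_div (norm_nonneg _), Real.sqrt_sq (by positivity), A]
    field_simp
  have hw : -Complex.I * (p.G₁ * ξ + p.G₂ * η - p.G₃ * (t / 2)) = (p.data ε).wave p.h (ξ, η, t) := by
    have e1 : p.G₁ = -((p.data ε).κ₁ * (p.data ε).l) := by
      simp only [G₁, data]; field_simp; ring
    have e2 : p.G₂ = (p.data ε).κ₂ * (p.data ε).l := by
      simp only [G₂, data]; field_simp
    simp only [CauchyData.wave, G₃, e1, e2]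
    ring
  rw [psi, hw, hA, CauchyData.Psi, ← det_T_one hp hε' hτ]
  ring

theorem data_phi (hp : p.Regular) {ε : ℂ} (hε : ε ≠ 0) (ξ η t : ℂ) :
    p.phi ξ η t = dsPhi (fun ξ η t => (p.data ε).tau (ξ, η, t)) p.h ξ η t := by
  rw [phi]
  congr 1
  funext ξ η t
  exact (data_tau hp hε ξ η t).symm

end DSParams

/-! ## The bright functions in terms of Cauchy data -/

section Bordered

open Matrix

variable {ι : Type*} [Fintype ι] [DecidableEq ι]

theorem det_updateRow_one (i : ι) (a : ι → ℂ) : ((1 : Matrix ι ι ℂ).updateRow i a).det = a i := by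
  rw [← cramer_transpose_apply, transpose_one, cramer_one]; rfl

theorem det_updateCol_one (i : ι) (a : ι → ℂ) : ((1 : Matrix ι ι ℂ).updateCol i a).det = a i := by
  rw [← cramer_apply, cramer_one]; rfl

/-- A determinant of a bordered matrix after elimination with a pivot in the added column. -/
theorem det_eliminated_bordered {M : Matrix ι ι ℂ} (hM : M.det ≠ 0) (x y : ι → ℂ) (o : ι)
    (ho : y o ≠ 0) :
    (Matrix.of fun i k => if i = o then x k else M i k - y i / y o * M o k).det * y o
      = M.det * (x ⬝ᵥ (M⁻¹ *ᵥ y)) := by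
  set ν : ι → ℂ := x ᵥ* M⁻¹ with hν
  have hνM : ν ᵥ* M = x := by
    rw [hν, vecMul_vecMul, nonsing_inv_mul _ (isUnit_iff_ne_zero.2 hM), vecMul_one]
  set w : ℂ := x ⬝ᵥ (M⁻¹ *ᵥ y) with hw
  have hνy : ν ⬝ᵥ y = w := by rw [hw, dotProduct_mulVec]
  -- Left multiplication by `B` eliminates with row `o` as pivot, and `A` puts `x` into row `o`. As
  -- `x = ν M` and the pivot step has subtracted multiples of row `o`, the coefficient of that row
  -- has to be `w / y o`. So `det A = w / y o` and `det B = 1`.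
  set A : Matrix ι ι ℂ := (1 : Matrix ι ι ℂ).updateRow o (Function.update ν o (w / y o)) with hA
  set B : Matrix ι ι ℂ := (1 : Matrix ι ι ℂ).updateCol o
    (Function.update (fun i => -(y i / y o)) o 1) with hB
  have hBM : ∀ i k, (B * M) i k = if i = o then M o k else M i k - y i / y o * M o k := by
    intro i k
    rw [mul_apply]
    have : ∀ j, B i j * M j k = (if i = j then M j k else 0)
        + (if j = o then (B i o - if i = o then 1 else 0) * M o k else 0) := by
      intro j
      by_cases hj : j = o
      · subst hj
        by_cases hij : i = j
        · subst hij; simp; ring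
        · simp [hij]
      · simp [hB, updateCol_ne hj, one_apply, hj]
    simp only [this, Finset.sum_add_distrib, Finset.sum_ite_eq, Finset.sum_ite_eq', Finset.mem_univ,
      if_true]
    by_cases hi : i = o
    · subst hi; simp [hB]
    · simp [hB, hi]; ring
  have hABM : (Matrix.of fun i k => if i = o then x k else M i k - y i / y o * M o k)
      = A * (B * M) := by
    ext i k
    by_cases hi : i = o
    · subst hi
      rw [of_apply, if_pos rfl, mul_apply]
      simp only [hBM, hA, updateRow_self]
      rw [← Finset.add_sum_erase _ _ (Finset.mem_univ i)]
      have h1 : ∑ j ∈ Finset.univ.erase i, Function.update ν i (w / y i) j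
          * (if j = i then M i k else M j k - y j / y i * M i k)
          = ∑ j ∈ Finset.univ.erase i, (ν j * M j k - M i k / y i * (ν j * y j)) := by
        refine Finset.sum_congr rfl fun j hj => ?_
        rw [Function.update_of_ne (Finset.ne_of_mem_erase hj), if_neg (Finset.ne_of_mem_erase hj)]
        ring
      have h2 : ∑ j ∈ Finset.univ.erase i, ν j * M j k = x k - ν i * M i k := by
        rw [← hνM, vecMul, dotProduct, ← Finset.add_sum_erase _ _ (Finset.mem_univ i)]; ring
      have h3 : ∑ j ∈ Finset.univ.erase i, ν j * y j = w - ν i * y i := by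
        rw [← hνy, dotProduct, ← Finset.add_sum_erase _ _ (Finset.mem_univ i)]; ring
      rw [h1, Finset.sum_sub_distrib, ← Finset.mul_sum, h2, h3, Function.update_self, if_pos rfl]
      field_simp
      ring
    · rw [of_apply, if_neg hi, mul_apply]
      simp only [hBM, hA, updateRow_ne hi, one_apply, ite_mul, one_mul, zero_mul,
        Finset.sum_ite_eq, Finset.mem_univ, if_true, if_neg hi]
  rw [hABM, det_mul, det_mul, hA, hB, det_updateRow_one, det_updateCol_one]
  simp only [Function.update_self]
  field_simp

end Bordered

namespace BrightParams

variable {N : ℕ} (q : BrightParams N)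

/-- The Cauchy data of the bright functions. -/
def data : CauchyData (Fin N ⊕ Fin N) where
  κ₁ := q.κ₁
  κ₂ := q.κ₂
  l := 0
  av := Sum.elim (fun _ => 0) (fun k => -q.αv (.inr k))
  au := Sum.elim (fun k => -q.αu (.inl k)) (fun _ => 0)
  bv := Sum.elim (fun k => -q.αv (.inl k)) (fun _ => 0)
  bu := Sum.elim (fun _ => 0) (fun k => -q.αu (.inr k))
  c := Sum.elim (fun k => -Complex.exp (q.d (.inl k))) (fun k => Complex.exp (q.d (.inr k)))
  C := Matrix.of fun i k => match i, k with
    | .inl _, .inl _ => 0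
    | .inr _, .inr _ => 0
    | .inl i, .inr k => q.αv (.inl i) * q.αu (.inr k) / (q.αu (.inr k) - q.αv (.inl i))
    | .inr i, .inl k => q.αv (.inr i) * q.αu (.inl k) / (q.αu (.inl k) - q.αv (.inr i))

variable {q}

theorem data_valid (hq : q.Admissible) : q.data.Valid where
  relA i k := by
    rcases i with i | i <;> rcases k with k | k <;> simp [data]
    have := sub_ne_zero.2 (hq.even_odd i k).symm
    field_simp
    ring
  relB i k := by
    rcases i with i | i <;> rcases k with k | k <;> simp [data]
    have := sub_ne_zero.2 (hq.odd_even i k).symm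
    field_simp
    ring
  rel_v i := by rcases i with i | i <;> simp [data]
  rel_u i := by rcases i with i | i <;> simp [data]
  c_ne i := by rcases i with i | i <;> simp [data]

theorem data_phase (ξ η t : ℂ) (i : Fin N ⊕ Fin N) : q.data.phase (ξ, η, t) i = q.Z ξ η t i := by
  rcases i with i | i <;> simp [data, CauchyData.phase, Z] <;> ring

open Matrix

/-- `1` at the even and `-1` at the odd indices. -/
def sgn : Fin N ⊕ Fin N → ℂ := Sum.elim (fun _ => -1) (fun _ => 1)

theorem exp_phase_div_c (ξ η t : ℂ) (i : Fin N ⊕ Fin N) :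
    Complex.exp (q.data.phase (ξ, η, t) i) / q.data.c i = sgn i * Complex.exp (q.z ξ η t i) := by
  rw [data_phase, z, Complex.exp_sub]
  rcases i with i | i
  · simp only [data, sgn, Sum.elim_inl]; field_simp
  · simp only [data, sgn, Sum.elim_inr]; field_simp

theorem c_mul_exp (ξ η t : ℂ) (i : Fin N ⊕ Fin N) :
    q.data.c i * Complex.exp (-q.data.phase (ξ, η, t) i)
      = sgn i * Complex.exp (-q.z ξ η t i) := by
  rw [data_phase, z, neg_sub, Complex.exp_sub, Complex.exp_neg]
  rcases i with i | i
  · simp only [data, sgn, Sum.elim_inl]; field_simp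
  · simp only [data, sgn, Sum.elim_inr]; field_simp

theorem data_tau (hq : q.Admissible) (ξ η t : ℂ) : q.data.tau (ξ, η, t) = q.tau ξ η t := by
  have h1 : q.M ξ η t = diagonal (fun i => sgn i * Complex.exp (1 / 2 * q.z ξ η t i))
      * q.data.mat (ξ, η, t) * diagonal (fun i => Complex.exp (1 / 2 * q.z ξ η t i)) := by
    ext i k
    have hd : Complex.exp (1 / 2 * q.z ξ η t i) * Complex.exp (1 / 2 * q.z ξ η t i)
        * Complex.exp (-q.z ξ η t i) = 1 := by
      rw [← Complex.exp_add, ← Complex.exp_add, Complex.exp_eq_one_iff]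
      exact ⟨0, by push_cast; ring⟩
    simp only [CauchyData.mat, mul_diagonal, diagonal_mul, Matrix.add_apply, diagonal_apply,
      c_mul_exp]
    rcases i with i | i <;> rcases k with k | k
    · by_cases h : i = k
      · subst h
        simp only [M, of_apply, if_true, sgn, Sum.elim_inl, data]
        linear_combination -hd
      · simp [M, data, h]
    · have := sub_ne_zero.2 (hq.odd_even i k)
      have := sub_ne_zero.2 (hq.odd_even i k).symm
      simp only [M, of_apply, sgn, Sum.elim_inl, data, reduceCtorEq, if_false]
      rw [mul_add, Complex.exp_add]
      field_simp
      ring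
    · have := sub_ne_zero.2 (hq.even_odd i k)
      have := sub_ne_zero.2 (hq.even_odd i k).symm
      simp only [M, of_apply, sgn, Sum.elim_inr, data, reduceCtorEq, if_false]
      rw [mul_add, Complex.exp_add]
      field_simp
      ring
    · by_cases h : i = k
      · subst h
        simp only [M, of_apply, if_true, sgn, Sum.elim_inr, data]
        linear_combination -hd
      · simp [M, data, h]
  rw [tau, h1, det_mul, det_mul, det_diagonal, det_diagonal, mul_right_comm,
    ← Finset.prod_mul_distrib, CauchyData.tau]
  congr 1
  refine Finset.prod_congr rfl fun i _ => ?_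
  rw [exp_phase_div_c, mul_assoc, ← Complex.exp_add]
  ring_nf

variable [NeZero N]

/-- Up to diagonal rescaling and row operations, `K` is the eliminated bordered matrix of
`det_eliminated_bordered` with border `bu`, `av` and pivot at the index `2`. Since `av` vanishes at
odd indices, elimination alters even rows only. -/
theorem det_K (hq : q.Admissible) {ξ η t : ℂ} (hτ : q.tau ξ η t ≠ 0) :
    (q.K ξ η t).det = -(q.tau ξ η t * q.data.om q.data.bu q.data.av (ξ, η, t)) := by
  have hdet : (q.data.mat (ξ, η, t)).det ≠ 0 :=
    (CauchyData.tau_ne_zero_iff (data_valid hq)).1 (by rwa [data_tau hq])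
  set D := q.data with hD
  set M := D.mat (ξ, η, t) with hM
  set o : Fin N ⊕ Fin N := .inr 0 with ho
  have hy : D.av o ≠ 0 := by simpa [hD, data, ho] using hq.αv_ne (.inr 0)
  set h : Fin N ⊕ Fin N → ℂ := fun i => Complex.exp (1 / 2 * (q.z ξ η t i + q.r i)) with hh
  have hsq : ∀ i, h i * h i = Complex.exp (q.z ξ η t i) * Complex.exp (q.r i) := by
    intro i; simp only [hh, ← Complex.exp_add]; ring_nf
  have hne : ∀ i, h i ≠ 0 := fun i => Complex.exp_ne_zero _
  have hsql : ∀ i, h (.inl i) * h (.inl i) * (q.αv (.inl i) * q.αu (.inl i))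
      = -Complex.exp (q.z ξ η t (.inl i)) := by
    intro i
    have h1 := hq.αv_ne (.inl i)
    have h2 := hq.αu_ne (.inl i)
    rw [hsq, r, Complex.exp_neg, Complex.exp_log (by simp [h1, h2])]
    field_simp
  have hsqr : ∀ i, h (.inr i) * h (.inr i)
      = -Complex.exp (q.z ξ η t (.inr i)) * (q.αv (.inr i) * q.αu (.inr i)) := by
    intro i
    have h1 := hq.αv_ne (.inr i)
    have h2 := hq.αu_ne (.inr i)
    rw [hsq, r, Complex.exp_log (by simp [h1, h2])]
    ring
  have hexp : ∀ i k, Complex.exp (1 / 2 * (q.z ξ η t i + q.z ξ η t k + q.r i + q.r k))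
      = h i * h k := by
    intro i k; simp only [hh, ← Complex.exp_add]; ring_nf
  have hexp' : ∀ i k, Complex.exp (1 / 2 * (q.z ξ η t i - q.z ξ η t k + q.r i - q.r k))
      = h i / h k := by
    intro i k; simp only [hh, ← Complex.exp_sub]; ring_nf
  -- The row factors `f` and column factors `g` absorb the half-phases and the `r̂`; index `2` gets
  -- its own row factor because its row has become the border.
  set f : Fin N ⊕ Fin N → ℂ := Sum.elim (fun i => -(q.αv (.inl i) * h (.inl i)))
    (fun i => if i = 0 then -h (.inr 0) else -(h (.inr i) / q.αv (.inr i))) with hf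
  set g : Fin N ⊕ Fin N → ℂ := Sum.elim (fun k => -(q.αu (.inl k) * h (.inl k)))
    (fun k => h (.inr k) / q.αu (.inr k)) with hg
  set Y : Matrix (Fin N ⊕ Fin N) (Fin N ⊕ Fin N) ℂ :=
    Matrix.of fun i k => if i = o then D.bu k else M i k - D.av i / D.av o * M o k with hY
  -- Subtracting the border row from the odd rows keeps the determinant and turns the odd-even
  -- entries of `C` into multiples of those of `K`.
  set X : Matrix (Fin N ⊕ Fin N) (Fin N ⊕ Fin N) ℂ :=
    Matrix.of fun i k => Y i k + Sum.elim (fun _ => -1) (fun _ => 0) i * Y o k with hX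
  have hdetX : X.det = Y.det :=
    det_eq_of_forall_row_eq_smul_add_const (Sum.elim (fun _ => -1) (fun _ => 0)) o rfl
      fun i k => by simp only [hX, of_apply]
  have hYdet : Y.det * D.av o = M.det * D.om D.bu D.av (ξ, η, t) :=
    det_eliminated_bordered hdet D.bu D.av o hy
  have hMa : ∀ i k, M i k = (if i = k then sgn i * Complex.exp (-q.z ξ η t i) else 0) + D.C i k := by
    intro i k
    simp only [hM, CauchyData.mat, Matrix.add_apply, diagonal_apply, hD, c_mul_exp]
  have hK : q.K ξ η t = diagonal f * X * diagonal g := by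
    ext i k
    rw [mul_diagonal, diagonal_mul]
    rcases i with i | i
    · rcases k with k | k
      · by_cases hik : i = k
        · subst hik
          have e := hsql i
          have e2 := Complex.exp_ne_zero (q.z ξ η t (.inl i))
          simp only [K, of_apply, hX, hY, hMa, if_true, hf, hg, hD, data, Sum.elim_inl, sgn, ho,
            reduceCtorEq, if_false, Complex.exp_neg]
          field_simp
          linear_combination e
        · simp [K, hX, hY, hMa, hik, hD, data, ho]
      · have e1 := sub_ne_zero.2 (hq.odd_even i k)
        have e2 := sub_ne_zero.2 (hq.odd_even i k).symm
        have e3 := hq.αu_ne (.inr k)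
        simp only [K, of_apply, hX, hY, hMa, if_true, hf, hg, hD, data, Sum.elim_inl, Sum.elim_inr,
          ho, reduceCtorEq, if_false, hexp]
        field_simp
        ring
    · by_cases hi : i = 0
      · subst hi
        rcases k with k | k
        · simp [K, hX, hY, hD, data, ho]
        · have e3 := hq.αu_ne (.inr k)
          by_cases hk : (0 : Fin N) = k
          · subst hk
            simp only [K, of_apply, hX, hY, if_true, hf, hg, hD, data, Sum.elim_inr, ho, hexp,
              and_self, ne_eq, not_true_eq_false, and_false, if_false]
            field_simp
            ring
          · have hk' : ¬ k = 0 := fun h => hk h.symm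
            simp only [K, of_apply, hX, hY, if_true, hf, hg, hD, data, Sum.elim_inr, ho, hexp,
              hk, hk', and_false, false_and, if_false]
            field_simp
            ring
      · have hio : ¬ (Sum.inr i : Fin N ⊕ Fin N) = Sum.inr 0 := by simpa using hi
        have e4 := hq.αv_ne (.inr i)
        have e5 := hq.αv_ne (.inr 0)
        rcases k with k | k
        · have e1 := sub_ne_zero.2 (hq.even_odd i k)
          have e2 := sub_ne_zero.2 (hq.even_odd i k).symm
          have e6 := sub_ne_zero.2 (hq.even_odd 0 k)
          have e7 := sub_ne_zero.2 (hq.even_odd 0 k).symm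
          simp only [K, of_apply, hX, hY, hMa, hf, hg, hD, data, Sum.elim_inl, Sum.elim_inr,
            ho, reduceCtorEq, if_false, hexp, hi, hio]
          field_simp
          ring
        · have e3 := hq.αu_ne (.inr k)
          have e8 := hne (.inr 0)
          by_cases hk : k = 0
          · subst hk
            have e := hsqr 0
            have e2 := Complex.exp_ne_zero (q.z ξ η t (.inr 0))
            simp only [K, of_apply, hX, hY, hMa, hf, hg, hD, data, Sum.elim_inr, ho,
              if_false, if_true, hexp', hi, hio, and_true, ne_eq, not_false_eq_true, sgn,
              Complex.exp_neg, true_and, and_self, false_and]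
            field_simp
            linear_combination (-(h (.inr i) * q.αv (.inr i))) * e
          · have hk' : ¬ (Sum.inr 0 : Fin N ⊕ Fin N) = Sum.inr k := by
              simpa using fun h => hk h.symm
            by_cases hik : i = k
            · subst hik
              have e := hsqr i
              have e2 := Complex.exp_ne_zero (q.z ξ η t (.inr i))
              simp only [K, of_apply, hX, hY, hMa, hf, hg, hD, data, Sum.elim_inr, ho,
                if_false, if_true, hi, hio, hk', sgn, Complex.exp_neg, and_self, false_and]
              field_simp
              linear_combination q.αv (.inr 0) * e
            · simp [K, hX, hY, hMa, hf, hg, hD, data, ho, hi, hk, hik, Ne.symm hk]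
  -- The diagonal factors reproduce the prefactor of `tau`, except for an extra `αv` at the pivot.
  -- It cancels the pivot `av o = -αv o`, leaving the minus sign of the claim.
  have hfg : ∀ i, f i * g i = (sgn i * Complex.exp (q.z ξ η t i))
      * (if i = o then q.αv o else 1) := by
    intro i
    rcases i with i | i
    · have e := hsql i
      simp only [hf, hg, Sum.elim_inl, sgn, ho, reduceCtorEq, if_false]
      linear_combination e
    · have e := hsqr i
      have e3 := hq.αu_ne (.inr i)
      have e4 := hq.αv_ne (.inr i)
      by_cases hi : i = 0
      · subst hi
        simp only [hf, hg, Sum.elim_inr, sgn, ho, if_true]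
        field_simp
        linear_combination (-1 : ℂ) * e
      · have hio : ¬ (Sum.inr i : Fin N ⊕ Fin N) = Sum.inr 0 := by simpa using hi
        simp only [hf, hg, Sum.elim_inr, sgn, ho, hi, hio, if_false]
        field_simp
        linear_combination (-1 : ℂ) * e
  have hprod : (∏ i, f i) * ∏ i, g i
      = (∏ k, Complex.exp (D.phase (ξ, η, t) k) / D.c k) * q.αv o := by
    rw [← Finset.prod_mul_distrib, Finset.prod_congr rfl fun i _ => hfg i,
      Finset.prod_mul_distrib, Finset.prod_ite_eq' Finset.univ o, if_pos (Finset.mem_univ _)]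
    simp only [hD, exp_phase_div_c]
  have hyo : D.av o = -q.αv o := by simp [hD, data, ho]
  rw [hK, det_mul, det_mul, det_diagonal, det_diagonal, mul_right_comm, hprod, hdetX,
    ← data_tau hq, CauchyData.tau, mul_assoc, mul_assoc]
  change _ * (_ * _) = -(_ * (M.det * _))
  rw [← hYdet, hyo]
  ring

theorem data_Psi (hq : q.Admissible) {ξ η t : ℂ} (hτ : q.tau ξ η t ≠ 0) :
    q.psi ξ η t = q.data.Psi
      ((Real.sqrt ‖q.data.κ₁ * q.data.κ₂‖ : ℂ) * Complex.exp (Complex.I * q.θ)) q.h (ξ, η, t) := by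
  have hw : q.data.wave q.h (ξ, η, t) = Complex.I * q.h * (t / 2) := by
    simp [CauchyData.wave, data]; ring
  have hG : (q.K ξ η t).det / (q.M ξ η t).det = q.data.G (ξ, η, t) := by
    rw [det_K hq hτ, CauchyData.G]
    change -(q.tau ξ η t * _) / q.tau ξ η t = 0 - _
    field_simp
    ring
  rw [psi, hG, CauchyData.Psi, hw]
  rfl

omit [NeZero N] in
theorem data_phi (hq : q.Admissible) (ξ η t : ℂ) :
    q.phi ξ η t = dsPhi (fun ξ η t => q.data.tau (ξ, η, t)) q.h ξ η t := by
  rw [phi]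
  congr 1
  funext ξ η t
  exact (data_tau hq ξ η t).symm

end BrightParams

/-! ## The four families of solutions -/

theorem CauchyData.isOpen_regular {ι : Type*} [Fintype ι] [DecidableEq ι] (D : CauchyData ι)
    (α : ℂ) : IsOpen (dsRegularSet α fun ξ η t => D.tau (ξ, η, t)) := by
  have h1 : Continuous fun p : ℝ × ℝ × ℝ => (dsXi α p.1 p.2.1, dsEta α p.1 p.2.1, (p.2.2 : ℂ)) := by
    unfold dsXi dsEta; fun_prop
  exact isOpen_ne.preimage (D.contDiff_tau.continuous.comp h1)

theorem norm_amplitude_sq (z : ℂ) (θ : ℝ) :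
    (‖(Real.sqrt ‖z‖ : ℂ) * Complex.exp (Complex.I * θ)‖ : ℂ) ^ 2 = (‖z‖ : ℂ) := by
  rw [norm_mul, mul_comm Complex.I, Complex.norm_exp_ofReal_mul_I, mul_one, Complex.norm_real,
    Real.norm_of_nonneg (Real.sqrt_nonneg _), ← Complex.ofReal_pow, Real.sq_sqrt (norm_nonneg _)]

theorem sign_mul_norm_of_real {x y s : ℂ} (hx : conj x = x) (hy : conj y = y) (hs : conj s = s)
    (hs0 : s ≠ 0) : ((-Real.sign (x.re * y.re) : ℝ) : ℂ) * (‖x / s * (y / s)‖ : ℂ)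
      = -(x / s * (y / s)) := by
  rw [Complex.conj_eq_iff_re] at hx hy hs
  rw [← hx, ← hy, ← hs]
  rw [← hs] at hs0
  simp only [Complex.ofReal_re]
  generalize x.re = x at *
  generalize y.re = y at *
  generalize s.re = s at *
  have hs' : s ≠ 0 := by exact_mod_cast hs0
  have h1 : x / s * (y / s) = (x * y) / s ^ 2 := by field_simp
  have h2 : (x : ℂ) / s * (y / s) = ((x * y / s ^ 2 : ℝ) : ℂ) := by rw [← h1]; push_cast; rfl
  rw [h2, Complex.norm_real, ← Complex.ofReal_mul, ← Complex.ofReal_neg]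
  congr 1
  have h3 : 0 < s ^ 2 := by positivity
  rw [Real.norm_eq_abs, abs_div, abs_of_pos h3]
  rcases lt_trichotomy (x * y) 0 with h | h | h
  · rw [Real.sign_of_neg h, abs_of_neg h]; ring
  · rw [h]; simp
  · rw [Real.sign_of_pos h, abs_of_pos h]; ring

namespace DSParams

variable {ι : Type*} {p : DSParams ι}

theorem DarkRealityDS1.conj_u (h : p.DarkRealityDS1) (k : ι) : conj (p.u k) = p.v k := by
  rw [← h.conj_v, Complex.conj_conj]

/-- A real `a` or `b` equal to `v_i` or `u_i` would force `v_i = u_i` by conjugation. -/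
theorem DarkRealityDS1.regular (h : p.DarkRealityDS1) (hp : p.Admissible) : p.Regular where
  a_ne_b := hp.a_ne_b
  v_ne_u := hp.v_ne_u
  a_ne_v i e := hp.v_ne_u i i (by rw [← h.conj_v, ← e, h.a_real])
  a_ne_u i e := hp.v_ne_u i i (by rw [← h.conj_u, ← e, h.a_real])
  b_ne_v i e := hp.v_ne_u i i (by rw [← h.conj_v, ← e, h.b_real])
  b_ne_u i e := hp.v_ne_u i i (by rw [← h.conj_u, ← e, h.b_real])

theorem DarkRealityDS2.conj_b (h : p.DarkRealityDS2) : conj p.b = p.a := by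
  rw [← h.conj_a, Complex.conj_conj]

theorem DarkRealityDS2.conj_κ₂ (h : p.DarkRealityDS2) : conj p.κ₂ = p.κ₁ := by
  rw [← h.conj_κ₁, Complex.conj_conj]

/-- If `a` or `b` were one of the real points, it would be real, giving `a = b`. -/
theorem DarkRealityDS2.regular (h : p.DarkRealityDS2) (hp : p.Admissible) : p.Regular where
  a_ne_b := hp.a_ne_b
  v_ne_u := hp.v_ne_u
  a_ne_v i e := hp.a_ne_b (by rw [← h.conj_a, e, h.v_real])
  a_ne_u i e := hp.a_ne_b (by rw [← h.conj_a, e, h.u_real])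
  b_ne_v i e := hp.a_ne_b (by rw [← h.conj_b, e, h.v_real])
  b_ne_u i e := hp.a_ne_b (by rw [← h.conj_b, e, h.u_real])

/-- With `u = conj v`, the matrix with entries `1/(v_i - u_k)` is skew-Hermitian, so no permutation
is needed. -/
theorem DarkRealityDS1.data_real (h : p.DarkRealityDS1) :
    (p.data 1).RealDS1 (Equiv.refl ι) where
  κ₁_real := by simp [data, h.κ₁_real, h.a_real, h.b_real]
  κ₂_real := by simp [data, h.κ₂_real, h.a_real, h.b_real]
  l_real := by simp [data]
  conj_av i := by simp [data, h.conj_v, h.a_real, h.b_real]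
  conj_au i := by simp [data, h.conj_u, h.a_real, h.b_real]
  conj_bv i := by simp [data, h.conj_v, h.a_real, h.b_real]
  conj_bu i := by simp [data, h.conj_u, h.a_real, h.b_real]
  conj_c i := by
    simp only [data, map_mul, map_div₀, map_sub, map_one, h.conj_u, h.conj_v, h.a_real, h.b_real,
      ← Complex.exp_conj, h.d_real, Equiv.refl_apply]
    rw [← neg_sub (p.v i), div_neg]
  conj_C i k := by
    simp only [data, Matrix.of_apply, map_mul, map_div₀, map_sub, map_one, h.conj_u, h.conj_v,
      h.a_real, h.b_real, Equiv.refl_apply]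
    rw [← neg_sub (p.v k), div_neg]

/-- The scale `a - b` changes sign under conjugation, whence `μ = -1`; the points themselves are
fixed, so the permutation is trivial. -/
theorem DarkRealityDS2.data_real (h : p.DarkRealityDS2) :
    (p.data 1).RealDS2 (Equiv.refl ι) (fun _ => 1) (fun _ => -1) (-1) 1 1 (-1) (-1) := by
  have hs : ∀ x : ℂ, (p.b - p.a) / x = -((p.a - p.b) / x) := by
    intro x; rw [← neg_sub, neg_div]
  refine ⟨?_, ?_, ?_, ?_, ?_, ?_, ?_, ?_, ?_, ?_, ?_, ?_, ?_, ?_, ?_, ?_, ?_, ?_, ?_, ?_⟩ <;>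
    intros <;>
    simp only [data, one_mul, mul_one, neg_mul, mul_neg, neg_neg, map_mul, map_div₀, map_sub,
      map_one, h.conj_a, h.conj_b, h.conj_κ₁, h.conj_κ₂, h.u_real, h.v_real, h.d_real, ← Complex.exp_conj,
      Equiv.refl_apply, hs, Matrix.of_apply]
  · rw [← neg_sub, div_neg]
  · rw [← neg_sub, div_neg]
  · rw [← neg_sub p.a, neg_mul, neg_div]

variable [Fintype ι] [DecidableEq ι]

theorem isOpen_regular (hp : p.Regular) (α : ℂ) : IsOpen (dsRegularSet α p.tau) := by
  have := (p.data 1).isOpen_regular α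
  simpa only [data_tau hp one_ne_zero] using this

theorem data_Psi_one (hp : p.Regular) {ξ η t : ℂ} (hτ : p.tau ξ η t ≠ 0) :
    p.psi ξ η t = (p.data 1).Psi
      ((Real.sqrt ‖(p.data 1).κ₁ * (p.data 1).κ₂‖ : ℂ) * Complex.exp (Complex.I * p.θ)) p.h
      (ξ, η, t) := by
  have := data_Psi hp (ε := 1) zero_lt_one hτ
  rwa [Complex.ofReal_one] at this

theorem solvesDS1 (hp : p.Admissible) (h : p.DarkRealityDS1) {U : Set (ℝ × ℝ × ℝ)} (hU : IsOpen U)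
    (hreg : U ⊆ dsRegularSet Complex.I p.tau) :
    SolvesDSOn Complex.I (-Real.sign (p.κ₁.re * p.κ₂.re)) U p.psi p.phi := by
  have hr := h.regular hp
  have hD := h.data_real
  have hτ : ∀ ξ η t, (p.data 1).tau (ξ, η, t) = p.tau ξ η t := data_tau hr one_ne_zero
  refine CauchyData.solvesDSOn (D := p.data 1) (data_valid hr one_ne_zero)
    (A := (Real.sqrt ‖(p.data 1).κ₁ * (p.data 1).κ₂‖ : ℂ) * Complex.exp (Complex.I * p.θ))
    (h := p.h) (by simp) hU ?_ ?_ (data_phi hr one_ne_zero) ?_ ?_ ?_ ?_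
  · intro x y t hx
    rw [hτ]
    have := hreg hx
    rwa [dsRegularSet, Set.mem_ofPred_eq] at this
  · intro ξ η t hne
    rw [hτ] at hne
    exact data_Psi_one hr hne
  · rw [norm_amplitude_sq]
    simpa [data] using sign_mul_norm_of_real h.κ₁_real h.κ₂_real (s := p.a - p.b)
      (by simp [h.a_real, h.b_real]) (sub_ne_zero.2 hp.a_ne_b)
  · exact fun x y t _ => hD.conj_pot (CauchyData.conj_dsXi_I x y) (CauchyData.conj_dsEta_I x y)
      (Complex.conj_ofReal t) _
  · exact fun x y t _ => hD.conj_G (CauchyData.conj_dsXi_I x y) (CauchyData.conj_dsEta_I x y)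
      (Complex.conj_ofReal t)
  · exact fun x y t => hD.re_wave (CauchyData.conj_dsXi_I x y) (CauchyData.conj_dsEta_I x y)
      (Complex.conj_ofReal t) _

theorem solvesDS2 (hp : p.Admissible) (h : p.DarkRealityDS2) {U : Set (ℝ × ℝ × ℝ)} (hU : IsOpen U)
    (hreg : U ⊆ dsRegularSet 1 p.tau) :
    SolvesDSOn 1 1 U p.psi p.phi := by
  have hr := h.regular hp
  have hD := h.data_real
  have hτ : ∀ ξ η t, (p.data 1).tau (ξ, η, t) = p.tau ξ η t := data_tau hr one_ne_zero
  refine CauchyData.solvesDSOn (D := p.data 1) (data_valid hr one_ne_zero)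
    (A := (Real.sqrt ‖(p.data 1).κ₁ * (p.data 1).κ₂‖ : ℂ) * Complex.exp (Complex.I * p.θ))
    (h := p.h) (by simp) hU ?_ ?_ (data_phi hr one_ne_zero) ?_ ?_ ?_ ?_
  · intro x y t hx
    rw [hτ]
    have := hreg hx
    rwa [dsRegularSet, Set.mem_ofPred_eq] at this
  · intro ξ η t hne
    rw [hτ] at hne
    exact data_Psi_one hr hne
  · have : (p.data 1).κ₂ = -conj (p.data 1).κ₁ := by rw [hD.conj_κ₁]; ring
    rw [norm_amplitude_sq, this, mul_neg, Complex.mul_conj', norm_neg, norm_pow, Complex.norm_real]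
    simp
  · exact fun x y t _ => hD.conj_pot (CauchyData.conj_dsXi_one x y) (CauchyData.conj_dsEta_one x y)
      (Complex.conj_ofReal t) _
  · exact fun x y t _ => hD.conj_G (CauchyData.conj_dsXi_one x y) (CauchyData.conj_dsEta_one x y)
      (Complex.conj_ofReal t)
  · exact fun x y t => hD.re_wave (CauchyData.conj_dsXi_one x y) (CauchyData.conj_dsEta_one x y)
      (Complex.conj_ofReal t) _

end DSParams

namespace BrightParams

variable {N : ℕ} {q : BrightParams N}

theorem RealityDS1.data_real (h : q.RealityDS1) : q.data.RealDS1 (Equiv.sumComm _ _) := by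
  have h1 : ∀ k, conj (q.αv (.inr k)) = q.αu (.inl k) := fun k => by
    rw [← h.conj_αu_odd, Complex.conj_conj]
  have h2 : ∀ k, conj (q.αv (.inl k)) = q.αu (.inr k) := fun k => by
    rw [← h.conj_αu_even, Complex.conj_conj]
  have h3 : ∀ k, conj (q.d (.inr k)) = q.d (.inl k) := fun k => by
    rw [← h.conj_d, Complex.conj_conj]
  refine ⟨h.κ₁_real, h.κ₂_real, by simp [data], ?_, ?_, ?_, ?_, ?_, ?_⟩
  · rintro (i | i) <;> simp [data, h1]
  · rintro (i | i) <;> simp [data, h.conj_αu_odd]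
  · rintro (i | i) <;> simp [data, h2]
  · rintro (i | i) <;> simp [data, h.conj_αu_even]
  · rintro (i | i) <;> simp [data, h3, h.conj_d, ← Complex.exp_conj]
  · rintro (i | i) (k | k)
    · simp [data]
    · simp only [data, Matrix.of_apply, map_div₀, map_mul, map_sub, h2, h.conj_αu_even,
        Equiv.sumComm_apply, Sum.swap_inl, Sum.swap_inr]
      rw [← neg_sub, div_neg, mul_comm]
    · simp only [data, Matrix.of_apply, map_div₀, map_mul, map_sub, h1, h.conj_αu_odd,
        Equiv.sumComm_apply, Sum.swap_inl, Sum.swap_inr]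
      rw [← neg_sub, div_neg, mul_comm]
    · simp [data]

/-- Conjugation exchanges odd and even indices. The value `μ = 1` is compatible with `μ l = -l`
because `l = 0`; the index-dependent signs compensate for the opposite signs of `c` at odd and even
indices. -/
theorem RealityDS2.data_real (h : q.RealityDS2) : q.data.RealDS2 (Equiv.sumComm _ _)
    (Sum.elim (fun _ => 1) (fun _ => -1)) (Sum.elim (fun _ => -1) (fun _ => 1)) 1 (-1) 1 (-1) 1 := by
  have h0 : conj q.κ₂ = q.κ₁ := by rw [← h.conj_κ₁, Complex.conj_conj]
  have h1 : ∀ k, conj (q.αv (.inr k)) = q.αv (.inl k) := fun k => by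
    rw [← h.conj_αv, Complex.conj_conj]
  have h2 : ∀ k, conj (q.αu (.inr k)) = q.αu (.inl k) := fun k => by
    rw [← h.conj_αu, Complex.conj_conj]
  have h3 : ∀ k, conj (q.d (.inr k)) = q.d (.inl k) := fun k => by
    rw [← h.conj_d, Complex.conj_conj]
  refine ⟨?_, ?_, by simp, by simp, by simp, by simp, by simpa [data] using h.conj_κ₁,
    by simpa [data] using h0, by simp [data], by simp [data], ?_, ?_, ?_, ?_, ?_, ?_, ?_, ?_, ?_, ?_⟩
  · rintro (i | i) <;> simp
  · rintro (i | i) <;> simp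
  · rintro (i | i) <;> simp [data, h1]
  · rintro (i | i) <;> simp [data, h.conj_αu]
  · rintro (i | i) <;> simp [data, h.conj_αv]
  · rintro (i | i) <;> simp [data, h2]
  · rintro (i | i) <;> simp [data, h.conj_αu]
  · rintro (i | i) <;> simp [data, h2]
  · rintro (i | i) <;> simp [data, h1]
  · rintro (i | i) <;> simp [data, h.conj_αv]
  · rintro (i | i) <;> simp [data, h3, h.conj_d, ← Complex.exp_conj]
  · rintro (i | i) (k | k) <;> simp [data, h1, h2, h.conj_αu, h.conj_αv]

theorem isOpen_regular (hq : q.Admissible) (α : ℂ) : IsOpen (dsRegularSet α q.tau) := by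
  have := q.data.isOpen_regular α
  simpa only [data_tau hq] using this

variable [NeZero N]

theorem solvesDS1 (hq : q.Admissible) (h : q.RealityDS1) :
    SolvesDSOn Complex.I (-Real.sign (q.κ₁.re * q.κ₂.re)) (dsRegularSet Complex.I q.tau)
      q.psi q.phi := by
  have hD := h.data_real
  have hτ : ∀ ξ η t, q.data.tau (ξ, η, t) = q.tau ξ η t := data_tau hq
  refine CauchyData.solvesDSOn (D := q.data) (data_valid hq)
    (A := (Real.sqrt ‖q.data.κ₁ * q.data.κ₂‖ : ℂ) * Complex.exp (Complex.I * q.θ))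
    (h := q.h) (by simp) (isOpen_regular hq _) ?_ ?_ (data_phi hq) ?_ ?_ ?_ ?_
  · intro x y t hx
    rw [hτ]; exact hx
  · intro ξ η t hne
    exact data_Psi hq (by rwa [← hτ])
  · rw [norm_amplitude_sq]
    simpa [data] using sign_mul_norm_of_real h.κ₁_real h.κ₂_real (s := 1) (by simp) one_ne_zero
  · exact fun x y t _ => hD.conj_pot (CauchyData.conj_dsXi_I x y) (CauchyData.conj_dsEta_I x y)
      (Complex.conj_ofReal t) _
  · exact fun x y t _ => hD.conj_G (CauchyData.conj_dsXi_I x y) (CauchyData.conj_dsEta_I x y)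
      (Complex.conj_ofReal t)
  · exact fun x y t => hD.re_wave (CauchyData.conj_dsXi_I x y) (CauchyData.conj_dsEta_I x y)
      (Complex.conj_ofReal t) _

theorem solvesDS2 (hq : q.Admissible) (h : q.RealityDS2) :
    SolvesDSOn 1 (-1) (dsRegularSet 1 q.tau) q.psi q.phi := by
  have hD := h.data_real
  have hτ : ∀ ξ η t, q.data.tau (ξ, η, t) = q.tau ξ η t := data_tau hq
  refine CauchyData.solvesDSOn (D := q.data) (data_valid hq)
    (A := (Real.sqrt ‖q.data.κ₁ * q.data.κ₂‖ : ℂ) * Complex.exp (Complex.I * q.θ))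
    (h := q.h) (by simp) (isOpen_regular hq _) ?_ ?_ (data_phi hq) ?_ ?_ ?_ ?_
  · intro x y t hx
    rw [hτ]; exact hx
  · intro ξ η t hne
    exact data_Psi hq (by rwa [← hτ])
  · have : q.data.κ₂ = conj q.data.κ₁ := by rw [hD.conj_κ₁]; ring
    rw [norm_amplitude_sq, this, Complex.mul_conj', norm_pow, Complex.norm_real]
    simp
  · exact fun x y t _ => hD.conj_pot (CauchyData.conj_dsXi_one x y) (CauchyData.conj_dsEta_one x y)
      (Complex.conj_ofReal t) _
  · exact fun x y t _ => hD.conj_G (CauchyData.conj_dsXi_one x y) (CauchyData.conj_dsEta_one x y)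
      (Complex.conj_ofReal t)
  · exact fun x y t => hD.re_wave (CauchyData.conj_dsXi_one x y) (CauchyData.conj_dsEta_one x y)
      (Complex.conj_ofReal t) _

end BrightParams

/-! ## Dependence on the data and the degeneration -/

open Filter

section Limits

open Matrix

variable {ι X : Type*} [Fintype ι] [DecidableEq ι] {f : Filter X}

theorem tendsto_det {M : X → Matrix ι ι ℂ} {M₀ : Matrix ι ι ℂ}
    (h : ∀ i k, Tendsto (fun x => M x i k) f (𝓝 (M₀ i k))) :
    Tendsto (fun x => (M x).det) f (𝓝 M₀.det) := by
  have h' : Tendsto M f (𝓝 M₀) := tendsto_pi_nhds.2 fun i => tendsto_pi_nhds.2 fun k => h i k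
  exact ((Continuous.matrix_det continuous_id).tendsto M₀).comp h'

theorem tendsto_inv_form {M : X → Matrix ι ι ℂ} {M₀ : Matrix ι ι ℂ}
    (h : ∀ i k, Tendsto (fun x => M x i k) f (𝓝 (M₀ i k))) (h0 : M₀.det ≠ 0)
    {u v : X → ι → ℂ} {u₀ v₀ : ι → ℂ} (hu : ∀ i, Tendsto (fun x => u x i) f (𝓝 (u₀ i)))
    (hv : ∀ i, Tendsto (fun x => v x i) f (𝓝 (v₀ i))) :
    Tendsto (fun x => u x ⬝ᵥ ((M x)⁻¹ *ᵥ v x)) f (𝓝 (u₀ ⬝ᵥ (M₀⁻¹ *ᵥ v₀))) := by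
  have h' : Tendsto M f (𝓝 M₀) := tendsto_pi_nhds.2 fun i => tendsto_pi_nhds.2 fun k => h i k
  have hadj : Tendsto (fun x => (M x).adjugate) f (𝓝 M₀.adjugate) :=
    ((Continuous.matrix_adjugate continuous_id).tendsto M₀).comp h'
  have hinv : ∀ i k, Tendsto (fun x => (M x)⁻¹ i k) f (𝓝 (M₀⁻¹ i k)) := by
    intro i k
    simp only [inv_def, Ring.inverse_eq_inv', Matrix.smul_apply, smul_eq_mul]
    exact ((tendsto_det h).inv₀ h0).mul (tendsto_pi_nhds.1 (tendsto_pi_nhds.1 hadj i) k)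
  simp only [dotProduct, mulVec]
  exact tendsto_finsetSum _ fun i _ => (hu i).mul <|
    tendsto_finsetSum _ fun k _ => (hinv i k).mul (hv k)

end Limits

namespace CauchyData

variable {ι X : Type*}

/-- Componentwise convergence of Cauchy data. -/
structure ConvergesTo (F : X → CauchyData ι) (f : Filter X) (D : CauchyData ι) : Prop where
  κ₁ : Tendsto (fun x => (F x).κ₁) f (𝓝 D.κ₁)
  κ₂ : Tendsto (fun x => (F x).κ₂) f (𝓝 D.κ₂)
  l : Tendsto (fun x => (F x).l) f (𝓝 D.l)
  av : ∀ i, Tendsto (fun x => (F x).av i) f (𝓝 (D.av i))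
  au : ∀ i, Tendsto (fun x => (F x).au i) f (𝓝 (D.au i))
  bv : ∀ i, Tendsto (fun x => (F x).bv i) f (𝓝 (D.bv i))
  bu : ∀ i, Tendsto (fun x => (F x).bu i) f (𝓝 (D.bu i))
  c : ∀ i, Tendsto (fun x => (F x).c i) f (𝓝 (D.c i))
  C : ∀ i k, Tendsto (fun x => (F x).C i k) f (𝓝 (D.C i k))

namespace ConvergesTo

variable {F : X → CauchyData ι} {f : Filter X} {D : CauchyData ι} (h : ConvergesTo F f D)
  (p : ℂ × ℂ × ℂ)

include h

theorem phase (k : ι) : Tendsto (fun x => (F x).phase p k) f (𝓝 (D.phase p k)) := by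
  have h1 := h.κ₁
  have h2 := h.κ₂
  have h3 := h.av k
  have h4 := h.au k
  have h5 := h.bv k
  have h6 := h.bu k
  exact (((((h1.const_mul _).mul (h3.sub h4)).mul_const _).sub
    (((h2.const_mul _).mul (h5.sub h6)).mul_const _)).add
    (((((h1.pow 2).mul ((h4.pow 2).sub (h3.pow 2))).sub
      ((h2.pow 2).mul ((h6.pow 2).sub (h5.pow 2)))).const_mul _).mul_const _))

theorem wave (a : ℝ) : Tendsto (fun x => (F x).wave a p) f (𝓝 (D.wave a p)) := by
  have h1 := h.κ₁.mul h.l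
  have h2 := h.κ₂.mul h.l
  exact (((h1.neg.mul_const _).add (h2.mul_const _)).sub
    ((((h1.pow 2).neg.sub (h2.pow 2)).add_const _).mul_const _)).const_mul _

variable [Fintype ι] [DecidableEq ι]

theorem mat (i k : ι) : Tendsto (fun x => (F x).mat p i k) f (𝓝 (D.mat p i k)) := by
  simp only [CauchyData.mat, Matrix.add_apply, Matrix.diagonal_apply]
  refine Tendsto.add ?_ (h.C i k)
  split_ifs
  · exact (h.c i).mul ((h.phase p i).neg.cexp)
  · exact tendsto_const_nhds

theorem tau (hc : ∀ i, D.c i ≠ 0) : Tendsto (fun x => (F x).tau p) f (𝓝 (D.tau p)) :=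
  (tendsto_finsetProd _ fun k _ => (h.phase p k).cexp.div (h.c k) (hc k)).mul
    (tendsto_det (h.mat p))

variable {p} (hp : (D.mat p).det ≠ 0)

include hp

theorem om {u v : X → ι → ℂ} {u₀ v₀ : ι → ℂ} (hu : ∀ i, Tendsto (fun x => u x i) f (𝓝 (u₀ i)))
    (hv : ∀ i, Tendsto (fun x => v x i) f (𝓝 (v₀ i))) :
    Tendsto (fun x => (F x).om (u x) (v x) p) f (𝓝 (D.om u₀ v₀ p)) :=
  tendsto_inv_form (h.mat p) hp hu hv

theorem Psi {A : X → ℂ} {A₀ : ℂ} (hA : Tendsto A f (𝓝 A₀)) (a : ℝ) :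
    Tendsto (fun x => (F x).Psi (A x) a p) f (𝓝 (D.Psi A₀ a p)) :=
  (hA.mul (h.l.sub (h.om hp h.bu h.av))).mul (h.wave p a).cexp

theorem pot (a : ℝ) : Tendsto (fun x => (F x).pot a p) f (𝓝 (D.pot a p)) := by
  have sq : ∀ {u : X → ι → ℂ} {u₀ : ι → ℂ}, (∀ i, Tendsto (fun x => u x i) f (𝓝 (u₀ i))) →
      ∀ i, Tendsto (fun x => (u x ^ 2) i) f (𝓝 ((u₀ ^ 2) i)) := fun hu i => (hu i).pow 2
  have hA : Tendsto (fun x => (F x).potA p) f (𝓝 (D.potA p)) :=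
    (h.κ₁.pow 2).neg.mul (((h.om hp h.au (sq h.av)).sub (h.om hp (sq h.au) h.av)).sub
      ((h.om hp h.au h.av).pow 2))
  have hB : Tendsto (fun x => (F x).potB p) f (𝓝 (D.potB p)) :=
    (h.κ₂.pow 2).neg.mul (((h.om hp h.bu (sq h.bv)).sub (h.om hp (sq h.bu) h.bv)).sub
      ((h.om hp h.bu h.bv).pow 2))
  exact ((hA.const_mul _).add (hB.const_mul _)).add_const _

end ConvergesTo

end CauchyData

namespace BrightParams

variable {N : ℕ} {q : BrightParams N}

theorem tendsto_ofReal_zero : Tendsto (fun ε : ℝ => (ε : ℂ)) (𝓝[>] 0) (𝓝 0) := by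
  have : Tendsto (fun ε : ℝ => (ε : ℂ)) (𝓝 0) (𝓝 ((0 : ℝ) : ℂ)) :=
    Complex.continuous_ofReal.tendsto 0
  rw [Complex.ofReal_zero] at this
  exact this.mono_left nhdsWithin_le_nhds

/-- `x + ε y` tends to `x`. -/
theorem tendsto_perturbation (x y : ℂ) :
    Tendsto (fun ε : ℝ => x + (ε : ℂ) * y) (𝓝[>] 0) (𝓝 x) := by
  simpa using (tendsto_ofReal_zero.mul_const y).const_add x

/-- Points clustering at different centres are separated for small `ε`. A `v_i` and a `u_k` share a
centre only when their parities differ, and then the admissible `α`'s separate them for every `ε >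
0`. -/
theorem eventually_regular (hq : q.Admissible) {a b : ℂ} (hab : a ≠ b) :
    ∀ᶠ ε : ℝ in 𝓝[>] 0, (q.degenerating a b ε).Regular := by
  have hab' : a - b ≠ 0 := sub_ne_zero.2 hab
  have far : ∀ {x y : ℂ} (z w : ℂ), x ≠ y →
      ∀ᶠ ε : ℝ in 𝓝[>] 0, x + ε * z * (a - b) ≠ y + ε * w * (a - b) := by
    intro x y z w hxy
    filter_upwards [(tendsto_perturbation (x - y) ((z - w) * (a - b))).eventually_ne
      (sub_ne_zero.2 hxy)] with ε hε e
    apply hε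
    linear_combination e
  have far' : ∀ {x y : ℂ} (w : ℂ), x ≠ y →
      ∀ᶠ ε : ℝ in 𝓝[>] 0, x ≠ y + ε * w * (a - b) := by
    intro x y w hxy
    filter_upwards [far 0 w hxy] with ε hε
    simpa using hε
  have near : ∀ (ε : ℝ) (x : ℂ) {z w : ℂ}, 0 < ε → z ≠ w →
      x + ε * z⁻¹ * (a - b) ≠ x + ε * w⁻¹ * (a - b) := by
    intro ε x z w hε hzw e
    have hε' : (ε : ℂ) ≠ 0 := by exact_mod_cast hε.ne'
    apply hzw
    have h1 : (ε * (a - b)) * z⁻¹ = (ε * (a - b)) * w⁻¹ := by linear_combination e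
    exact inv_injective (mul_left_cancel₀ (mul_ne_zero hε' hab') h1)
  have near' : ∀ (ε : ℝ) (x : ℂ) {z : ℂ}, 0 < ε → z ≠ 0 → x ≠ x + ε * z⁻¹ * (a - b) := by
    intro ε x z hε hz e
    have hε' : (ε : ℂ) ≠ 0 := by exact_mod_cast hε.ne'
    have : ε * z⁻¹ * (a - b) = 0 := by linear_combination -e
    simp [hε', hz, hab'] at this
  have e1 : ∀ i k, ∀ᶠ ε : ℝ in 𝓝[>] 0,
      (q.degenerating a b ε).v i ≠ (q.degenerating a b ε).u k := by
    rintro (i | i) (k | k)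
    · exact far _ _ hab.symm
    · filter_upwards [self_mem_nhdsWithin] with ε hε
      exact near ε b hε (hq.odd_even i k)
    · filter_upwards [self_mem_nhdsWithin] with ε hε
      exact near ε a hε (hq.even_odd i k)
    · exact far _ _ hab
  have e2 : ∀ i, ∀ᶠ ε : ℝ in 𝓝[>] 0, a ≠ (q.degenerating a b ε).v i := by
    rintro (i | i)
    · exact far' _ hab
    · filter_upwards [self_mem_nhdsWithin] with ε hε
      exact near' ε a hε (hq.αv_ne _)
  have e3 : ∀ i, ∀ᶠ ε : ℝ in 𝓝[>] 0, a ≠ (q.degenerating a b ε).u i := by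
    rintro (i | i)
    · filter_upwards [self_mem_nhdsWithin] with ε hε
      exact near' ε a hε (hq.αu_ne _)
    · exact far' _ hab
  have e4 : ∀ i, ∀ᶠ ε : ℝ in 𝓝[>] 0, b ≠ (q.degenerating a b ε).v i := by
    rintro (i | i)
    · filter_upwards [self_mem_nhdsWithin] with ε hε
      exact near' ε b hε (hq.αv_ne _)
    · exact far' _ hab.symm
  have e5 : ∀ i, ∀ᶠ ε : ℝ in 𝓝[>] 0, b ≠ (q.degenerating a b ε).u i := by
    rintro (i | i)
    · exact far' _ hab.symm
    · filter_upwards [self_mem_nhdsWithin] with ε hε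
      exact near' ε b hε (hq.αu_ne _)
  filter_upwards [eventually_all.2 fun i => eventually_all.2 (e1 i), eventually_all.2 e2,
    eventually_all.2 e3, eventually_all.2 e4, eventually_all.2 e5] with ε h1 h2 h3 h4 h5
  exact ⟨hab, h1, h2, h3, h4, h5⟩

/-- With scale `ε`, a point at distance of order `ε` from its centre gives a quotient equal to its
limit, and one at the other centre gives a quotient of order `ε`. The summand `-ln ε` of `d`
compensates the factor `ε` in `c`. -/
theorem data_convergesTo (hq : q.Admissible) {a b : ℂ} (hab : a ≠ b) :
    CauchyData.ConvergesTo (fun ε : ℝ => (q.degenerating a b ε).data ε) (𝓝[>] 0) q.data := by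
  have hab' : a - b ≠ 0 := sub_ne_zero.2 hab
  have hba' : b - a ≠ 0 := sub_ne_zero.2 hab.symm
  have pos : ∀ᶠ ε : ℝ in 𝓝[>] 0, (ε : ℂ) ≠ 0 := by
    filter_upwards [self_mem_nhdsWithin] with ε hε
    exact_mod_cast (ne_of_gt hε)
  -- a quotient with numerator `ε (a - b)` and denominator bounded away from zero
  have small : ∀ x y : ℂ, x ≠ 0 →
      Tendsto (fun ε : ℝ => (ε : ℂ) * (a - b) / (x + ε * y)) (𝓝[>] 0) (𝓝 0) := by
    intro x y hx
    have := (tendsto_ofReal_zero.mul_const (a - b)).div (tendsto_perturbation x y) hx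
    rwa [zero_mul, zero_div] at this
  refine ⟨?_, ?_, tendsto_ofReal_zero, ?_, ?_, ?_, ?_, ?_, ?_⟩
  · refine tendsto_const_nhds.congr' ?_
    filter_upwards [pos] with ε hε
    simp only [DSParams.data, degenerating, data]
    field_simp
  · refine tendsto_const_nhds.congr' ?_
    filter_upwards [pos] with ε hε
    simp only [DSParams.data, degenerating, data]
    field_simp
  · rintro (i | i)
    · refine (small (a - b) (-((q.αv (.inl i))⁻¹ * (a - b))) hab').congr fun ε => ?_
      simp only [DSParams.data, degenerating]
      congr 1; ring
    · refine tendsto_const_nhds.congr' ?_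
      filter_upwards [pos] with ε hε
      have := hq.αv_ne (.inr i)
      simp only [DSParams.data, degenerating, data, Sum.elim_inr]
      rw [sub_add_cancel_left]
      field_simp
  · rintro (i | i)
    · refine tendsto_const_nhds.congr' ?_
      filter_upwards [pos] with ε hε
      have := hq.αu_ne (.inl i)
      simp only [DSParams.data, degenerating, data, Sum.elim_inl]
      rw [sub_add_cancel_left]
      field_simp
    · refine (small (a - b) (-((q.αu (.inr i))⁻¹ * (a - b))) hab').congr fun ε => ?_
      simp only [DSParams.data, degenerating]
      congr 1; ring
  · rintro (i | i)
    · refine tendsto_const_nhds.congr' ?_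
      filter_upwards [pos] with ε hε
      have := hq.αv_ne (.inl i)
      simp only [DSParams.data, degenerating, data, Sum.elim_inl]
      rw [sub_add_cancel_left]
      field_simp
    · refine (small (b - a) (-((q.αv (.inr i))⁻¹ * (a - b))) hba').congr fun ε => ?_
      simp only [DSParams.data, degenerating]
      congr 1; ring
  · rintro (i | i)
    · refine (small (b - a) (-((q.αu (.inl i))⁻¹ * (a - b))) hba').congr fun ε => ?_
      simp only [DSParams.data, degenerating]
      congr 1; ring
    · refine tendsto_const_nhds.congr' ?_
      filter_upwards [pos] with ε hε
      have := hq.αu_ne (.inr i)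
      simp only [DSParams.data, degenerating, data, Sum.elim_inr]
      rw [sub_add_cancel_left]
      field_simp
  · have hexp : ∀ {ε : ℝ}, 0 < ε → ∀ d : ℂ,
        (ε : ℂ) * (a - b) * Complex.exp (-(Real.log ε : ℂ) + d) = (a - b) * Complex.exp d := by
      intro ε hε d
      have hε' : (ε : ℂ) ≠ 0 := by exact_mod_cast hε.ne'
      rw [Complex.exp_add, Complex.exp_neg, ← Complex.ofReal_exp, Real.exp_log hε]
      field_simp
    have lim : ∀ (d x y : ℂ), x ≠ 0 → Tendsto (fun ε : ℝ =>
        (a - b) * Complex.exp d / (x + ε * y)) (𝓝[>] 0) (𝓝 ((a - b) * Complex.exp d / x)) :=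
      fun d x y hx => tendsto_const_nhds.div (tendsto_perturbation x y) hx
    rintro (i | i)
    · have h0 : (a - b) * Complex.exp (q.d (.inl i)) / (b - a) = -Complex.exp (q.d (.inl i)) := by
        field_simp; ring
      have := lim (q.d (.inl i)) (b - a)
        ((q.αv (.inl i))⁻¹ * (a - b) - (q.αu (.inl i))⁻¹ * (a - b)) hba'
      rw [h0] at this
      refine this.congr' ?_
      filter_upwards [self_mem_nhdsWithin] with ε hε
      simp only [DSParams.data, degenerating]
      rw [hexp hε]
      congr 1; ring
    · have h0 : (a - b) * Complex.exp (q.d (.inr i)) / (a - b) = Complex.exp (q.d (.inr i)) := by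
        field_simp
      have := lim (q.d (.inr i)) (a - b)
        ((q.αv (.inr i))⁻¹ * (a - b) - (q.αu (.inr i))⁻¹ * (a - b)) hab'
      rw [h0] at this
      refine this.congr' ?_
      filter_upwards [self_mem_nhdsWithin] with ε hε
      simp only [DSParams.data, degenerating]
      rw [hexp hε]
      congr 1; ring
  · rintro (i | i) (k | k)
    · refine (small (b - a) ((q.αv (.inl i))⁻¹ * (a - b) - (q.αu (.inl k))⁻¹ * (a - b))
        hba').congr fun ε => ?_
      simp only [DSParams.data, degenerating, Matrix.of_apply]
      congr 1; ring
    · refine tendsto_const_nhds.congr' ?_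
      filter_upwards [pos] with ε hε
      have h1 := hq.αv_ne (.inl i)
      have h2 := hq.αu_ne (.inr k)
      have h3 := sub_ne_zero.2 (hq.odd_even i k).symm
      simp only [DSParams.data, degenerating, data, Matrix.of_apply]
      have : b + ε * (q.αv (.inl i))⁻¹ * (a - b) - (b + ε * (q.αu (.inr k))⁻¹ * (a - b))
          = ε * (a - b) * ((q.αu (.inr k) - q.αv (.inl i)) / (q.αv (.inl i) * q.αu (.inr k))) := by
        field_simp; ring
      rw [this]
      field_simp
    · refine tendsto_const_nhds.congr' ?_
      filter_upwards [pos] with ε hε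
      have h1 := hq.αv_ne (.inr i)
      have h2 := hq.αu_ne (.inl k)
      have h3 := sub_ne_zero.2 (hq.even_odd i k).symm
      simp only [DSParams.data, degenerating, data, Matrix.of_apply]
      have : a + ε * (q.αv (.inr i))⁻¹ * (a - b) - (a + ε * (q.αu (.inl k))⁻¹ * (a - b))
          = ε * (a - b) * ((q.αu (.inl k) - q.αv (.inr i)) / (q.αv (.inr i) * q.αu (.inl k))) := by
        field_simp; ring
      rw [this]
      field_simp
    · refine (small (a - b) ((q.αv (.inr i))⁻¹ * (a - b) - (q.αu (.inr k))⁻¹ * (a - b))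
        hab').congr fun ε => ?_
      simp only [DSParams.data, degenerating, Matrix.of_apply]
      congr 1; ring

variable [NeZero N]

/-- For `phi` no limit is exchanged with a derivative: `dsPhi_tau` has already expressed the
derivatives as the rational expression `pot` in the data. -/
theorem tendsto_degenerating (hq : q.Admissible) {a b : ℂ} (hab : a ≠ b) {ξ η t : ℂ}
    (hτ : q.tau ξ η t ≠ 0) :
    Tendsto (fun ε : ℝ => (q.degenerating a b ε).psi ξ η t) (𝓝[>] 0) (𝓝 (q.psi ξ η t)) ∧
    Tendsto (fun ε : ℝ => (q.degenerating a b ε).phi ξ η t) (𝓝[>] 0) (𝓝 (q.phi ξ η t)) := by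
  have hc := data_convergesTo hq hab
  have hτ' : q.data.tau (ξ, η, t) ≠ 0 := by rwa [data_tau hq]
  have hdet : (q.data.mat (ξ, η, t)).det ≠ 0 :=
    (CauchyData.tau_ne_zero_iff (data_valid hq)).1 hτ'
  have hev : ∀ᶠ ε : ℝ in 𝓝[>] 0, 0 < ε ∧ (q.degenerating a b ε).Regular ∧
      ((q.degenerating a b ε).data ε).tau (ξ, η, t) ≠ 0 := by
    filter_upwards [self_mem_nhdsWithin, eventually_regular hq hab,
      (hc.tau (ξ, η, t) (data_valid hq).c_ne).eventually_ne hτ'] with ε h1 h2 h3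
    exact ⟨h1, h2, h3⟩
  constructor
  · have hA : Tendsto (fun ε : ℝ => (Real.sqrt ‖((q.degenerating a b ε).data ε).κ₁
        * ((q.degenerating a b ε).data ε).κ₂‖ : ℂ) * Complex.exp (Complex.I * q.θ)) (𝓝[>] 0)
        (𝓝 ((Real.sqrt ‖q.data.κ₁ * q.data.κ₂‖ : ℂ) * Complex.exp (Complex.I * q.θ))) :=
      ((Complex.continuous_ofReal.tendsto _).comp
        ((Real.continuous_sqrt.tendsto _).comp (hc.κ₁.mul hc.κ₂).norm)).mul_const _
    rw [data_Psi hq hτ]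
    refine (hc.Psi hdet hA q.h).congr' ?_
    filter_upwards [hev] with ε ⟨h1, h2, h3⟩
    rw [DSParams.data_tau h2 (by exact_mod_cast h1.ne')] at h3
    exact (DSParams.data_Psi h2 h1 h3).symm
  · rw [data_phi hq, CauchyData.dsPhi_tau (data_valid hq) hτ']
    refine (hc.pot hdet q.h).congr' ?_
    filter_upwards [hev] with ε ⟨h1, h2, h3⟩
    have hε : (ε : ℂ) ≠ 0 := by exact_mod_cast h1.ne'
    rw [DSParams.data_phi h2 hε, CauchyData.dsPhi_tau (DSParams.data_valid h2 hε) h3]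
    rfl

end BrightParams

/-! ## Cauchy determinants -/

section Cauchy

open Matrix

/-- Elimination of one point from a Cauchy determinant. -/
theorem det_cauchy_option {α : Type*} [Fintype α] [DecidableEq α] (v u : Option α → ℂ)
    (h : ∀ i k, v i ≠ u k) :
    (Matrix.of fun i k => (v i - u i) / (v i - u k)).det
      = (∏ i : α, (v (some i) - v none) * (u none - u (some i))
          / ((v (some i) - u none) * (v none - u (some i))))
        * (Matrix.of fun i k : α => (v (some i) - u (some i)) / (v (some i) - u (some k))).det := by
  have hs : ∀ i k, v i - u k ≠ 0 := fun i k => sub_ne_zero.2 (h i k)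
  set e := Equiv.optionEquivSumPUnit.{0} α
  rw [← det_submatrix_equiv_self e.symm]
  have h1 : (Matrix.of fun i k => (v i - u i) / (v i - u k)).submatrix e.symm e.symm
      = fromBlocks (Matrix.of fun i k : α => (v (some i) - u (some i)) / (v (some i) - u (some k)))
        (Matrix.of fun i _ => (v (some i) - u (some i)) / (v (some i) - u none))
        (Matrix.of fun _ k => (v none - u none) / (v none - u (some k))) (1 : Matrix PUnit PUnit ℂ) := by
    ext i k
    rcases i with i | i <;> rcases k with k | k <;> simp [e, div_self (hs none none)]
  rw [h1, det_fromBlocks_one₂₂]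
  -- The added diagonal entry is `1`, so the Schur complement needs no inverse; a Cauchy matrix
  -- reproduces itself there up to diagonal factors.
  have h2 : (Matrix.of fun i k : α => (v (some i) - u (some i)) / (v (some i) - u (some k)))
      - (Matrix.of fun (i : α) (_ : PUnit) => (v (some i) - u (some i)) / (v (some i) - u none))
        * (Matrix.of fun (_ : PUnit) (k : α) => (v none - u none) / (v none - u (some k)))
      = diagonal (fun i : α => (v (some i) - v none) / (v (some i) - u none))
        * (Matrix.of fun i k : α => (v (some i) - u (some i)) / (v (some i) - u (some k)))
        * diagonal (fun k : α => (u none - u (some k)) / (v none - u (some k))) := by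
    ext i k
    have a1 := hs (some i) (some k)
    have a2 := hs (some i) none
    have a3 := hs none (some k)
    simp only [Matrix.sub_apply, mul_diagonal, diagonal_mul, of_apply]
    simp only [mul_apply, Finset.univ_unique, Finset.sum_singleton, of_apply]
    field_simp
    ring
  rw [h2, det_mul, det_mul, det_diagonal, det_diagonal, mul_right_comm, ← Finset.prod_mul_distrib]
  congr 1
  refine Finset.prod_congr rfl fun i _ => ?_
  rw [div_mul_div_comm]

-- Induction on the number of points: by `det_cauchy_option` each added point multiplies the
-- determinant by the cross-ratios it forms with the others. In the complex order, nonnegativity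
-- includes being real.
open scoped ComplexOrder in
theorem det_cauchy_nonneg (α : Type*) [Fintype α] [DecidableEq α] (v u : α → ℂ)
    (h : ∀ i k, v i ≠ u k)
    (hpos : ∀ i j, i ≠ j → 0 ≤ (v i - v j) * (u j - u i) / ((v i - u j) * (v j - u i))) :
    0 ≤ (Matrix.of fun i k => (v i - u i) / (v i - u k)).det := by
  classical
  let P : ∀ (α : Type _) [Fintype α], Prop := fun α _ => ∀ v u : α → ℂ, (∀ i k, v i ≠ u k) →
    (∀ i j, i ≠ j → 0 ≤ (v i - v j) * (u j - u i) / ((v i - u j) * (v j - u i))) →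
    0 ≤ (Matrix.of fun i k => (v i - u i) / (v i - u k)).det
  have : P α := by
    refine Fintype.induction_empty_option (P := P) ?_ ?_ ?_ α
    · intro α β _ e hα v u h hpos
      let := Fintype.ofEquiv β e.symm
      rw [← det_submatrix_equiv_self e]
      convert hα (v ∘ e) (u ∘ e) (fun i k => h _ _) (fun i j hij => hpos _ _ (e.injective.ne hij)) using 2
      rfl
    · intro v u _ _
      simp
    · intro α _ hα v u h hpos
      have hd := det_cauchy_option v u h
      have h1 := hα (fun i => v (some i)) (fun i => u (some i)) (fun i k => h _ _)
        (fun i j hij => hpos _ _ (by simpa using hij))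
      convert (mul_nonneg (Finset.prod_nonneg fun i _ => hpos (some i) none (by simp)) h1) using 1
      convert hd
  convert this v u h hpos

theorem det_cauchy_ne_zero (α : Type*) [Fintype α] [DecidableEq α] (v u : α → ℂ)
    (h : ∀ i k, v i ≠ u k) (hv : Function.Injective v) (hu : Function.Injective u) :
    (Matrix.of fun i k => (v i - u i) / (v i - u k)).det ≠ 0 := by
  classical
  let P : ∀ (α : Type _) [Fintype α], Prop := fun α _ => ∀ v u : α → ℂ, (∀ i k, v i ≠ u k) →
    Function.Injective v → Function.Injective u →
    (Matrix.of fun i k => (v i - u i) / (v i - u k)).det ≠ 0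
  have : P α := by
    refine Fintype.induction_empty_option (P := P) ?_ ?_ ?_ α
    · intro α β _ e hα v u h hv hu
      let := Fintype.ofEquiv β e.symm
      rw [← det_submatrix_equiv_self e]
      convert hα (v ∘ e) (u ∘ e) (fun i k => h _ _) (hv.comp e.injective) (hu.comp e.injective) using 2
      rfl
    · intro v u _ _ _
      simp
    · intro α _ hα v u h hv hu
      have hd := det_cauchy_option v u h
      have h1 := hα (fun i => v (some i)) (fun i => u (some i)) (fun i k => h _ _)
        (hv.comp (Option.some_injective _)) (hu.comp (Option.some_injective _))
      have h2 := mul_ne_zero (Finset.prod_ne_zero_iff (s := Finset.univ).2 fun (i : α) _ =>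
        div_ne_zero (mul_ne_zero (sub_ne_zero.2 (hv.ne (Option.some_ne_none i)))
          (sub_ne_zero.2 (hu.ne (Option.some_ne_none i).symm)))
          (mul_ne_zero (sub_ne_zero.2 (h (some i) none)) (sub_ne_zero.2 (h none (some i))))) h1
      convert h2 using 1
      convert hd
  convert this v u h hv hu

/-- The columns of a Cauchy matrix on distinct points are linearly independent. -/
theorem cauchy_mulVec_injective {α : Type*} (S : Finset α) {v u w : α → ℂ}
    (h : ∀ i ∈ S, ∀ k ∈ S, v i ≠ u k) (hv : Set.InjOn v S) (hu : Set.InjOn u S)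
    (hw : ∀ i ∈ S, ∑ k ∈ S, w k / (v i - u k) = 0) : ∀ k ∈ S, w k = 0 := by
  classical
  set A : Matrix S S ℂ := Matrix.of fun i k => (v i - u i) / (v i - u k) with hA
  have hdet : A.det ≠ 0 := det_cauchy_ne_zero S (fun i => v i) (fun i => u i)
    (fun i k => h i i.2 k k.2) (fun i k e => Subtype.ext (hv i.2 k.2 e))
    (fun i k e => Subtype.ext (hu i.2 k.2 e))
  have h0 : A *ᵥ (fun k => w k) = 0 := by
    ext i
    simp only [mulVec, dotProduct, hA, of_apply, Pi.zero_apply]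
    have := hw i i.2
    rw [← Finset.sum_coe_sort] at this
    calc ∑ k : S, (v i - u i) / (v i - u k) * w k = (v i - u i) * ∑ k : S, w k / (v i - u k) := by
          rw [Finset.mul_sum]
          exact Finset.sum_congr rfl fun k _ => by ring
      _ = 0 := by rw [this, mul_zero]
  have := eq_zero_of_mulVec_eq_zero hdet h0
  intro k hk
  exact congrFun this ⟨k, hk⟩

/-- The matrix with the rows of `C` on `S`, and those of the identity elsewhere. -/
def rowsOn {ι : Type*} [DecidableEq ι] (S : Finset ι) (C : Matrix ι ι ℂ) : Matrix ι ι ℂ :=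
  Matrix.of fun i k => if i ∈ S then C i k else (1 : Matrix ι ι ℂ) i k

/-- Multilinearity in the rows: each row is taken from `1` or from `B`. -/
theorem det_one_add_eq_sum {ι : Type*} [Fintype ι] [DecidableEq ι] (B : Matrix ι ι ℂ) :
    (1 + B).det = ∑ s : Finset ι, (rowsOn sᶜ B).det := by
  have h := (detRowAlternating (R := ℂ) (n := ι)).map_add_univ (1 : Matrix ι ι ℂ) B
  refine h.trans (Finset.sum_congr rfl fun s _ => congrArg det ?_)
  ext i k
  by_cases hi : i ∈ s <;> simp [rowsOn, Finset.piecewise, hi]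

open scoped ComplexOrder in
/-- If all principal minors of a matrix are nonnegative, then so are the determinants obtained
by adding the identity to positive multiples of the rows, and they are at least `1`. -/
theorem one_le_det_one_add {ι : Type*} [Fintype ι] [DecidableEq ι] (A : Matrix ι ι ℂ) (E : ι → ℂ)
    (hE : ∀ i, 0 ≤ E i) (hA : ∀ p : ι → Prop, [DecidablePred p] → 0 ≤ (A.toSquareBlockProp p).det) :
    1 ≤ (1 + diagonal E * A).det := by
  have h2 : ∀ (s : Finset ι) (P : ι → Prop) [DecidablePred P], (∀ i, P i ↔ i ∉ s) →
      0 ≤ (rowsOn s (diagonal E * A)).det := by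
    intro s P _ hP
    -- The identity rows make the matrix block triangular, so its determinant is a principal minor
    -- of `A` times a product of `E`'s.
    rw [twoBlockTriangular_det' _ P]
    · have e1 : toSquareBlockProp (rowsOn s (diagonal E * A)) P = 1 := by
        ext ⟨i, hi⟩ ⟨k, hk⟩
        rw [hP] at hi
        simp [toSquareBlockProp, rowsOn, hi, one_apply]
      have e2 : toSquareBlockProp (rowsOn s (diagonal E * A)) (fun i => ¬ P i)
          = diagonal (fun i : {i // ¬ P i} => E i) * A.toSquareBlockProp (fun i => ¬ P i) := by
        ext ⟨i, hi⟩ ⟨k, hk⟩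
        rw [hP, not_not] at hi
        simp [toSquareBlockProp, rowsOn, hi, diagonal_mul]
      rw [e1, e2, det_one, one_mul, det_mul, det_diagonal]
      exact mul_nonneg (Finset.prod_nonneg fun i _ => hE i) (hA _)
    · intro i hi j hj
      have : i ≠ j := fun e => hj (e ▸ hi)
      rw [hP] at hi
      simp [rowsOn, hi, this]
  -- Taking every row from the identity gives the term `1`, the source of the lower bound.
  have h3 : (rowsOn (Finset.univ : Finset ι)ᶜ (diagonal E * A)).det = 1 := by
    rw [← det_one (R := ℂ) (n := ι)]
    congr 1
    ext i k
    simp [rowsOn]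
  rw [det_one_add_eq_sum, ← h3]
  exact Finset.single_le_sum (fun s _ => h2 sᶜ (· ∈ s) (by simp)) (Finset.mem_univ _)

end Cauchy

/-! ### Non-vanishing of the dark denominators -/

namespace DSParams

variable {ι : Type*} [Fintype ι] [DecidableEq ι] {p : DSParams ι}

open Matrix

theorem tau_eq_det_one_add (hp : p.Regular) (ξ η t : ℂ) :
    p.tau ξ η t = (1 + diagonal (fun i => Complex.exp (p.Z ξ η t i - p.d i))
      * Matrix.of fun i k => (p.v i - p.u i) / (p.v i - p.u k)).det := by
  have hab := sub_ne_zero.2 hp.a_ne_b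
  rw [← data_tau hp one_ne_zero, CauchyData.tau, ← det_diagonal, ← det_mul]
  congr 1
  ext i k
  have h3 := sub_ne_zero.2 (hp.v_ne_u i k)
  have h4 := sub_ne_zero.2 (hp.v_ne_u i i)
  simp only [CauchyData.mat, diagonal_mul, Matrix.add_apply, data_phase hp one_ne_zero, of_apply,
    diagonal_apply, one_apply, Complex.exp_sub, Complex.exp_neg]
  have e1 := Complex.exp_ne_zero (p.Z ξ η t i)
  have e2 := Complex.exp_ne_zero (p.d i)
  by_cases h : i = k
  · subst h
    simp only [if_true, data, of_apply]
    field_simp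
  · simp only [if_neg h, data, of_apply, zero_add]
    field_simp

-- Real phases give positive exponentials, and a principal minor of a Cauchy-type matrix is again of
-- Cauchy type on a subset of the points.
open scoped ComplexOrder in
theorem tau_ne_zero_of_nonneg (hp : p.Regular) {ξ η t : ℂ}
    (hre : ∀ i, conj (p.Z ξ η t i - p.d i) = p.Z ξ η t i - p.d i)
    (hpos : ∀ i j, i ≠ j → 0 ≤ (p.v i - p.v j) * (p.u j - p.u i)
      / ((p.v i - p.u j) * (p.v j - p.u i))) : p.tau ξ η t ≠ 0 := by
  rw [tau_eq_det_one_add hp]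
  refine (lt_of_lt_of_le zero_lt_one (one_le_det_one_add _ _ (fun i => ?_) fun P _ => ?_)).ne'
  · obtain ⟨r, hr⟩ := Complex.conj_eq_iff_real.1 (hre i)
    rw [hr, ← Complex.ofReal_exp]
    exact_mod_cast (Real.exp_pos r).le
  · exact det_cauchy_nonneg {i // P i} (fun i => p.v i) (fun i => p.u i)
      (fun i k => hp.v_ne_u _ _) (fun i j hij => hpos _ _ fun e => hij (Subtype.ext e))

omit [Fintype ι] [DecidableEq ι] in
theorem DarkRealityDS1.conj_Z (h : p.DarkRealityDS1) (hp : p.Admissible) (x y t : ℝ) (i : ι) :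
    conj (p.Z (dsXi Complex.I x y) (dsEta Complex.I x y) t i)
      = p.Z (dsXi Complex.I x y) (dsEta Complex.I x y) t i := by
  rw [← data_phase (h.regular hp) one_ne_zero]
  exact h.data_real.conj_phase (CauchyData.conj_dsXi_I x y) (CauchyData.conj_dsEta_I x y)
    (Complex.conj_ofReal t) i

omit [Fintype ι] [DecidableEq ι] in
theorem DarkRealityDS2.conj_Z (h : p.DarkRealityDS2) (hp : p.Admissible) (x y t : ℝ) (i : ι) :
    conj (p.Z (dsXi 1 x y) (dsEta 1 x y) t i) = p.Z (dsXi 1 x y) (dsEta 1 x y) t i := by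
  rw [← data_phase (h.regular hp) one_ne_zero]
  exact h.data_real.conj_phase (CauchyData.conj_dsXi_one x y) (CauchyData.conj_dsEta_one x y)
    (Complex.conj_ofReal t) i

open scoped ComplexOrder in
theorem DarkRealityDS1.tau_ne_zero (h : p.DarkRealityDS1) (hp : p.Admissible) (x y t : ℝ) :
    p.tau (dsXi Complex.I x y) (dsEta Complex.I x y) t ≠ 0 := by
  refine tau_ne_zero_of_nonneg (h.regular hp) (fun i => ?_) fun i j _ => ?_
  · rw [map_sub, h.conj_Z hp, h.d_real]
  -- For `u = conj v` the cross-ratio is a quotient of squared moduli.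
  · have e : (p.v i - p.v j) * (p.u j - p.u i) / ((p.v i - p.u j) * (p.v j - p.u i))
        = ((‖p.v i - p.v j‖ ^ 2 / ‖p.v i - p.u j‖ ^ 2 : ℝ) : ℂ) := by
      push_cast
      rw [← Complex.mul_conj', ← Complex.mul_conj', map_sub, map_sub, h.conj_v, h.conj_v, h.conj_u,
        ← neg_sub (p.u i), ← neg_sub (p.u i), mul_neg, mul_neg, neg_div_neg_eq]
    rw [e]
    exact_mod_cast (by positivity)

end DSParams

open scoped ComplexOrder in
theorem DSParams.DarkRealityDS2.tau_ne_zero {N : ℕ} {p : DSParams (Fin N)} (h : p.DarkRealityDS2)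
    (hp : p.Admissible) (ho : p.Ordered) (x y t : ℝ) : p.tau (dsXi 1 x y) (dsEta 1 x y) t ≠ 0 := by
  refine tau_ne_zero_of_nonneg (h.regular hp) (fun i => ?_) ?_
  · rw [map_sub, h.conj_Z hp, h.d_real]
  -- For interlaced points with `i < j`, numerator and denominator of the cross-ratio are both
  -- nonpositive.
  · have key : ∀ i j, i < j → 0 ≤ ((p.v i).re - (p.v j).re) * ((p.u j).re - (p.u i).re)
        / (((p.v i).re - (p.u j).re) * ((p.v j).re - (p.u i).re)) := by
      intro i j hij
      have h1 := ho.1 i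
      have h2 := ho.1 j
      have h3 := ho.2 i j hij
      exact div_nonneg_of_nonpos
        (mul_nonpos_of_nonpos_of_nonneg (by linarith) (by linarith))
        (mul_nonpos_of_nonpos_of_nonneg (by linarith) (by linarith))
    have hv : ∀ i, p.v i = ((p.v i).re : ℂ) := fun i =>
      (Complex.conj_eq_iff_re.1 (h.v_real i)).symm
    have hu : ∀ i, p.u i = ((p.u i).re : ℂ) := fun i =>
      (Complex.conj_eq_iff_re.1 (h.u_real i)).symm
    intro i j hij
    rcases lt_or_gt_of_ne hij with hlt | hlt
    · have := key i j hlt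
      rw [hv i, hv j, hu i, hu j]
      exact_mod_cast this
    · have := key j i hlt
      rw [hv i, hv j, hu i, hu j]
      have e : ((p.v i).re - (p.v j).re) * ((p.u j).re - (p.u i).re)
          / (((p.v i).re - (p.u j).re) * ((p.v j).re - (p.u i).re))
          = ((p.v j).re - (p.v i).re) * ((p.u i).re - (p.u j).re)
          / (((p.v j).re - (p.u i).re) * ((p.v i).re - (p.u j).re)) := by
        congr 1 <;> ring
      rw [← e] at this
      exact_mod_cast this

/-! ## Asymptotics along rays -/

section Rays

open Matrix Filter

variable {ι : Type*} [DecidableEq ι]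

/-- The factors which normalize the rows of `diag g + C` off `S`. -/
def rowScale (S : Finset ι) (g : ι → ℂ) (k : ι) : ℂ := if k ∈ S then 1 else (g k)⁻¹

theorem rowScale_ne_zero {S : Finset ι} {g : ι → ℂ} (hg : ∀ k, g k ≠ 0) (k : ι) :
    rowScale S g k ≠ 0 := by
  unfold rowScale
  split_ifs
  · exact one_ne_zero
  · exact inv_ne_zero (hg k)

variable [Fintype ι]

theorem tendsto_rowScale {X : Type*} {f : Filter X} {S : Finset ι} {g : X → ι → ℂ}
    (hS : ∀ k ∉ S, Tendsto (fun x => (g x k)⁻¹) f (𝓝 0)) (v : ι → ℂ) (k : ι) :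
    Tendsto (fun x => rowScale S (g x) k * v k) f (𝓝 (if k ∈ S then v k else 0)) := by
  unfold rowScale
  split_ifs with h
  · simpa only [one_mul] using tendsto_const_nhds
  · simpa using (hS k h).mul_const (v k)

/-- On `S` the diagonal term dies and the row of `C` survives; off `S`, division by the diverging
diagonal entry leaves an identity row. -/
theorem tendsto_rowScale_mul {X : Type*} {f : Filter X} {S : Finset ι} {g : X → ι → ℂ}
    (hg : ∀ x k, g x k ≠ 0) (h0 : ∀ k ∈ S, Tendsto (fun x => g x k) f (𝓝 0))
    (h1 : ∀ k ∉ S, Tendsto (fun x => (g x k)⁻¹) f (𝓝 0)) (C : Matrix ι ι ℂ) (i k : ι) :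
    Tendsto (fun x => (diagonal (rowScale S (g x)) * (diagonal (g x) + C)) i k) f
      (𝓝 (rowsOn S C i k)) := by
  simp only [diagonal_mul, Matrix.add_apply, rowScale, rowsOn, of_apply]
  by_cases h : i ∈ S
  · simp only [h, if_true, one_mul, diagonal_apply]
    split_ifs
    · simpa using (h0 i h).add_const (C i k)
    · simpa only [zero_add] using tendsto_const_nhds
  · simp only [h, if_false, mul_add, diagonal_apply, one_apply]
    have := (h1 i h).mul_const (C i k)
    rw [zero_mul] at this
    split_ifs
    · simp only [inv_mul_cancel₀ (hg _ i)]
      simpa using this.const_add 1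
    · simpa using this

theorem det_rowsOn_ne_zero {S : Finset ι} {C : Matrix ι ι ℂ}
    (h : ∀ w : ι → ℂ, (∀ i ∉ S, w i = 0) → (∀ i ∈ S, ∑ k, C i k * w k = 0) → w = 0) :
    (rowsOn S C).det ≠ 0 := by
  intro h0
  obtain ⟨w, hw, hw0⟩ := exists_mulVec_eq_zero_iff.2 h0
  refine hw (h w (fun i hi => ?_) fun i hi => ?_)
  · simpa [rowsOn, mulVec, dotProduct, hi, one_apply] using congrFun hw0 i
  · simpa [rowsOn, mulVec, dotProduct, hi] using congrFun hw0 i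

/-- Row scaling cancels in a form when the right vector is scaled too, so the limit can be taken
with normalized rows. -/
theorem form_inv_rowScale {S : Finset ι} {g : ι → ℂ} (hg : ∀ k, g k ≠ 0) (M : Matrix ι ι ℂ)
    (u v : ι → ℂ) : u ⬝ᵥ (M⁻¹ *ᵥ v)
      = u ⬝ᵥ ((diagonal (rowScale S g) * M)⁻¹ *ᵥ fun k => rowScale S g k * v k) := by
  have hu : IsUnit (diagonal (rowScale S g)).det := by
    rw [det_diagonal]
    exact (Finset.prod_ne_zero_iff.2 fun k _ => rowScale_ne_zero hg k).isUnit
  have : (fun k => rowScale S g k * v k) = diagonal (rowScale S g) *ᵥ v := by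
    ext k; rw [mulVec_diagonal]
  rw [this, Matrix.mul_inv_rev, mulVec_mulVec, Matrix.mul_assoc, nonsing_inv_mul _ hu,
    Matrix.mul_one]

theorem tendsto_exp_line_zero (c w : ℂ) {z : ℂ} (hz : 0 < z.re) :
    Tendsto (fun s : ℝ => c * Complex.exp (-(w + s * z))) atTop (𝓝 0) := by
  have : Tendsto (fun s : ℝ => Complex.exp (-(w + s * z))) atTop (𝓝 0) := by
    rw [Complex.tendsto_exp_nhds_zero_iff]
    simp only [Complex.neg_re, Complex.add_re, Complex.re_ofReal_mul]
    exact tendsto_neg_atTop_atBot.comp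
      (tendsto_atTop_add_const_left _ _ (tendsto_id.atTop_mul_const hz))
  simpa using this.const_mul c

theorem tendsto_inv_exp_line_zero (c w : ℂ) {z : ℂ} (hz : z.re < 0) :
    Tendsto (fun s : ℝ => (c * Complex.exp (-(w + s * z)))⁻¹) atTop (𝓝 0) := by
  refine (tendsto_exp_line_zero c⁻¹ (-w) (z := -z) (by simpa using hz)).congr fun s => ?_
  rw [mul_inv, ← Complex.exp_neg]
  congr 2
  ring

end Rays

/-- The point `(ξ, η, t)` which belongs to the real point `(x, y, t)`. -/
def dsPoint (α : ℂ) (x y t : ℝ) : ℂ × ℂ × ℂ := (dsXi α x y, dsEta α x y, t)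

namespace CauchyData

open Matrix Filter

variable {ι : Type*} (D : CauchyData ι)

theorem phase_ray (α : ℂ) (x y t a b s : ℝ) (k : ι) :
    D.phase (dsPoint α (x + s * a) (y + s * b) t) k
      = D.phase (dsPoint α x y t) k + s * D.phase (dsPoint α a b 0) k := by
  simp only [phase, dsPoint, dsXi, dsEta]
  push_cast
  ring

variable [Fintype ι] [DecidableEq ι] {D}

/-- The indices of the phases which increase in the direction `(a, b)`. -/
def increasing (D : CauchyData ι) (α : ℂ) (a b : ℝ) : Finset ι :=
  {k | 0 < (D.phase (dsPoint α a b 0) k).re}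

variable {α : ℂ} {a b : ℝ} (hgen : ∀ k, (D.phase (dsPoint α a b 0) k).re ≠ 0)

include hgen

/-- The constant shift `r` allows `T_0` and `T_1` to be treated together; the limit does not depend
on it. -/
theorem tendsto_shifted_ray (hD : D.Valid) (x y t : ℝ) (r : ι → ℂ) (C : Matrix ι ι ℂ) (i k : ι) :
    Tendsto (fun s : ℝ =>
      (diagonal (rowScale (D.increasing α a b) fun k =>
          D.c k * Complex.exp (-(D.phase (dsPoint α (x + s * a) (y + s * b) t) k + r k)))
        * (diagonal (fun k =>
          D.c k * Complex.exp (-(D.phase (dsPoint α (x + s * a) (y + s * b) t) k + r k))) + C)) i k)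
      atTop (𝓝 (rowsOn (D.increasing α a b) C i k)) := by
  refine tendsto_rowScale_mul (g := fun (s : ℝ) k => D.c k *
    Complex.exp (-(D.phase (dsPoint α (x + s * a) (y + s * b) t) k + r k)))
    (fun s k => mul_ne_zero (hD.c_ne k) (Complex.exp_ne_zero _)) (fun k hk => ?_)
    (fun k hk => ?_) C i k
  · simp only [phase_ray, add_right_comm _ _ (r k)]
    exact tendsto_exp_line_zero _ _ (by simpa [increasing] using hk)
  · simp only [phase_ray, add_right_comm _ _ (r k)]
    exact tendsto_inv_exp_line_zero _ _ (lt_of_le_of_ne (by simpa [increasing] using hk) (hgen k))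

theorem tendsto_mat_ray (hD : D.Valid) (x y t : ℝ) (i k : ι) :
    Tendsto (fun s : ℝ =>
      (diagonal (rowScale (D.increasing α a b) fun k =>
          D.c k * Complex.exp (-D.phase (dsPoint α (x + s * a) (y + s * b) t) k))
        * D.mat (dsPoint α (x + s * a) (y + s * b) t)) i k)
      atTop (𝓝 (rowsOn (D.increasing α a b) D.C i k)) := by
  simpa [mat] using tendsto_shifted_ray hgen hD x y t (fun _ => 0) D.C i k

variable (hdet : (rowsOn (D.increasing α a b) D.C).det ≠ 0)

include hdet

theorem eventually_tau_ne_zero (hD : D.Valid) (x y t : ℝ) :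
    ∀ᶠ s : ℝ in atTop, D.tau (dsPoint α (x + s * a) (y + s * b) t) ≠ 0 := by
  filter_upwards [(tendsto_det (tendsto_mat_ray hgen hD x y t)).eventually_ne hdet] with s hs
  rw [det_mul] at hs
  exact (tau_ne_zero_iff hD).2 (right_ne_zero_of_mul hs)

theorem tendsto_om_ray (hD : D.Valid) (x y t : ℝ) (u v : ι → ℂ) :
    Tendsto (fun s : ℝ => D.om u v (dsPoint α (x + s * a) (y + s * b) t)) atTop
      (𝓝 (u ⬝ᵥ ((rowsOn (D.increasing α a b) D.C)⁻¹ *ᵥ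
        fun k => if k ∈ D.increasing α a b then v k else 0))) := by
  have hg : ∀ (s : ℝ) k, D.c k * Complex.exp (-D.phase (dsPoint α (x + s * a) (y + s * b) t) k) ≠ 0 :=
    fun s k => mul_ne_zero (hD.c_ne k) (Complex.exp_ne_zero _)
  have hlim : ∀ k, Tendsto (fun s : ℝ => rowScale (D.increasing α a b) (fun k =>
      D.c k * Complex.exp (-D.phase (dsPoint α (x + s * a) (y + s * b) t) k)) k * v k) atTop
      (𝓝 (if k ∈ D.increasing α a b then v k else 0)) := by
    refine tendsto_rowScale (fun k hk => ?_) v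
    simp only [phase_ray]
    exact tendsto_inv_exp_line_zero _ _
      (lt_of_le_of_ne (by simpa [increasing] using hk) (hgen k))
  have := tendsto_inv_form (tendsto_mat_ray hgen hD x y t) hdet
    (fun i => (tendsto_const_nhds : Tendsto (fun _ : ℝ => u i) atTop (𝓝 (u i)))) hlim
  refine this.congr fun s => ?_
  exact (form_inv_rowScale (hg s) _ u v).symm

end CauchyData

/-! ### Dark solitons along rays -/

namespace DSParams

open Matrix Filter

variable {ι : Type*} [Fintype ι] [DecidableEq ι] {p : DSParams ι}

theorem A_pos (hp : p.Admissible) : 0 < p.A :=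
  div_pos (Real.sqrt_pos.2 (norm_pos_iff.2 (mul_ne_zero hp.κ₁_ne hp.κ₂_ne)))
    (norm_pos_iff.2 (sub_ne_zero.2 hp.a_ne_b))

theorem det_rowsOn_data_ne_zero (hp : p.Regular) (hu : Function.Injective p.u)
    (hv : Function.Injective p.v) (S : Finset ι) : (rowsOn S (p.data 1).C).det ≠ 0 := by
  refine det_rowsOn_ne_zero fun w hw hC => ?_
  have key := cauchy_mulVec_injective S (w := w) (fun i _ k _ => hp.v_ne_u i k) hv.injOn hu.injOn
    fun i hi => by
      have h1 := hC i hi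
      rw [← Finset.sum_subset (Finset.subset_univ S) fun k _ hk => by rw [hw k hk, mul_zero]] at h1
      refine (mul_eq_zero.1 (?_ : (p.a - p.b) * ∑ k ∈ S, w k / (p.v i - p.u k) = 0)).resolve_left
        (sub_ne_zero.2 hp.a_ne_b)
      rw [← h1, Finset.mul_sum]
      refine Finset.sum_congr rfl fun k _ => ?_
      simp only [data, of_apply]
      ring
  ext k
  by_cases hk : k ∈ S
  · exact key k hk
  · exact hw k hk

/-- Up to a phase, the quotient of `det T_1` and `det T_0` is a quotient of determinants of
matrices with normalized rows. -/
theorem norm_det_T (hp : p.Regular) (S : Finset ι) (β ξ η t : ℂ) :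
    ‖(p.T β ξ η t).det‖ = (∏ k ∈ S, ‖Complex.exp (p.Z ξ η t k) / (p.data 1).c k‖)
      * (∏ k ∈ S, ‖Complex.exp (β * p.r k)‖)
      * ‖(diagonal (rowScale S fun k => (p.data 1).c k * Complex.exp (-(p.Z ξ η t k + β * p.r k)))
        * (diagonal (fun k => (p.data 1).c k * Complex.exp (-(p.Z ξ η t k + β * p.r k)))
          + (p.data 1).C)).det‖ := by
  rw [det_T hp one_ne_zero, det_mul, det_diagonal, norm_mul, norm_mul, ← mul_assoc,
    ← Finset.prod_mul_distrib, norm_prod, norm_prod, ← Finset.prod_mul_prod_compl S,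
    ← Finset.prod_mul_prod_compl S fun k => ‖rowScale S _ k‖]
  congr 1
  have e1 : ∏ k ∈ S, ‖rowScale S (fun k => (p.data 1).c k *
      Complex.exp (-(p.Z ξ η t k + β * p.r k))) k‖ = 1 :=
    Finset.prod_eq_one fun k hk => by simp [rowScale, hk]
  rw [e1, one_mul]
  congr 1
  · refine Finset.prod_congr rfl fun k _ => ?_
    rw [← norm_mul, Complex.exp_add]
    congr 1
    ring
  · refine Finset.prod_congr rfl fun k hk => ?_
    rw [rowScale, if_neg (Finset.mem_compl.1 hk), Complex.exp_neg, mul_inv, inv_inv, mul_comm,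
      div_eq_mul_inv, mul_comm]

/-- After normalization both determinants tend to the same non-zero Cauchy-type limit. The
prefactors differ by factors `|e^{r_k}| = 1`, so the quotient has modulus tending to `1`. -/
theorem hasSolitonBackground (hp : p.Regular) (hu : Function.Injective p.u)
    (hv : Function.Injective p.v) {α : ℂ} (hr : ∀ k, ‖Complex.exp (p.r k)‖ = 1)
    (hwave : ∀ x y t : ℝ, ((p.data 1).wave p.h (dsPoint α x y t)).re = 0) :
    HasSolitonBackground α p.Z p.tau p.psi p.A := by
  intro x y t a b hgen
  have hD := data_valid hp one_ne_zero
  have hph : ∀ x y t k, (p.data 1).phase (dsPoint α x y t) k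
      = p.Z (dsXi α x y) (dsEta α x y) t k := fun x y t k => data_phase hp one_ne_zero _ _ _ k
  have hgen' : ∀ k, ((p.data 1).phase (dsPoint α a b 0) k).re ≠ 0 := fun k => by
    rw [hph]; simpa using hgen k
  set S := (p.data 1).increasing α a b with hS
  have hdet := det_rowsOn_data_ne_zero hp hu hv S
  have hlim : ∀ β : ℂ, Tendsto (fun s : ℝ =>
      ‖(diagonal (rowScale S fun k => (p.data 1).c k * Complex.exp (-(p.Z (dsXi α (x + s * a)
          (y + s * b)) (dsEta α (x + s * a) (y + s * b)) t k + β * p.r k)))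
        * (diagonal (fun k => (p.data 1).c k * Complex.exp (-(p.Z (dsXi α (x + s * a)
          (y + s * b)) (dsEta α (x + s * a) (y + s * b)) t k + β * p.r k)))
          + (p.data 1).C)).det‖) atTop (𝓝 ‖(rowsOn S (p.data 1).C).det‖) := by
    intro β
    have := CauchyData.tendsto_shifted_ray hgen' hD x y t (fun k => β * p.r k) (p.data 1).C
    simp only [hph] at this
    exact (tendsto_det this).norm
  refine ⟨?_, ?_⟩
  · filter_upwards [CauchyData.eventually_tau_ne_zero hgen' hdet hD x y t] with s hs
    rw [dsRegularSet, Set.mem_ofPred_eq]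
    rwa [dsPoint, data_tau hp one_ne_zero] at hs
  · have h1 := ((hlim 1).div (hlim 0) (norm_ne_zero_iff.2 hdet)).const_mul p.A
    rw [div_self (norm_ne_zero_iff.2 hdet), mul_one] at h1
    refine h1.congr fun s => ?_
    have hw := hwave (x + s * a) (y + s * b) t
    have hw' : ‖Complex.exp (-Complex.I * (p.G₁ * dsXi α (x + s * a) (y + s * b)
        + p.G₂ * dsEta α (x + s * a) (y + s * b) - p.G₃ * ((t : ℂ) / 2)))‖ = 1 := by
      rw [Complex.norm_exp, Real.exp_eq_one_iff, ← hw]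
      congr 1
      have hab := sub_ne_zero.2 hp.a_ne_b
      have hba := sub_ne_zero.2 hp.a_ne_b.symm
      have g1 : p.G₁ = -((p.data 1).κ₁ * (p.data 1).l) := by
        simp only [G₁, data]; field_simp; ring
      have g2 : p.G₂ = (p.data 1).κ₂ * (p.data 1).l := by
        simp only [G₂, data]; field_simp
      simp only [CauchyData.wave, dsPoint, G₃, g1, g2]
      ring
    have hA : ‖(p.A : ℂ)‖ = p.A := by
      rw [Complex.norm_real, Real.norm_of_nonneg]
      unfold A; positivity
    have hθ : ‖Complex.exp (Complex.I * p.θ)‖ = 1 := by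
      rw [mul_comm, Complex.norm_exp_ofReal_mul_I]
    rw [psi, norm_mul, norm_mul, norm_mul, hw', hA, hθ, norm_div, norm_det_T hp S,
      norm_det_T hp S]
    simp only [one_mul, zero_mul, Complex.exp_zero, norm_one, Finset.prod_const_one, hr, mul_one]
    rw [mul_div_mul_left]
    · rfl
    · exact Finset.prod_ne_zero_iff.2 fun k _ => norm_ne_zero_iff.2
        (div_ne_zero (Complex.exp_ne_zero _) (hD.c_ne k))

/-- Each of the two factors of `e^{r_k}` has modulus one, because `v_k` and `u_k` are equidistant
from every real point. -/
theorem DarkRealityDS1.norm_exp_r (h : p.DarkRealityDS1) (hp : p.Admissible) (k : ι) :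
    ‖Complex.exp (p.r k)‖ = 1 := by
  have hr := h.regular hp
  have e1 : ‖p.b - p.v k‖ = ‖p.b - p.u k‖ := by
    rw [← RCLike.norm_conj (p.b - p.v k), map_sub, h.b_real, h.conj_v]
  have e2 : ‖p.a - p.v k‖ = ‖p.a - p.u k‖ := by
    rw [← RCLike.norm_conj (p.a - p.v k), map_sub, h.a_real, h.conj_v]
  rw [exp_r hr, norm_mul, norm_div, norm_div, e1, e2,
    div_self (norm_ne_zero_iff.2 (sub_ne_zero.2 (hr.b_ne_u k))),
    div_self (norm_ne_zero_iff.2 (sub_ne_zero.2 (hr.a_ne_u k))), one_mul]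

/-- A real point is equidistant from the conjugate points `a` and `b`, so the moduli of the two
factors are reciprocal. -/
theorem DarkRealityDS2.norm_exp_r (h : p.DarkRealityDS2) (hp : p.Admissible) (k : ι) :
    ‖Complex.exp (p.r k)‖ = 1 := by
  have hr := h.regular hp
  have e1 : ‖p.b - p.v k‖ = ‖p.a - p.v k‖ := by
    rw [← RCLike.norm_conj (p.b - p.v k), map_sub, h.conj_b, h.v_real]
  have e2 : ‖p.b - p.u k‖ = ‖p.a - p.u k‖ := by
    rw [← RCLike.norm_conj (p.b - p.u k), map_sub, h.conj_b, h.u_real]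
  rw [exp_r hr, norm_mul, norm_div, norm_div, e1, e2, div_mul_div_comm, mul_comm,
    div_self (mul_ne_zero (norm_ne_zero_iff.2 (sub_ne_zero.2 (hr.a_ne_u k)))
      (norm_ne_zero_iff.2 (sub_ne_zero.2 (hr.a_ne_v k))))]

theorem DarkRealityDS1.hasSolitonBackground (h : p.DarkRealityDS1) (hp : p.Admissible)
    (hv : Function.Injective p.v) : HasSolitonBackground Complex.I p.Z p.tau p.psi p.A := by
  refine DSParams.hasSolitonBackground (h.regular hp) (fun i k e => hv ?_) hv (h.norm_exp_r hp)
    fun x y t => h.data_real.re_wave (CauchyData.conj_dsXi_I x y) (CauchyData.conj_dsEta_I x y)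
      (Complex.conj_ofReal t) _
  rw [← h.conj_u, ← h.conj_u, e]

theorem DarkRealityDS2.hasSolitonBackground (h : p.DarkRealityDS2) (hp : p.Admissible)
    (hu : Function.Injective p.u) (hv : Function.Injective p.v) :
    HasSolitonBackground 1 p.Z p.tau p.psi p.A :=
  DSParams.hasSolitonBackground (h.regular hp) hu hv (h.norm_exp_r hp)
    fun x y t => h.data_real.re_wave (CauchyData.conj_dsXi_one x y) (CauchyData.conj_dsEta_one x y)
      (Complex.conj_ofReal t) _

end DSParams

/-! ### Bright solitons along rays -/

namespace BrightParams

open Matrix Filter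

variable {N : ℕ} {q : BrightParams N}

/-- One of the two blocks of the limit matrix: a Cauchy matrix in the inverse parameters. -/
theorem eq_zero_of_inv_cauchy {S : Finset (Fin N)} {v u w : Fin N → ℂ} (hv0 : ∀ i, v i ≠ 0)
    (hu0 : ∀ i, u i ≠ 0) (hvu : ∀ i k, v i ≠ u k) (hv : Function.Injective v)
    (hu : Function.Injective u) (hw : ∀ i ∉ S, w i = 0)
    (h : ∀ i ∈ S, ∑ k, v i * u k / (u k - v i) * w k = 0) : w = 0 := by
  have key := cauchy_mulVec_injective S (v := fun i => (v i)⁻¹) (u := fun i => (u i)⁻¹) (w := w)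
    (fun i _ k _ e => hvu i k (inv_injective e)) (inv_injective.comp hv).injOn
    (inv_injective.comp hu).injOn fun i hi => by
      have h1 := h i hi
      rw [← Finset.sum_subset (Finset.subset_univ S) fun k _ hk => by rw [hw k hk, mul_zero]] at h1
      rw [← h1]
      refine Finset.sum_congr rfl fun k _ => ?_
      have h2 := hv0 i
      have h3 := hu0 k
      have h4 := sub_ne_zero.2 (hvu i k).symm
      have h5 : (v i)⁻¹ - (u k)⁻¹ = (u k - v i) / (v i * u k) := by field_simp
      rw [h5]
      field_simp
  ext k
  by_cases hk : k ∈ S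
  · exact key k hk
  · exact hw k hk

/-- The `α`'s are distinct among each of the four families. -/
structure Distinct (q : BrightParams N) : Prop where
  u_inl : Function.Injective fun k => q.αu (.inl k)
  u_inr : Function.Injective fun k => q.αu (.inr k)
  v_inl : Function.Injective fun k => q.αv (.inl k)
  v_inr : Function.Injective fun k => q.αv (.inr k)

theorem injective_of_conj {ι : Type*} {f g : ι → ℂ} (hf : Function.Injective f)
    (h : ∀ k, conj (f k) = g k) : Function.Injective g := by
  intro i k e
  rw [← h, ← h] at e
  exact hf ((starRingEnd ℂ).injective e)

/-- `C` couples only indices of opposite parity, so the kernel equations split into two Cauchy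
systems. They are square because `S` contains both or neither index of each pair. -/
theorem det_rowsOn_data_ne_zero (hq : q.Admissible) (hd : q.Distinct)
    {S : Finset (Fin N ⊕ Fin N)} (hS : ∀ k, .inl k ∈ S ↔ .inr k ∈ S) :
    (rowsOn S q.data.C).det ≠ 0 := by
  refine det_rowsOn_ne_zero fun w hw hC => ?_
  have h1 : (fun k => w (.inr k)) = 0 := by
    refine eq_zero_of_inv_cauchy (S := Finset.univ.filter fun k => Sum.inr k ∈ S)
      (v := fun k => q.αv (.inl k)) (u := fun k => q.αu (.inr k)) (fun _ => hq.αv_ne _)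
      (fun _ => hq.αu_ne _) hq.odd_even hd.v_inl hd.u_inr (fun i hi => hw _ (by simpa using hi))
      fun i hi => ?_
    have := hC (.inl i) ((hS i).2 (by simpa using hi))
    simpa [data, Fintype.sum_sum_type] using this
  have h2 : (fun k => w (.inl k)) = 0 := by
    refine eq_zero_of_inv_cauchy (S := Finset.univ.filter fun k => Sum.inl k ∈ S)
      (v := fun k => q.αv (.inr k)) (u := fun k => q.αu (.inl k)) (fun _ => hq.αv_ne _)
      (fun _ => hq.αu_ne _) hq.even_odd hd.v_inr hd.u_inl (fun i hi => hw _ (by simpa using hi))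
      fun i hi => ?_
    have := hC (.inr i) ((hS i).1 (by simpa using hi))
    simpa [data, Fintype.sum_sum_type] using this
  ext (k | k)
  · exact congrFun h2 k
  · exact congrFun h1 k

/-- The reason for the decay. The vectors `bu` and `av` live on even indices, whereas the even part
of the solution `x` is determined by equations with zero right-hand side: the odd rows in `S` and
the even identity rows off `S`. -/
theorem form_rowsOn_eq_zero {S : Finset (Fin N ⊕ Fin N)} (hdet : (rowsOn S q.data.C).det ≠ 0) :
    q.data.bu ⬝ᵥ ((rowsOn S q.data.C)⁻¹ *ᵥ fun k => if k ∈ S then q.data.av k else 0) = 0 := by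
  set y : Fin N ⊕ Fin N → ℂ := fun k => if k ∈ S then q.data.av k else 0 with hy
  set x := (rowsOn S q.data.C)⁻¹ *ᵥ y with hx
  have hMx : rowsOn S q.data.C *ᵥ x = y := by
    rw [hx, mulVec_mulVec, mul_nonsing_inv _ hdet.isUnit, one_mulVec]
  -- Setting the odd components of `x` to zero gives a vector killed by the invertible limit matrix.
  have h0 : (Sum.elim (fun _ => 0) (fun k => x (.inr k)) : Fin N ⊕ Fin N → ℂ) = 0 := by
    refine eq_zero_of_mulVec_eq_zero hdet ?_
    ext (i | i)
    · have := congrFun hMx (.inl i)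
      by_cases hi : Sum.inl i ∈ S
      · simpa [mulVec, dotProduct, Fintype.sum_sum_type, rowsOn, hi, hy, data] using this
      · simp [mulVec, dotProduct, Fintype.sum_sum_type, rowsOn, hi]
    · have := congrFun hMx (.inr i)
      by_cases hi : Sum.inr i ∈ S
      · simp [mulVec, dotProduct, Fintype.sum_sum_type, rowsOn, hi, data]
      · simpa [mulVec, dotProduct, Fintype.sum_sum_type, rowsOn, hi, hy, one_apply] using this
  have h1 : ∀ k, x (.inr k) = 0 := fun k => congrFun h0 (.inr k)
  simp [dotProduct, Fintype.sum_sum_type, data, h1]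

variable [NeZero N]

theorem hasSolitonBackground (hq : q.Admissible) (hd : q.Distinct) {α : ℂ}
    (hphase : ∀ (x y t : ℝ) k, conj (q.data.phase (dsPoint α x y t) k)
      = q.data.phase (dsPoint α x y t) (Equiv.sumComm _ _ k))
    (hwave : ∀ x y t : ℝ, (q.data.wave q.h (dsPoint α x y t)).re = 0) :
    HasSolitonBackground α q.Z q.tau q.psi 0 := by
  intro x y t a b hgen
  have hD := data_valid hq
  have hph : ∀ x y t k, q.data.phase (dsPoint α x y t) k
      = q.Z (dsXi α x y) (dsEta α x y) t k := fun x y t k => data_phase _ _ _ k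
  have hgen' : ∀ k, (q.data.phase (dsPoint α a b 0) k).re ≠ 0 := fun k => by
    rw [hph]; simpa using hgen k
  -- The two phases of a pair are conjugate, so they grow together along the ray.
  have hS : ∀ k, Sum.inl k ∈ q.data.increasing α a b ↔ Sum.inr k ∈ q.data.increasing α a b := by
    intro k
    have := congrArg Complex.re (hphase a b 0 (.inl k))
    rw [Complex.conj_re, Equiv.sumComm_apply, Sum.swap_inl] at this
    simp [CauchyData.increasing, this]
  have hdet := det_rowsOn_data_ne_zero hq hd hS
  have hτ := CauchyData.eventually_tau_ne_zero hgen' hdet hD x y t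
  simp only [dsPoint, data_tau hq] at hτ
  refine ⟨hτ, ?_⟩
  have hG := CauchyData.tendsto_om_ray hgen' hdet hD x y t q.data.bu q.data.av
  rw [form_rowsOn_eq_zero hdet] at hG
  have := hG.norm.const_mul ‖(Real.sqrt ‖q.κ₁ * q.κ₂‖ : ℂ) * Complex.exp (Complex.I * q.θ)‖
  rw [norm_zero, mul_zero] at this
  refine this.congr' ?_
  filter_upwards [hτ] with s hs
  have hw : ‖Complex.exp (q.data.wave q.h (dsXi α (x + s * a) (y + s * b),
      dsEta α (x + s * a) (y + s * b), (t : ℂ)))‖ = 1 := by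
    rw [Complex.norm_exp, Real.exp_eq_one_iff]
    exact hwave (x + s * a) (y + s * b) t
  have hl : q.data.l = 0 := rfl
  rw [data_Psi hq hs, CauchyData.Psi, CauchyData.G, hl, zero_sub, mul_neg, neg_mul, norm_neg,
    norm_mul _ (Complex.exp (q.data.wave _ _)), hw, mul_one, norm_mul _ (q.data.om _ _ _)]
  rfl

theorem RealityDS1.hasSolitonBackground (h : q.RealityDS1) (hq : q.Admissible)
    (hu : Function.Injective fun k => q.αu (.inl k))
    (hv : Function.Injective fun k => q.αv (.inl k)) :
    HasSolitonBackground Complex.I q.Z q.tau q.psi 0 := by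
  refine BrightParams.hasSolitonBackground hq
    ⟨hu, injective_of_conj hv fun k => ?_, hv, injective_of_conj hu h.conj_αu_odd⟩
    (fun x y t => h.data_real.conj_phase (CauchyData.conj_dsXi_I x y) (CauchyData.conj_dsEta_I x y)
      (Complex.conj_ofReal t))
    fun x y t => h.data_real.re_wave (CauchyData.conj_dsXi_I x y) (CauchyData.conj_dsEta_I x y)
      (Complex.conj_ofReal t) _
  rw [← h.conj_αu_even, Complex.conj_conj]

theorem RealityDS2.hasSolitonBackground (h : q.RealityDS2) (hq : q.Admissible)
    (hu : Function.Injective fun k => q.αu (.inl k))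
    (hv : Function.Injective fun k => q.αv (.inl k)) :
    HasSolitonBackground 1 q.Z q.tau q.psi 0 :=
  BrightParams.hasSolitonBackground hq
    ⟨hu, injective_of_conj hu h.conj_αu, hv, injective_of_conj hv h.conj_αv⟩
    (fun x y t => h.data_real.conj_phase (CauchyData.conj_dsXi_one x y)
      (CauchyData.conj_dsEta_one x y) (Complex.conj_ofReal t))
    fun x y t => h.data_real.re_wave (CauchyData.conj_dsXi_one x y) (CauchyData.conj_dsEta_one x y)
      (Complex.conj_ofReal t) _

end BrightParams

end

theorem mainTheorem7 (N : ℕ) [NeZero N] :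
    -- Dark `N`-solitons of DS1: globally smooth solutions.
    (∀ p : DSParams (Fin N), p.Admissible → p.DarkRealityDS1 →
      (∀ x y t : ℝ, p.tau (dsXi Complex.I x y) (dsEta Complex.I x y) t ≠ 0) ∧
      SolvesDSOn Complex.I (-Real.sign (p.κ₁.re * p.κ₂.re)) Set.univ p.psi p.phi ∧
      (Function.Injective p.v →
        0 < p.A ∧ HasSolitonBackground Complex.I p.Z p.tau p.psi p.A)) ∧
    -- Dark `N`-solitons of DS2 with `ρ = 1`: solutions wherever the denominator does not vanish,
    -- hence globally smooth solutions if the real points are interlaced.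
    (∀ p : DSParams (Fin N), p.Admissible → p.DarkRealityDS2 →
      SolvesDSOn 1 1 (dsRegularSet 1 p.tau) p.psi p.phi ∧
      (p.Ordered → ∀ x y t : ℝ, p.tau (dsXi 1 x y) (dsEta 1 x y) t ≠ 0) ∧
      (p.Ordered → SolvesDSOn 1 1 Set.univ p.psi p.phi) ∧
      (Function.Injective p.u → Function.Injective p.v →
        0 < p.A ∧ HasSolitonBackground 1 p.Z p.tau p.psi p.A)) ∧
    -- The further degeneration: the determinantal functions tend to the bright ones.
    (∀ q : BrightParams N, q.Admissible → ∀ a b : ℂ, a ≠ b →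
      ∀ ξ η t : ℂ, q.tau ξ η t ≠ 0 →
        Filter.Tendsto (fun ε : ℝ => (q.degenerating a b ε).psi ξ η t) (𝓝[>] 0)
          (𝓝 (q.psi ξ η t)) ∧
        Filter.Tendsto (fun ε : ℝ => (q.degenerating a b ε).phi ξ η t) (𝓝[>] 0)
          (𝓝 (q.phi ξ η t))) ∧
    -- Bright `N`-solitons of DS1.
    (∀ q : BrightParams N, q.Admissible → q.RealityDS1 →
      SolvesDSOn Complex.I (-Real.sign (q.κ₁.re * q.κ₂.re)) (dsRegularSet Complex.I q.tau)
        q.psi q.phi ∧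
      (Function.Injective (fun k => q.αu (.inl k)) → Function.Injective (fun k => q.αv (.inl k)) →
        HasSolitonBackground Complex.I q.Z q.tau q.psi 0)) ∧
    -- Bright `N`-solitons of DS2 with `ρ = -1`.
    (∀ q : BrightParams N, q.Admissible → q.RealityDS2 →
      SolvesDSOn 1 (-1) (dsRegularSet 1 q.tau) q.psi q.phi ∧
      (Function.Injective (fun k => q.αu (.inl k)) → Function.Injective (fun k => q.αv (.inl k)) →
        HasSolitonBackground 1 q.Z q.tau q.psi 0)) := by
  refine ⟨fun p hp h => ⟨h.tau_ne_zero hp, ?_, fun hv => ⟨DSParams.A_pos hp,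
    h.hasSolitonBackground hp hv⟩⟩, fun p hp h => ⟨?_, fun ho => h.tau_ne_zero hp ho, fun ho => ?_,
    fun hu hv => ⟨DSParams.A_pos hp, h.hasSolitonBackground hp hu hv⟩⟩,
    fun q hq a b hab ξ η t hτ => BrightParams.tendsto_degenerating hq hab hτ,
    fun q hq h => ⟨BrightParams.solvesDS1 hq h, h.hasSolitonBackground hq⟩,
    fun q hq h => ⟨BrightParams.solvesDS2 hq h, h.hasSolitonBackground hq⟩⟩
  · exact DSParams.solvesDS1 hp h isOpen_univ fun x _ => h.tau_ne_zero hp x.1 x.2.1 x.2.2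
  · exact DSParams.solvesDS2 hp h (DSParams.isOpen_regular (h.regular hp) 1) subset_rfl
  · exact DSParams.solvesDS2 hp h isOpen_univ fun x _ => h.tau_ne_zero hp ho x.1 x.2.1 x.2.2
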